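/- For a field $K$, a pair $\mathcal Q=(\mathcal I,\mathcal J)$ of a collection $\mathcal I$ of $3$-element subsets and a collection $\mathcal J$ of $6$-element subsets of $\{1,\dots,8\}$ is called \emph{representable over $K$} if there are eight distinct points $p_1,\dots,p_8\in\mathbb P^2_K$ such that a triple $\{p_i\}_{i\in I}$ lies on a line if and only if $I\in\mathcal I$, and a sextuple $\{p_j\}_{j\in J}$ lies on an irreducible conic if and only if $J\in\mathcal J$. The pair $\mathcal Q$ is a \emph{candidate quatroid} if (i) it is matroidal: there is some $\mathcal J'$ such that $(\mathcal I,\mathcal J')$ is representable over $\mathbb C$; and (ii) it satisfies Bézout's weak criteria: $|I\cap J|\le 2$ for all $I\in\mathcal I$, $J\in\mathcal J$; if $I_1,I_2\in\mathcal I$ and $|I_1\cap I_2|>1$ then every $3$-subset of $I_1\cup I_2$ is in $\mathcal I$; if $J_1,J_2\in\mathcal J$ and $|J_1\cap J_2|>4$ then every $6$-subset of $J_1\cup J_2$ is in $\mathcal J$. The symmetric group $\mathfrak S_8$ acts on pairs by permuting the labels. Put (writing $123$ for $\{1,2,3\}$, etc.) $$\mathcal Q_{41}=(\{123,145,167,246,258,357,368,478\},\emptyset)\quad\text{(the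 MacLane matroid)},$$ $$\mathcal Q_{63}=(\{123,145,246,356\},\{125678,134678,234578\})\quad\text{(the Fano candidate)}.$$ \textbf{Theorem.} A candidate quatroid is representable over $\mathbb Q$ if and only if it lies neither in the $\mathfrak S_8$-orbit of $\mathcal Q_{41}$ nor in that of $\mathcal Q_{63}$. Every pair in the orbit of $\mathcal Q_{41}$ is a candidate quatroid which is representable over $\mathbb C$ but not over $\mathbb R$. Every pair in the orbit of $\mathcal Q_{63}$ is a candidate quatroid which is not representable over $\mathbb C$. -/

import Mathlib

open scoped LinearAlgebra.Projectivization Pointwise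

namespace Quatroid

/-- A pair `𝒬 = (ℐ, 𝒥)`: a collection `ℐ` of triples and a collection `𝒥` of sextuples of an
eight-element set. The labels `1, 2, …, 8` are represented by the elements `0, 1, …, 7` of
`Fin 8`. -/
@[ext]
structure QPair where
  /-- The collection of triples. -/
  triples : Finset (Finset (Fin 8))
  /-- The collection of sextuples. -/
  sextuples : Finset (Finset (Fin 8))
  card_triple : ∀ I ∈ triples, I.card = 3
  card_sextuple : ∀ J ∈ sextuples, J.card = 6

/-- The natural action of the symmetric group by relabelling. -/
instance : MulAction (Equiv.Perm (Fin 8)) QPair where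
  smul σ Q :=
    { triples := σ • Q.triples
      sextuples := σ • Q.sextuples
      card_triple := by
        intro I hI
        obtain ⟨I', hI', rfl⟩ := Finset.mem_smul_finset.1 hI
        rw [Finset.card_smul_finset]
        exact Q.card_triple I' hI'
      card_sextuple := by
        intro J hJ
        obtain ⟨J', hJ', rfl⟩ := Finset.mem_smul_finset.1 hJ
        rw [Finset.card_smul_finset]
        exact Q.card_sextuple J' hJ' }
  one_smul Q := QPair.ext (one_smul _ Q.triples) (one_smul _ Q.sextuples)
  mul_smul σ τ Q := QPair.ext (mul_smul σ τ Q.triples) (mul_smul σ τ Q.sextuples)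

section Plane

variable {K : Type*} [Field K]

/-- The points of `p` indexed by `S` lie on a line of the projective plane over `K`. A line is
given by its coefficient vector up to scaling, and incidence is the vanishing of the linear form. -/
def OnLine (p : Fin 8 → ℙ K (Fin 3 → K)) (S : Finset (Fin 8)) : Prop :=
  ∃ l : ℙ K (Fin 3 → K), ∀ i ∈ S, Projectivization.orthogonal l (p i)

/-- The points of `p` indexed by `S` lie on an irreducible conic of the projective plane over `K`.
As `F` is homogeneous, its vanishing at a point does not depend on the representative vector. -/
def OnConic (p : Fin 8 → ℙ K (Fin 3 → K)) (S : Finset (Fin 8)) : Prop :=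
  ∃ F : MvPolynomial (Fin 3) K, F.IsHomogeneous 2 ∧ Irreducible F ∧
    ∀ i ∈ S, MvPolynomial.eval (p i).rep F = 0

/-- The configuration `p` represents the pair `Q` over `K`: the eight points are distinct, the
collinear triples are exactly those of `Q`, and the sextuples lying on an irreducible conic are
exactly those of `Q`. -/
def Represents (p : Fin 8 → ℙ K (Fin 3 → K)) (Q : QPair) : Prop :=
  Function.Injective p ∧
  (∀ I : Finset (Fin 8), I.card = 3 → (OnLine p I ↔ I ∈ Q.triples)) ∧
  (∀ J : Finset (Fin 8), J.card = 6 → (OnConic p J ↔ J ∈ Q.sextuples))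

end Plane

/-- The pair `Q` is representable over the field `K`. -/
def Representable (K : Type*) [Field K] (Q : QPair) : Prop :=
  ∃ p : Fin 8 → ℙ K (Fin 3 → K), Represents p Q

/-- The pair `(ℐ, 𝒥)` is matroidal: the realization space over `ℂ` of the matroid with
three-element nonbases `ℐ`, i.e. the union over all `𝒥'` of the realization spaces of
`(ℐ, 𝒥')`, is nonempty. -/
def IsMatroidal (Q : QPair) : Prop :=
  ∃ Q' : QPair, Q'.triples = Q.triples ∧ Representable ℂ Q'

/-- Bézout's weak criteria. -/
structure WeakBezout (Q : QPair) : Prop where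
  /-- A line and a conic meet in at most two points. -/
  line_conic : ∀ I ∈ Q.triples, ∀ J ∈ Q.sextuples, (I ∩ J).card ≤ 2
  /-- Two lines meet in at most one point. -/
  line_line : ∀ I₁ ∈ Q.triples, ∀ I₂ ∈ Q.triples, 1 < (I₁ ∩ I₂).card →
    ∀ I ⊆ I₁ ∪ I₂, I.card = 3 → I ∈ Q.triples
  /-- Two conics meet in at most four points. -/
  conic_conic : ∀ J₁ ∈ Q.sextuples, ∀ J₂ ∈ Q.sextuples, 4 < (J₁ ∩ J₂).card →
    ∀ J ⊆ J₁ ∪ J₂, J.card = 6 → J ∈ Q.sextuples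

/-- Candidate quatroids. -/
def IsCandidate (Q : QPair) : Prop :=
  IsMatroidal Q ∧ WeakBezout Q

/-- The MacLane matroid `({123, 145, 167, 246, 258, 357, 368, 478}, {})`, every label lowered
by one. -/
def Q41 : QPair where
  triples := {{0, 1, 2}, {0, 3, 4}, {0, 5, 6}, {1, 3, 5}, {1, 4, 7}, {2, 4, 6}, {2, 5, 7},
    {3, 6, 7}}
  sextuples := ∅
  card_triple := by
    simp only [Finset.mem_insert, Finset.mem_singleton, forall_eq_or_imp, forall_eq]; decide
  card_sextuple := by simp

/-- The Fano candidate `({123, 145, 246, 356}, {125678, 134678, 234578})`, every label lowered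
by one. -/
def Q63 : QPair where
  triples := {{0, 1, 2}, {0, 3, 4}, {1, 3, 5}, {2, 4, 5}}
  sextuples := {{0, 1, 4, 5, 6, 7}, {0, 2, 3, 5, 6, 7}, {1, 2, 3, 4, 6, 7}}
  card_triple := by
    simp only [Finset.mem_insert, Finset.mem_singleton, forall_eq_or_imp, forall_eq]; decide
  card_sextuple := by
    simp only [Finset.mem_insert, Finset.mem_singleton, forall_eq_or_imp, forall_eq]; decide

end Quatroid

/-! The proof joins a finite classification of the pairs satisfying Bézout's weak criteria with
explicit coordinates for all but two of its classes and two arguments of elementary projective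
geometry.

Classification. Two distinct triples with two common elements are faces of one 4-set, two distinct
sextuples with five common elements are faces of one 7-set. Hence the weak criteria say that a 4-set
or a 7-set with two faces in the family has all its faces there, and that no triple of the family
lies inside a sextuple of it (`IsBezout`). The triples are enumerated label by label. At each stage
the triples through the new label are decided by a backtracking search, and every outcome is carried
by a permutation to a short list of masks; these lists have 2, 3, 5, 10, 24 and 69 entries for 3 to
8 labels. Two of the 69 contain a Fano plane. They are discarded because the diagonal points of a
quadrangle are not collinear in characteristic different from two (`not_onLine_diagonal`); this is
where matroidality enters. Adding sextuples to the other 67 leads to the 126 masks in `targets`. The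
search is needed only in one direction: the branch that follows a given family is never cut
(`exists_mem_search`). The permutations are supplied as data and checked, so nothing about their
origin has to be proved.

Coordinates. Collinearity is the vanishing of a determinant. Six points of which no three are
collinear lie on an irreducible conic if and only if the quadratic transformation based at three of
them sends the other three to collinear points (`IsLift.conicBracket_eq_zero_of_onConic`,
`IsLift.onConic_of_conicBracket_eq_zero`). A configuration with coordinates in a subring is
therefore verified by exact arithmetic (`representable_of_checkConfig`). For 124 masks there are
eight integral vectors, which serve every field of characteristic zero.

Exceptions. In a projective frame the lines of the MacLane matroid force a ratio of coordinates to
be a root of t² - t + 1; such a root exists in the complex numbers, but in no ordered field. For the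
Fano candidate, the four lines form a complete quadrilateral, in suitable coordinates ±x ± y ± z =
0. Each conic passes through two of the three pairs of opposite vertices and through the two
remaining points. With the coordinates of a point read as the sides of a triangle, the conics say by
the law of cosines that the two points have triangles with equal angles. Then the triangles are
similar and the two points coincide (`proportional_of_conics`). -/

namespace Quatroid

/-! ### Subsets of `Fin 8` as numbers, families of subsets as bit masks -/

/-- The `i`-th binary digit of `m`. -/
def hasBit (m i : ℕ) : Bool := Nat.beq (Nat.land (Nat.shiftRight m i) 1) 1

/-- `hasBit` is spelled with operations that the kernel evaluates directly on numerals; this lemma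
passes to `Nat.testBit`, for which the proofs argue. -/
theorem hasBit_eq_testBit (m i : ℕ) : hasBit m i = m.testBit i := by
  rw [Bool.eq_iff_iff]
  have h : Nat.land (Nat.shiftRight m i) 1 = (m >>> i) % 2 := Nat.and_one_is_mod _
  simp only [hasBit, h, Nat.beq_eq, Nat.testBit_eq_decide_div_mod_eq, Nat.shiftRight_eq_div_pow,
    decide_eq_true_eq]

/-- Evaluates the argument before it is passed on. -/
def strict {α : Type} (n : ℕ) (k : ℕ → α) : α := Nat.casesOn n (k 0) fun m => k (m + 1)

/-- The case distinction in `strict` only forces the kernel to reduce `n` to a numeral; logically it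
is application of `k`. -/
theorem strict_eq {α : Type} (n : ℕ) (k : ℕ → α) : strict n k = k n := by cases n <;> rfl

/-- The mask `m`, shifted by 32 digits to make room for a remainder of it. The remainder carries no
information, it gives different masks different lowest digits, by which the kernel hashes them. -/
def pack (m : ℕ) : ℕ := Nat.lor (Nat.shiftLeft m 32) (Nat.mod m 4294967291)

theorem pack_shiftRight (m : ℕ) : pack m >>> 32 = m := by
  have h : pack m = m <<< 32 ||| m % 4294967291 := rfl
  -- The modulus is `2 ^ 32 - 5`, so the remainder fits into the 32 digits that the shift removes.
  have h2 : m % 4294967291 < 2 ^ 32 := (Nat.mod_lt _ (by norm_num)).trans (by norm_num)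
  rw [h, Nat.shiftRight_or_distrib, Nat.shiftLeft_shiftRight, Nat.shiftRight_eq_zero _ _ h2,
    Nat.or_zero]

/-- The `i`-th binary digit of the packed mask `n`. -/
def look (n i : ℕ) : Bool := hasBit (Nat.shiftRight n 32) i

theorem look_eq_testBit (n i : ℕ) : look n i = (n >>> 32).testBit i := hasBit_eq_testBit _ _

/-- Adds the digit `c` to a packed mask. -/
def insertBit (n c : ℕ) : ℕ := pack (Nat.lor (Nat.shiftRight n 32) (Nat.pow 2 c))

theorem testBit_insertBit (n c d : ℕ) :
    (insertBit n c >>> 32).testBit d = true ↔ (n >>> 32).testBit d = true ∨ c = d := by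
  have h : insertBit n c = pack (n >>> 32 ||| 2 ^ c) := rfl
  rw [h, pack_shiftRight, Nat.testBit_or, Nat.testBit_two_pow, Bool.or_eq_true, decide_eq_true_eq]

/-- The number whose binary digits `1` are at the places listed in `l`. -/
def code (l : List ℕ) : ℕ := l.foldr (fun i a => Nat.lor (Nat.pow 2 i) a) 0

theorem testBit_code (l : List ℕ) (i : ℕ) : (code l).testBit i = true ↔ i ∈ l := by
  induction l with
  | nil => simp [code]
  | cons a l ih =>
    have h : code (a :: l) = 2 ^ a ||| code l := rfl
    rw [h, Nat.testBit_or, Bool.or_eq_true, ih, Nat.testBit_two_pow, decide_eq_true_eq,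
      List.mem_cons, eq_comm]

/-- The subset of `Fin 8` with the given code. -/
def members (c : ℕ) : Finset (Fin 8) := Finset.univ.filter fun i => c.testBit i = true

theorem mem_members (c : ℕ) (i : Fin 8) : i ∈ members c ↔ c.testBit i = true := by
  simp [members]

theorem mem_members_code (l : List ℕ) (i : Fin 8) : i ∈ members (code l) ↔ (i : ℕ) ∈ l := by
  rw [mem_members, testBit_code]

/-- The mask of all codes of lists in `V` that satisfy `f`. -/
def collect (V : List (List ℕ)) (f : List ℕ → Bool) : ℕ :=
  V.foldr (fun l a => bif f l then Nat.lor (Nat.pow 2 (code l)) a else a) 0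

theorem testBit_collect {V : List (List ℕ)} {f : List ℕ → Bool} {c : ℕ} :
    (collect V f).testBit c = true ↔ ∃ l ∈ V, f l = true ∧ code l = c := by
  induction V with
  | nil => simp [collect]
  | cons a V ih =>
    have h : collect (a :: V) f = bif f a then 2 ^ (code a) ||| collect V f else collect V f := rfl
    rw [h]
    cases hf : f a
    · simp [ih, hf]
    · simp [ih, hf, Nat.testBit_or, Nat.testBit_two_pow]

/-! ### Families satisfying Bézout's weak criteria -/

/-- The weak Bézout criteria for a family of triples and sextuples. -/
structure IsBezout (F : Finset (Finset (Fin 8))) : Prop where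
  closed : ∀ q : Finset (Fin 8), (q.card = 4 ∨ q.card = 7) → ∀ i ∈ q, ∀ j ∈ q, i ≠ j →
    q.erase i ∈ F → q.erase j ∈ F → ∀ k ∈ q, q.erase k ∈ F
  not_subset : ∀ I ∈ F, ∀ J ∈ F, I.card = 3 → J.card = 6 → ¬ I ⊆ J

/-- Each stage of the classification continues with a relabelled family, so the criteria have to
survive relabelling. -/
theorem IsBezout.smul {F : Finset (Finset (Fin 8))} (h : IsBezout F)
    (σ : Equiv.Perm (Fin 8)) : IsBezout (σ • F) where
  closed q hq i hi j hj hij hFi hFj k hk := by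
    have key : ∀ x, q.erase x ∈ σ • F ↔ (σ⁻¹ • q).erase (σ⁻¹ x) ∈ F := by
      intro x
      rw [← Finset.inv_smul_mem_iff]
      have : σ⁻¹ • q.erase x = (σ⁻¹ • q).erase (σ⁻¹ x) := by
        ext y
        simp only [Finset.mem_erase, Finset.mem_inv_smul_finset_iff, Equiv.Perm.smul_def,
          Ne, Equiv.Perm.eq_inv_iff_eq]
      rw [this]
    rw [key] at hFi hFj ⊢
    have hmem : ∀ x ∈ q, σ⁻¹ x ∈ σ⁻¹ • q := fun x hx => by
      rw [Finset.mem_inv_smul_finset_iff]; simpa using hx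
    refine h.closed (σ⁻¹ • q) ?_ _ (hmem i hi) _ (hmem j hj) ?_ hFi hFj _ (hmem k hk)
    · simpa only [Finset.card_smul_finset] using hq
    · simpa using hij
  not_subset I hI J hJ hI3 hJ6 hIJ := by
    rw [← Finset.inv_smul_mem_iff] at hI hJ
    refine h.not_subset _ hI _ hJ ?_ ?_ (Finset.smul_finset_subset_smul_finset hIJ)
    · rwa [Finset.card_smul_finset]
    · rwa [Finset.card_smul_finset]

/-! ### Search for all families with partially prescribed members -/

/-- The packed masks `pos` and `neg` record correct information on the family `F`. -/
structure Describes (pos neg : ℕ) (F : Finset (Finset (Fin 8))) : Prop where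
  mem : ∀ c, (pos >>> 32).testBit c = true → members c ∈ F
  notMem : ∀ c, (neg >>> 32).testBit c = true → members c ∉ F

/-- The packed mask of the sets that arise from `q` by omission of an element. -/
def faces (q : List ℕ) : ℕ :=
  Nat.shiftLeft
    (q.foldr (fun i a => Nat.lor (Nat.pow 2 (Nat.xor (code q) (Nat.pow 2 i))) a) 0) 32

/-- The packed masks violate the closure property for the packed mask `w` of faces. -/
def clash (pos neg w : ℕ) : Bool :=
  !Nat.beq (Nat.land neg w) 0 &&
    !Nat.beq (Nat.land (Nat.land pos w) (Nat.sub (Nat.land pos w) 1)) 0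

/-- `q` lists four or seven elements of `Fin 8`. -/
def IsCluster (q : List ℕ) : Prop :=
  q.Nodup ∧ (∀ i ∈ q, i < 8) ∧ (q.length = 4 ∨ q.length = 7)

instance (q : List ℕ) : Decidable (IsCluster q) := by unfold IsCluster; infer_instance

theorem card_members_code {l : List ℕ} (hl : l.Nodup) (h8 : ∀ i ∈ l, i < 8) :
    (members (code l)).card = l.length := by
  rw [← List.toFinset_card_of_nodup hl]
  rw [← Finset.card_map Fin.valEmbedding]
  congr 1
  ext i
  simp only [Finset.mem_map, mem_members_code, Fin.valEmbedding_apply, List.mem_toFinset]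
  exact ⟨fun ⟨a, ha, hai⟩ => hai ▸ ha, fun hi => ⟨⟨i, h8 i hi⟩, hi, rfl⟩⟩

theorem members_face {q : List ℕ} {i : ℕ} (hi : i ∈ q) (h8 : i < 8) :
    members (code q ^^^ 2 ^ i) = (members (code q)).erase ⟨i, h8⟩ := by
  ext x
  rw [Finset.mem_erase, mem_members_code, mem_members, Nat.testBit_xor, Nat.testBit_two_pow]
  by_cases hx : i = x
  · subst hx
    have := (testBit_code q x).2 hi
    simp [this]
  · have hx' : x ≠ ⟨i, h8⟩ := fun e => hx (by rw [e])
    simp [hx, hx', testBit_code]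

/-- The summand 32 aligns the faces with packed masks. `clash` can then intersect without unpacking,
and the remainder in the lowest 32 digits is ignored. -/
theorem testBit_faces (q : List ℕ) (b : ℕ) :
    (faces q).testBit b = true ↔ ∃ i ∈ q, b = 32 + (code q ^^^ 2 ^ i) := by
  have h : ∀ (l : List ℕ) (c : ℕ),
      (l.foldr (fun i a => Nat.lor (Nat.pow 2 (Nat.xor (code q) (Nat.pow 2 i))) a) 0).testBit c
        = true ↔ ∃ i ∈ l, c = code q ^^^ 2 ^ i := by
    intro l c
    induction l with
    | nil => simp
    | cons a l ih =>
      have h : ∀ x y : ℕ, Nat.lor x y = x ||| y := fun _ _ => rfl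
      have h' : ∀ x y : ℕ, Nat.xor x y = x ^^^ y := fun _ _ => rfl
      rw [List.foldr_cons, h, Nat.testBit_or, Bool.or_eq_true, ih]
      simp only [List.mem_cons, exists_eq_or_imp, h', Nat.pow_eq, Nat.testBit_two_pow,
        decide_eq_true_eq, @eq_comm _ (code q ^^^ 2 ^ a)]
  have h2 : faces q = (q.foldr
      (fun i a => Nat.lor (Nat.pow 2 (Nat.xor (code q) (Nat.pow 2 i))) a) 0) <<< 32 := rfl
  rw [h2, Nat.testBit_shiftLeft, Bool.and_eq_true, h, decide_eq_true_eq]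
  constructor
  · rintro ⟨hb, i, hi, h⟩
    exact ⟨i, hi, by omega⟩
  · rintro ⟨i, hi, h⟩
    exact ⟨by omega, i, hi, by omega⟩

/-- Intersecting `x` with `x - 1` deletes the lowest digit `1`; if `x` had only one such digit, it
would be a power of two and nothing would remain. -/
theorem exists_testBit_of_land_pred_ne_zero {x : ℕ} (h : x &&& (x - 1) ≠ 0) :
    ∃ a b, a ≠ b ∧ x.testBit a = true ∧ x.testBit b = true := by
  by_contra hc
  push Not at hc
  have hx : x ≠ 0 := by rintro rfl; simp at h
  obtain ⟨a, ha⟩ := Nat.exists_testBit_of_ne_zero hx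
  have hxa : x = 2 ^ a := by
    refine Nat.eq_of_testBit_eq fun b => ?_
    rw [Nat.testBit_two_pow]
    by_cases hab : a = b
    · subst hab; simpa using ha
    · simpa [hab] using hc a b hab ha
  rw [hxa, Nat.and_two_pow_sub_one_eq_mod, Nat.mod_self] at h
  exact h rfl

/-- A clash would exhibit two faces of `q` known to be in `F` and a third known to be outside,
against the closure property. Hence correct information never clashes. -/
theorem clash_eq_false {F : Finset (Finset (Fin 8))} (hF : IsBezout F) {pos neg : ℕ}
    (h : Describes pos neg F) {q : List ℕ} (hq : IsCluster q) : clash pos neg (faces q) = false := by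
  obtain ⟨hnd, h8, hlen⟩ := hq
  rw [← Bool.not_eq_true]
  intro hc
  have e : ∀ x y : ℕ, Nat.land x y = x &&& y := fun _ _ => rfl
  simp only [clash, Bool.and_eq_true, Bool.not_eq_true', e, Nat.sub_eq, ← Bool.not_eq_true,
    Nat.beq_eq] at hc
  obtain ⟨hn, hp⟩ := hc
  have hbit : ∀ n b, (n &&& faces q).testBit b = true →
      ∃ i ∈ q, b = 32 + (code q ^^^ 2 ^ i) ∧ (n >>> 32).testBit (code q ^^^ 2 ^ i) = true := by
    intro n b hb
    rw [Nat.testBit_and, Bool.and_eq_true, testBit_faces] at hb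
    obtain ⟨hb, i, hi, rfl⟩ := hb
    exact ⟨i, hi, rfl, by rwa [Nat.testBit_shiftRight]⟩
  obtain ⟨c, hc⟩ := Nat.exists_testBit_of_ne_zero hn
  obtain ⟨a, b, hab, ha, hb⟩ := exists_testBit_of_land_pred_ne_zero hp
  obtain ⟨k, hk, -, hkn⟩ := hbit _ _ hc
  obtain ⟨i, hi, rfl, hip⟩ := hbit _ _ ha
  obtain ⟨j, hj, rfl, hjp⟩ := hbit _ _ hb
  have hFi := h.mem _ hip
  have hFj := h.mem _ hjp
  refine h.notMem _ hkn ?_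
  rw [members_face hi (h8 i hi)] at hFi
  rw [members_face hj (h8 j hj)] at hFj
  rw [members_face hk (h8 k hk)]
  refine hF.closed _ (by rwa [card_members_code hnd h8]) _ ((mem_members_code _ _).2 hi) _
    ((mem_members_code _ _).2 hj) ?_ hFi hFj _ ((mem_members_code _ _).2 hk)
  intro hij
  exact hab (by rw [Fin.mk.inj hij])

theorem Describes.insert_pos {pos neg c : ℕ} {F : Finset (Finset (Fin 8))}
    (h : Describes pos neg F) (hc : members c ∈ F) : Describes (insertBit pos c) neg F where
  mem d hd := by
    rcases (testBit_insertBit _ _ _).1 hd with hd | rfl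
    exacts [h.mem d hd, hc]
  notMem := h.notMem

theorem Describes.insert_neg {pos neg c : ℕ} {F : Finset (Finset (Fin 8))}
    (h : Describes pos neg F) (hc : members c ∉ F) : Describes pos (insertBit neg c) F where
  mem := h.mem
  notMem d hd := by
    rcases (testBit_insertBit _ _ _).1 hd with hd | rfl
    exacts [h.notMem d hd, hc]

/-- All ways to decide the sets listed in `vs` without a clash, added to the list `acc`. Each entry
of `vs` is the code of a set, together with the masks of faces to be inspected after the
decision. -/
def search : List (ℕ × List ℕ) → ℕ → ℕ → List (ℕ × ℕ) → List (ℕ × ℕ)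
  | [], pos, neg, acc => (pos, neg) :: acc
  | v :: vs, pos, neg, acc =>
    (fun acc' => strict (insertBit pos v.1) fun pos' =>
      bif v.2.any (clash pos' neg) then acc' else search vs pos' neg acc')
    (strict (insertBit neg v.1) fun neg' =>
      bif v.2.any (clash pos neg') then acc else search vs pos neg' acc)

theorem search_cons (v : ℕ × List ℕ) (vs : List (ℕ × List ℕ)) (pos neg : ℕ)
    (acc : List (ℕ × ℕ)) : search (v :: vs) pos neg acc =
      (fun acc' => bif v.2.any (clash (insertBit pos v.1) neg) then acc'
        else search vs (insertBit pos v.1) neg acc')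
      (bif v.2.any (clash pos (insertBit neg v.1)) then acc
        else search vs pos (insertBit neg v.1) acc) := by
  rw [search, strict_eq]
  exact strict_eq _ _

/-- The branch in which a set is accepted starts from the results of the branch in which it is
rejected; those results must not get lost. -/
theorem subset_search (vs : List (ℕ × List ℕ)) (pos neg : ℕ) (acc : List (ℕ × ℕ)) :
    acc ⊆ search vs pos neg acc := by
  induction vs generalizing pos neg acc with
  | nil => exact List.subset_cons_self _ _
  | cons v vs ih =>
    rw [search_cons]
    generalize v.2.any (clash pos (insertBit neg v.1)) = b
    generalize v.2.any (clash (insertBit pos v.1) neg) = b'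
    cases b <;> cases b' <;> simp only [cond_true, cond_false]
    · exact List.Subset.trans (ih _ _ _) (ih _ _ _)
    · exact ih _ _ _
    · exact ih _ _ _
    · exact List.Subset.refl _

/-- Let `F` itself decide each set. Along this path the masks always describe `F`, so no clash can
cut it, and its end is among the results. Completeness of the search asks nothing about the order of
`vs` or about which clusters are inspected. -/
theorem exists_mem_search {F : Finset (Finset (Fin 8))} (hF : IsBezout F)
    (vs : List (ℕ × List ℕ)) (hvs : ∀ v ∈ vs, ∀ w ∈ v.2, ∃ q, IsCluster q ∧ w = faces q)
    (pos neg : ℕ) (acc : List (ℕ × ℕ)) (h : Describes pos neg F) :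
    ∃ s ∈ search vs pos neg acc, Describes s.1 s.2 F := by
  induction vs generalizing pos neg acc with
  | nil => exact ⟨(pos, neg), by simp [search], h⟩
  | cons v vs ih =>
    have hvs' : ∀ v ∈ vs, ∀ w ∈ v.2, ∃ q, IsCluster q ∧ w = faces q :=
      fun u hu => hvs u (List.mem_cons_of_mem _ hu)
    have hclash : ∀ pos neg, Describes pos neg F → v.2.any (clash pos neg) = false := by
      intro pos neg h
      rw [List.any_eq_false]
      intro w hw
      obtain ⟨q, hq, hwq⟩ := hvs v (List.mem_cons_self) w hw
      rw [hwq, clash_eq_false hF h hq]; exact Bool.false_ne_true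
    rw [search_cons]
    by_cases hv : members v.1 ∈ F
    · have h' := h.insert_pos hv
      simp only [hclash _ _ h', cond_false]
      exact ih hvs' _ _ _ h'
    · have h' := h.insert_neg hv
      obtain ⟨s, hs, hsF⟩ := ih hvs' _ _ acc h'
      simp only [hclash _ _ h', cond_false]
      refine ⟨s, ?_, hsF⟩
      generalize v.2.any (clash (insertBit pos v.1) neg) = b
      cases b <;> simp only [cond_true, cond_false]
      · exact subset_search _ _ _ _ hs
      · exact hs

/-! ### Certificates -/

/-- The mask of all codes less than `256` whose digit `i` is `0`. -/
def maskZero (i : ℕ) : ℕ := Nat.div (Nat.sub (Nat.pow 2 256) 1) (Nat.succ (Nat.pow 2 (Nat.pow 2 i)))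

/-- The mask of all codes less than `256` whose digit `i` is `1`. -/
def maskOne (i : ℕ) : ℕ := Nat.shiftLeft (maskZero i) (Nat.pow 2 i)

/-- The mask of all codes whose digits `i` and `j` are the same. -/
def maskSame (i j : ℕ) : ℕ :=
  Nat.lor (Nat.land (maskZero i) (maskZero j)) (Nat.land (maskOne i) (maskOne j))

/-- The mask of all codes whose digits `i` and `j` are `1` and `0`. -/
def maskOneZero (i j : ℕ) : ℕ := Nat.land (maskOne i) (maskZero j)

/-- The mask of all sets that arise from those with mask `m` by the transposition of `i < j`. -/
def swapMask (i j m : ℕ) : ℕ :=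
  Nat.lor (Nat.land m (maskSame i j))
    (Nat.lor
      (Nat.shiftLeft (Nat.land m (maskOneZero i j)) (Nat.sub (Nat.pow 2 j) (Nat.pow 2 i)))
      (Nat.shiftRight (Nat.land m (maskOneZero j i)) (Nat.sub (Nat.pow 2 j) (Nat.pow 2 i))))

/-- The transposition of `i` and `j`. -/
def swapNat (i j k : ℕ) : ℕ := bif Nat.beq k i then j else bif Nat.beq k j then i else k

/-- The digits of `d` are those of `c` after the transposition of the places `i` and `j`. -/
def isSwapped (i j c d : ℕ) : Bool :=
  (List.range 8).all fun k => (hasBit d k).xor (!hasBit c (swapNat i j k))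

/-- The masks in the definition of `swapMask` are correct. -/
def checkSwap (i j : ℕ) : Bool :=
  Nat.ble (maskSame i j) (Nat.pow 2 256) && Nat.ble (maskOneZero i j) (Nat.pow 2 256) &&
  Nat.ble (maskOneZero j i) (Nat.pow 2 256) &&
  (List.range 257).all fun c =>
    (!hasBit (maskSame i j) c || isSwapped i j c c) &&
    (!hasBit (maskOneZero i j) c ||
      isSwapped i j c (Nat.add c (Nat.sub (Nat.pow 2 j) (Nat.pow 2 i)))) &&
    (!hasBit (maskOneZero j i) c ||
      isSwapped i j c (Nat.sub c (Nat.sub (Nat.pow 2 j) (Nat.pow 2 i))))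

/-- The closed formulas for the masks are tested for all 28 transpositions instead of being derived.
-/
theorem checkSwap_all : ((List.range 8).all fun j => (List.range j).all fun i => checkSwap i j) =
    true := by
  decide +kernel

theorem members_of_isSwapped {i j : Fin 8} {c d : ℕ} (h : isSwapped i j c d = true) :
    members d = Equiv.swap i j • members c := by
  ext x
  have hx := List.all_eq_true.1 h x (List.mem_range.2 x.2)
  rw [← Finset.inv_smul_mem_iff, Equiv.swap_inv, mem_members, Equiv.Perm.smul_def, mem_members]
  simp only [hasBit_eq_testBit] at hx
  have e : swapNat i j x = (Equiv.swap i j x : Fin 8) := by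
    have hb : ∀ a b, Nat.beq a b = decide (a = b) := fun a b => by
      rw [Bool.eq_iff_iff, Nat.beq_eq, decide_eq_true_eq]
    simp only [swapNat, hb, Bool.cond_decide, Fin.val_inj, Equiv.swap_apply_def]
    split_ifs <;> rfl
  rw [e] at hx
  revert hx
  cases d.testBit x <;> cases c.testBit (Equiv.swap i j x : Fin 8) <;> simp

/-- The comparison in `checkSwap` is not strict, so place 256 is not excluded; this is why 257 codes
are tested there. -/
theorem lt_of_testBit_of_le {m c : ℕ} (hm : m ≤ 2 ^ 256) (hc : m.testBit c = true) : c < 257 := by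
  by_contra h
  exact absurd (Nat.ge_two_pow_of_testBit hc)
    (not_le.2 (hm.trans_lt (Nat.pow_lt_pow_right (by norm_num) (by omega))))

/-- A code whose digits `i` and `j` agree is fixed by the transposition. One with only digit `i`
increases by `2 ^ j - 2 ^ i`, one with only digit `j` decreases by as much. A whole family is thus
relabelled by three intersections and two shifts. Only this inclusion is needed: information lost on
the way would make a certificate fail, not make it wrong. -/
theorem exists_of_testBit_swapMask {i j : Fin 8} (hij : i < j) {m d : ℕ}
    (hd : (swapMask i j m).testBit d = true) :
    ∃ c, m.testBit c = true ∧ members d = Equiv.swap i j • members c := by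
  have h := List.all_eq_true.1 (List.all_eq_true.1 checkSwap_all j (List.mem_range.2 j.2)) i
    (List.mem_range.2 hij)
  simp only [checkSwap, Bool.and_eq_true, Nat.ble_eq, Nat.pow_eq, Nat.sub_eq, Nat.add_eq,
    List.all_eq_true, List.mem_range, Bool.or_eq_true, Bool.not_eq_true', hasBit_eq_testBit] at h
  obtain ⟨⟨⟨h1, h2⟩, h3⟩, h⟩ := h
  have hs : swapMask i j m = (m &&& maskSame i j) |||
      ((m &&& maskOneZero i j) <<< (2 ^ (j : ℕ) - 2 ^ (i : ℕ)) |||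
      (m &&& maskOneZero j i) >>> (2 ^ (j : ℕ) - 2 ^ (i : ℕ))) := rfl
  rw [hs, Nat.testBit_or, Nat.testBit_or, Nat.testBit_shiftLeft, Nat.testBit_shiftRight,
    Nat.testBit_and, Nat.testBit_and, Nat.testBit_and] at hd
  simp only [Bool.or_eq_true, Bool.and_eq_true, decide_eq_true_eq] at hd
  rcases hd with hd | ⟨hle, hd⟩ | hd
  · refine ⟨_, hd.1, members_of_isSwapped ?_⟩
    simpa [hd.2] using (h _ (lt_of_testBit_of_le h1 hd.2)).1.1
  · refine ⟨_, hd.1, members_of_isSwapped ?_⟩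
    simpa [hd.2, Nat.sub_add_cancel hle] using (h _ (lt_of_testBit_of_le h2 hd.2)).1.2
  · refine ⟨_, hd.1, members_of_isSwapped ?_⟩
    simpa [hd.2] using (h _ (lt_of_testBit_of_le h3 hd.2)).2

theorem Describes.swap {pos neg : ℕ} {F : Finset (Finset (Fin 8))} (h : Describes pos neg F)
    {i j : Fin 8} (hij : i < j) :
    Describes (pack (swapMask i j (Nat.shiftRight pos 32)))
      (pack (swapMask i j (Nat.shiftRight neg 32))) (Equiv.swap i j • F) where
  mem d hd := by
    rw [pack_shiftRight] at hd
    obtain ⟨c, hc, hcd⟩ := exists_of_testBit_swapMask hij hd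
    rw [hcd]
    exact Finset.smul_mem_smul_finset (h.mem c hc)
  notMem d hd := by
    rw [pack_shiftRight] at hd
    obtain ⟨c, hc, hcd⟩ := exists_of_testBit_swapMask hij hd
    rw [hcd, Finset.smul_mem_smul_finset_iff]
    exact h.notMem c hc

/-- Applies at most `fuel` transpositions to the packed masks. The places to be transposed are the
octal digits of `c`. -/
def relabel (k : ℕ → ℕ → Bool) : ℕ → ℕ → ℕ → ℕ → Bool
  | 0, _, pos, neg => k pos neg
  | fuel + 1, c, pos, neg =>
    strict (Nat.mod c 8) fun i => strict (Nat.mod (Nat.shiftRight c 3) 8) fun j =>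
      bif Nat.blt i j then
        strict (pack (swapMask i j (Nat.shiftRight pos 32))) fun pos' =>
          strict (pack (swapMask i j (Nat.shiftRight neg 32))) fun neg' =>
            relabel k fuel (Nat.shiftRight c 6) pos' neg'
      else k pos neg

/-- The permutation is the product of the transpositions read from `c`. A pair of digits that is not
increasing, such as the padding `0, 0`, ends the process. -/
theorem exists_of_relabel {k : ℕ → ℕ → Bool} {fuel c pos neg : ℕ}
    (hk : relabel k fuel c pos neg = true) {F : Finset (Finset (Fin 8))}
    (h : Describes pos neg F) :
    ∃ (σ : Equiv.Perm (Fin 8)) (pos' neg' : ℕ), Describes pos' neg' (σ • F) ∧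
      k pos' neg' = true := by
  induction fuel generalizing c pos neg F with
  | zero => exact ⟨1, pos, neg, by rwa [one_smul], hk⟩
  | succ fuel ih =>
    rw [relabel, strict_eq, strict_eq] at hk
    obtain ⟨i, hi⟩ : ∃ i : Fin 8, Nat.mod c 8 = i := ⟨⟨_, Nat.mod_lt _ (by norm_num)⟩, rfl⟩
    obtain ⟨j, hj⟩ : ∃ j : Fin 8, Nat.mod (Nat.shiftRight c 3) 8 = j :=
      ⟨⟨_, Nat.mod_lt _ (by norm_num)⟩, rfl⟩
    rw [hi, hj] at hk
    cases hij : Nat.blt i j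
    · rw [hij, cond_false] at hk
      exact ⟨1, pos, neg, by rwa [one_smul], hk⟩
    · rw [hij, cond_true, strict_eq, strict_eq] at hk
      have hij' : i < j := by simpa [Nat.blt] using hij
      obtain ⟨σ, p, q, hpq, hk'⟩ := ih hk (h.swap hij')
      exact ⟨σ * Equiv.swap _ _, p, q, by rwa [mul_smul], hk'⟩

/-- The mask `m` is that of `F`, as far as the sets listed in `V` are concerned. -/
def Agrees (m : ℕ) (V : List (List ℕ)) (F : Finset (Finset (Fin 8))) : Prop :=
  ∀ l ∈ V, members (code l) ∈ F ↔ m.testBit (code l) = true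

/-- The packed masks `pos` and `neg` describe the family with mask `m` as far as the sets in the
mask `full` are concerned. -/
def matchesMask (full m pos neg : ℕ) : Bool :=
  Nat.beq (Nat.shiftRight pos 32) m &&
    Nat.beq (Nat.land full (Nat.lor m (Nat.shiftRight neg 32))) full

/-- The transpositions given by the lowest 14 octal digits of `c` carry the family described by
`s` to the target number `c / 8 ^ 14`. -/
def certifies (full : ℕ) (targets : List ℕ) (s : ℕ × ℕ) (c : ℕ) : Bool :=
  match targets[Nat.shiftRight c 42]? with
  | none => false
  | some m => relabel (matchesMask full m) 7 c s.1 s.2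

/-- `matchesMask` demands that the sets known to be inside are exactly those of the target and that
the sets known to be outside cover the rest of `V`. So membership is settled for each set in `V`.
Seven transpositions suffice for any permutation of eight labels, and they use the lowest 42 binary
digits of `c`. -/
theorem exists_agrees_of_certifies {V : List (List ℕ)} {targets : List ℕ} {s : ℕ × ℕ} {c : ℕ}
    (hc : certifies (collect V fun _ => true) targets s c = true)
    {F : Finset (Finset (Fin 8))} (h : Describes s.1 s.2 F) :
    ∃ m ∈ targets, ∃ σ : Equiv.Perm (Fin 8), Agrees m V (σ • F) := by
  unfold certifies at hc
  split at hc
  · exact absurd hc (by simp)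
  rename_i m hm
  obtain ⟨σ, p, q, hpq, hk⟩ := exists_of_relabel hc h
  refine ⟨m, List.mem_of_getElem? hm, σ, fun l hl => ?_⟩
  rw [matchesMask, Bool.and_eq_true, Nat.beq_eq, Nat.beq_eq] at hk
  obtain ⟨hp, hq⟩ := hk
  have hp' : p >>> 32 = m := hp
  have hq' : (collect V fun _ => true) &&& (m ||| q >>> 32) = collect V fun _ => true := hq
  have hl' : (collect V fun _ => true).testBit (code l) = true :=
    testBit_collect.2 ⟨l, hl, rfl, rfl⟩
  have hlq : m.testBit (code l) = true ∨ (q >>> 32).testBit (code l) = true := by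
    rw [← hq', Nat.testBit_and, Nat.testBit_or, Bool.and_eq_true, Bool.or_eq_true] at hl'
    exact hl'.2
  constructor
  · intro hlF
    exact hlq.resolve_right fun h => hpq.notMem _ h hlF
  · intro hlm
    exact hpq.mem _ (hp' ▸ hlm)

/-- Each state is certified by the entry at the same place. -/
def certifyAll (full : ℕ) (targets : List ℕ) : List (ℕ × ℕ) → List ℕ → Bool
  | [], _ => true
  | _ :: _, [] => false
  | s :: ss, c :: cs => certifies full targets s c && certifyAll full targets ss cs

theorem exists_certifies {full : ℕ} {targets : List ℕ} {ss : List (ℕ × ℕ)} {cs : List ℕ}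
    (h : certifyAll full targets ss cs = true) {s : ℕ × ℕ} (hs : s ∈ ss) :
    ∃ c, certifies full targets s c = true := by
  induction ss generalizing cs with
  | nil => simp at hs
  | cons a ss ih =>
    cases cs with
    | nil => simp [certifyAll] at h
    | cons c cs =>
      rw [certifyAll, Bool.and_eq_true] at h
      rcases List.mem_cons.1 hs with rfl | hs
      · exact ⟨c, h.1⟩
      · exact ih h.2 hs

/-! ### Stages of the classification -/

/-- The triples with largest element `n`, each with the quadruples that it completes. -/
def tripleVars (n : ℕ) : List (ℕ × List ℕ) :=
  (List.range n).flatMap fun j => (List.range j).map fun i =>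
    (code [i, j, n], (List.range i).map fun d => faces [d, i, j, n])

/-- The triples of elements less than `n`. -/
def triples (n : ℕ) : List (List ℕ) :=
  (List.range n).flatMap fun k => (List.range k).flatMap fun j => (List.range j).map fun i =>
    [i, j, k]

/-- The elements of `Fin 8` other than those listed in `e`. -/
def others (e : List ℕ) : List ℕ := (List.range 8).filter fun x => !e.elem x

/-- The sextuples of elements less than eight. -/
def sextuples : List (List ℕ) :=
  (List.range 8).flatMap fun j => (List.range j).map fun i => others [i, j]

/-- The sextuples, each with the two sets of seven elements that contain it. -/
def sextupleVars : List (ℕ × List ℕ) :=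
  (List.range 8).flatMap fun j => (List.range j).map fun i =>
    (code (others [i, j]), [faces (others [i]), faces (others [j])])

/-- All extensions of the families of triples in `masks` by triples that contain `n`. -/
def tripleStates (n : ℕ) (masks : List ℕ) : List (ℕ × ℕ) :=
  masks.flatMap fun m =>
    strict (pack m) fun k =>
    strict (pack (collect (triples n) fun l => look k (code l))) fun pos =>
    strict (pack (collect (triples n) fun l => !look k (code l))) fun neg =>
    search (tripleVars n) pos neg []

/-- The triple `t` of the family with packed mask `pos` is contained in the set with code `c`. -/
def blocks (pos c : ℕ) (t : List ℕ) : Bool :=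
  look pos (code t) && Nat.beq (Nat.land (code t) c) (code t)

/-- All extensions of the families of triples in `masks` by sextuples. -/
def sextupleStates (masks : List ℕ) : List (ℕ × ℕ) :=
  masks.flatMap fun m =>
    strict (pack m) fun k =>
    strict (pack (collect (triples 8) fun l => look k (code l))) fun pos =>
    strict (pack (Nat.lor (collect (triples 8) fun l => !look k (code l))
      (collect sextuples fun l => (triples 8).any (blocks k (code l))))) fun neg =>
    search (sextupleVars.filter fun v => !look neg v.1) pos neg []

/-! ### The linear spaces on eight points and the candidate quatroids -/

/-- Masks of the linear spaces on 3 points. -/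
def spaces3 : List ℕ := [
  128, 0]

/-- Masks of the linear spaces on 4 points. -/
def spaces4 : List ℕ := [
  26752, 128, 0]

/-- Masks of the linear spaces on 5 points. -/
def spaces5 : List ℕ := [
  375941248, 26752, 33554560, 128, 0]

/-- Masks of the linear spaces on 6 points. -/
def spaces6 : List ℕ := [
  78274679833913472, 375941248, 562949953448064, 26752, 4507997707436160, 4398080065664,
  33554560, 72057594037928064, 128, 0]

/-- Masks of the linear spaces on 7 points. -/
def spaces7 : List ℕ := [
  5214322623900981569529889937713280, 78274679833913472, 158456325028528675187463841920,
  375941248, 5192455317277707796997891719981184, 1267655435931508422963355478144,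
  4835703279021466652272768, 562949953448064, 5192296858534827628530496329246848, 26752,
  158461236289675367615817580672, 4911261146692428729680000, 75557868233912030855296,
  4507997707436160, 5192296858610385492260808732704896, 75557863730312403484800,
  19342813113838464875364480, 4398080065664, 158456325028528675187121455232,
  316912650057057350374209355904, 33554560, 72057594037928064, 128, 0]

/-- Masks of the linear spaces on 8 points. -/
def spaces8 : List ℕ := [
  26960359788324348720949767030734241706367231428990564075626486589568,
  5214322623900981569529889937713280,
  12554203470773361527671578846415332832204789163607902939264, 78274679833913472,
  26959946679704843268363379889353015356618303245206378084531008202880,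
  100433627772032898770696242444295858313531347865235746220160,
  5846006549323611672973195655893660753811194013824, 158456325028528675187463841920,
  26959946667150639794667015087019630673637144422540572481103986190464, 375941248,
  1606938044282374390942237338347369443266244409688625499891840,
  23384115400275246006206840744041415905832664590464,
  89202980799314947883420580887591337743902848, 5192455317277707796997891719981184,
  12554203476619724888918367010467992170493713764299250362496,
  1606938044264836638903208880505215261860491996658164016638080,
  5846363361246788164052659338289002875371181336704,
  374144775968634323551381237182792323828666182166656,
  356811923176491237920007423870796747451164800, 5708990770823840791888579809306403508886464640,
  1267655435931508422963355478144,
  26959946667150639794667371898942807163607413829736213876354358208640,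
  356811923176489970269407195641395250747959424,
  12554203476619368076995190519230076998773121989018451470464,
  100433627772032898770696242444137406824206098211514934651008,
  5846006549323611672814744166568411100090382444672,
  1606938044282374301739256539032421564681366801118754408261760,
  23384026197294446691258962159163807335961572960384,
  26959946667150639794667015087019630673637149258243851502570262521984,
  4835703279021466652272768, 12554203470773361527671578846415332832204711451878022473856,
  25108406941546723055343157692830665664409422340806091499648,
  411376139330301510538742295639337626245683966408957915790600320, 562949953448064,
  26960358043290065877148857947368922600249445535658585577760913123456,
  5192296858534827628530496329246848, 26752, 158461236289675367615817580672,
  2923003274661805836407374576693712731740594765952, 4911261146692428729680000,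
  12554203470773450730652372968907899050635669716286123802752,
  89202980794122492566218430958827358054776960,
  12554203470773361527671578846415332907762579122840099881088, 75557868233912030855296,
  12554203470773361527671578846415332832204715396925776461952, 4507997707436160,
  12554203494157476927946824852463714908923822057677746339968,
  23384115400275246006048382076719111168749677314176,
  89202980799314789424753258582854254756626560, 5192296858610385492260808732704896,
  26959946667150639794667104290000424796129710640971526804862037655680,
  89202980794122492566218430954323758427406464,
  95780971304118053647396689196969881839901507539959936, 75557863730312403484800,
  1606938044282374301739256539032421579188476635935752631353472,
  23384026197294446691258976666273642152959796052096,
  26959946667150639794667015087019630673637163765353686319568485613696,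
  19342813113838464875364480, 12554203470773361527671578846415332832204710893326149091456,
  100433627766186892221372630771322662657637687115822632272000, 4398080065664,
  158456325028528675187121455232, 374144419156711147060460229825425510382292940357760,
  316912650057057350374209355904,
  26959946667150639794667015087019630673637144422540572481103643803776, 33554560,
  72057594037928064, 128, 0]

/-- Masks of the linear spaces on eight points with a Fano subplane. -/
def fanoSpaces : List ℕ := [
  12554203476619724888918367010467992170493713764299250362496, 158461236289675367615817580672]

/-- Isomorphisms of the one-point extensions with the spaces on 3 points. -/
def certificates3 : List ℕ := [
  0, 4398046511104]

/-- Isomorphisms of the one-point extensions with the spaces on 4 points. -/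
def certificates4 : List ℕ := [
  0, 4398046511104, 4398046511130, 4398046512785, 4398046618696, 8796093022208]

/-- Isomorphisms of the one-point extensions with the spaces on 5 points. -/
def certificates5 : List ℕ := [
  0, 4398046511104, 4398046511139, 8796093022208, 8796093022216, 8796093023312, 13194139533312,
  8796102338656, 13194139535586, 8796093167712, 13194139678865, 8796102305888, 13194148848712,
  13194139535513, 13194139674184, 13194148849232, 17592186044416]

/-- Isomorphisms of the one-point extensions with the spaces on 6 points. -/
def certificates6 : List ℕ := [
  0, 4398046511104, 4398046511148, 8796093022208, 8796093022216, 8796093023312, 8796093130328,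
  13194139533312, 8796093025067, 8796104734873, 17592186044416, 21990232555520, 17592186044451,
  21990232555537, 21990232555555, 21990232557777, 26388279066624, 8796842666600, 13194139536171,
  21990232558379, 21990232738513, 26388279066668, 21990232738504, 21990244267080, 26388279069448,
  21990244267088, 21990232738512, 26388279247952, 26388279069475, 26388279249096, 26388290745424,
  30786325577728, 35184372088832, 26389028711016, 26388290513512, 26388279241320, 35184372271850,
  26388290779752, 26388279245416, 26388279069288, 35184383802001, 26389028645480, 26388290480744,
  26388279066664, 35185121731656, 26388290447976, 26388279175784, 35184372271769, 26389028678248,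
  26388279068328, 35184383796808, 26388288383592, 26388279212200, 35185121732176, 35184383769249,
  35185119635528, 35184383535184, 35184372263000, 39582418599936]

/-- Isomorphisms of the one-point extensions with the spaces on 7 points. -/
def certificates7 : List ℕ := [
  0, 4398046511104, 4398046511157, 8796093022208, 8796093022216, 8796093023312, 8796093130328,
  8796102338656, 13194139533312, 8796093025652, 17592186044416, 21990232555520, 21990232555546,
  26388279066624, 21990232555537, 21990232557201, 26388279066641, 21990232557209, 21990232555545,
  26388279068313, 26388279066668, 26388279069457, 26388279248537, 30786325577728, 8853887331440,
  13194139536756, 26388279070068, 26388279287057, 26388293174937, 30786325577781, 26388279287048,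
  26388293174344, 26389181998664, 30786325581128, 26388293174352, 26388279287056, 26388293174864,
  30786325795920, 26389181998680, 26388293174936, 26389181998168, 30786339579480, 30786325581164,
  30786325797640, 30786339652688, 30787226412632, 35184372088832, 39582418599936, 21990232775987,
  21991135590553, 21991118513736, 43980465111040, 48378511622144, 48378511624968, 52776558133248,
  48378523300944, 52776558135505, 21990984296528, 52776569844808, 57174604644352, 21990246665458,
  26388279287091, 21990246595737, 26389182101657, 22047890548296, 26389165024840, 48378525729872,
  52776558136657, 52776572208200, 61572651155456, 65970697666560, 52834213931096, 61572651157657,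
  65970697668761, 61572662863432, 70368744177664, 65970709374536, 70368744180488, 70368755852888,
  74766790688768, 26389182102705, 26388293172401, 30786325798195, 26389182035633, 26388293105329,
  30787228612761, 52777461167176, 57174604644405, 65971600696904, 70368744398088, 70369647142488,
  74766790688821, 52776572236872, 57174604647779, 66028491974224, 70368758285392, 70426534225496,
  74766790692177, 66028487780424, 70368758286536, 70426534193248, 74766790692195, 65971600435280,
  70369647146064, 70369647110240, 74766790908113, 79164837199872, 83562883710976, 83562883710993,
  83562883713177, 83562883856033, 87960930222080, 17649980353648, 35184372309299, 61572651375923,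
  70369646849136, 61572651158835, 70368758180976, 70426404170864, 70369645014128, 83562897820825,
  61572651158899, 70426538421360, 61572651375411, 70368744396464, 70369630137456, 70368758253232,
  83563786741320, 61572651155507, 70369642687600, 61572651158323, 70368758216880, 70426402139248,
  70369645083312, 83620678018640, 70369495886960, 70426400009328, 83563786681505, 70368757722224,
  70369645050032, 83620673824840, 70369644817520, 70368758250160, 83563786479696, 35242166364248,
  83562897521833, 83563767605832, 83620543801936, 92358976733184, 30844119886960, 30787211570288,
  30786339155056, 39582418820403, 65970697887027, 74766790909235, 65970711776465, 74766804798673,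
  74766790692147, 74766790905041, 83563786745521, 87960930225524, 65970711776456, 74766804798664,
  65971600700488, 74767693722696, 74766790905032, 74766804530248, 83620677921864, 87960930442504,
  65971600700496, 74767693722704, 65970711776464, 74766804798672, 74766804530256, 74766790905040,
  83563786644560, 87960944329808, 74766790688819, 74766790692049, 83562897815729, 87960930442531,
  74766790692040, 74766790898760, 83563786415176, 87960944330952, 74766790898768, 74766790692048,
  83620673760336, 87961833190480, 83563784649393, 83620543769672, 83563767573584, 92358976733237,
  87960930225451, 87960930437832, 87960944030800, 92358976736620, 92358976953123, 96757023244288,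
  79222631509104, 88018724531312, 79165739969648, 87961832991856, 79222497291376, 87960944323696,
  88018590313584, 87961831156848, 88018586119280, 96757037354226, 79165740235888, 87961833258096,
  79164851305584, 87960944327792, 79165738138736, 87960930442352, 87961831160944, 87960944299120,
  87961831095408, 96757926280337, 79222631410800, 88018724433008, 79165739904112, 87961832926320,
  79222497258608, 87960930225520, 88018590280816, 87960930442032, 87960944298224, 96814817551432,
  79165739871344, 87961832893552, 79222497193072, 87960944225392, 88018590215280, 87961831058544,
  88018586020976, 96757037354137, 79222631443568, 88018724465776, 79165723159664, 87960930440880,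
  87961816181872, 87960944297648, 87961831093936, 96757926274632, 79165588909168, 87961828732016,
  79164850744432, 87960944261296, 88018588183664, 87961831127728, 88018586018928, 96814817551952,
  87961681931376, 88018586053744, 87961831091312, 96757926214817, 87960943766640, 87961831094448,
  87960944298160, 96814813358152, 87961830861936, 87960944294576, 87961831089264, 96757926013008,
  87960944290928, 87960930441904, 87960944288880, 96757037344856, 96757037055145, 96757907139144,
  96814683335248, 96757924178520, 96814679140960, 101155069755392]

/-- A part of `certificates8`. -/
def certificates8Part0 : List ℕ := [
  0, 4398046511104, 4398046511166, 8796093022208, 8796093022216, 8796093023312, 8796093130328,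
  8796102338656, 8796842666600, 13194139533312, 8796093026237, 17592186044416, 21990232555520,
  21990232555546, 21990232557794, 26388279066624, 21990232555537, 21990232557201, 21990232701073,
  26388279066641, 21990232557209, 21990232555545, 21990232557721, 26388279068313, 21990232701089,
  21990232557793, 21990232700577, 26388279212193, 26388279066677, 26388279070033, 26388279285401,
  26388293105825, 30786325577728, 13123221171832, 13194139537341, 26388279070653, 26388279324497,
  26388295571097, 26389335390369, 30786325577790, 26388279324488, 26388295570504, 26389335352904,
  26455883786312, 30786325581704, 26388295570512, 26388279324496, 26388295571024, 26389335390288,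
  30786325832784, 26389335352920, 26388295571096, 26389335352408, 26455883753560, 30786341938776,
  26455883786336, 26389335390368, 26455883785312, 26389335385696, 30787375081568, 30786325581749,
  30786325835080, 30786342048848, 30787379766872, 30853796079712, 35184372088832, 39582418599936,
  17592186302332, 17659797387937, 43980465111040, 48378511622144, 43980465111093, 48378511622170,
  48378511622197, 48378511625562, 52776558133248, 43980465111084, 48378511622188, 43980465114484,
  48378511623825, 48378511625588, 48378511840913, 52776558133265, 43980465114476, 48378511624986,
  43980465111092, 48378511804049, 48378511842586, 48378525730449, 52776558134937, 48378511625580,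
  48378511842074, 52776558133292, 48378511622196, 48378525697681, 52776558136081, 48378511625498,
  48378511836817, 52776558315161, 52776558136692, 52776558353681, 52776572241561, 57174604644352,
  21990232813436, 43980465111102, 48378511622206, 43980465368392, 48378511879496, 61572651155456,
  65970697666560, 70368744177664, 65970697669960, 74766790688768, 70368744181064, 74766790692168,
  79164837199872, 65971753952856, 74766790691601, 43981519373392, 74766804796488, 83562883710976,
  70368758252624, 74766804763728, 79164837202705, 48379565884496, 74766790692112, 83562883713809,
  79164851307592, 83562897818696, 87960930222080, 21991288983290, 26388279324540, 48378511626173,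
  48378511880026, 52776558133310, 48378511626056, 48378511873672, 52776558390600, 70368760681552,
  74766807192656, 79164837203857, 74767847114320, 83562883966609, 79164853670984, 83563937899592,
  92358976733184, 96757023244288, 70369800463960, 74767846975064, 79164837455513, 74834401928280,
  83562883714969, 79165891389000, 83562900182600, 92358976733210, 96757023244314,
  101155069755392, 105553116266496, 105553116266522, 109951162777600, 105553116269896,
  114349209288704, 118747255799808, 105553116485256, 114349209288730, 118747255799834,
  109951162781000, 118747255803208, 118747256018568, 123145302310912, 127543348822016,
  26455890443961, 26389335228089, 30786325835644, 52776558391164, 52776574639889, 52777614558873,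
  57174604644414, 79165893624904, 83563940136008, 87960930222142, 79232448439880, 83630494950984,
  87960930226074, 109951163035464, 118747256057672, 118747272304264, 123145302310974,
  127543348822078, 79164853706512, 83562900217616, 87960930226065, 79165893625424,
  83563940136528, 87960930477713, 109951179281488, 118747272303696, 118748312085584,
  123145302314897, 127543348826001, 79165893625496, 83563940136600, 87960930477721,
  79232448439384, 83630494950488, 87960930226073, 109952219063896, 118748312086104,
  118747272304216, 123145302566553, 127543349077657, 109951179283208, 118747272305416,
  118748312159880, 123145302314924, 127543348826028, 109952219137104, 118748312159312,
  118814862845008, 123145302567697, 127543349078801, 110018769823320, 118814862845528,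
  118748312159832, 123145318745753, 127543365256857, 131941395333120, 136339441844224,
  136339441844241, 136339441845913, 140737488355328, 140737488355372, 145135534866432,
  21919314194040, 35184372346748, 92358976991100, 92358993239834, 123145302568828,
  92358993239825, 92360033158801, 123145318817553, 92360033158809, 92358993239833,
  123146358736537, 123145302314876, 123145302564625, 123145318549145, 140737488359357,
  92358993239816, 92360033158792, 123145318817544, 92360033158216, 92426587972680,
  123146358735944, 92426587973192, 92360033158728, 123212913550920, 123145302564616,
  123145318548552, 123146341557832, 140737488613192, 92360033158224, 92426587972688,
  123146358735952, 92358993239824, 92360033158800, 123145318817552, 92360033158736,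
  92426587973200, 123146358736464, 123145318548560, 123145302564624, 123145318549072,
  140737504859216, 92426587973208, 92360033158744, 123212913550936, 92360033158808,
  92358993239832, 123146358736536, 92426587972696, 92360033158232, 123212913550424,
  123146341557848, 123145318549144, 123146341557336, 140738544641624, 123145302310972,
  123145302314769, 123145302558361, 140737488613228, 123145302314760, 123145302557768,
  123145318147656, 140737504860936, 123145302557776, 123145302314768, 123145302558288,
  140738544714832, 123145318147672, 123145302558360, 123145318147160, 140805095401048,
  149533581377536, 140737488359284, 140737488608520, 140737504560208, 140738525505112,
  153931627888640, 35113453727352, 30852846169720, 30787347918456, 39582418857852,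
  96757023502204, 96757039750938, 127543349079932, 96757039750929, 96758079669905,
  127543365328657, 96758079669913, 96757039750937, 127544405247641, 127543348825980,
  127543349075729, 127543365060249, 140737488613244, 145135534870461, 96757039750920,
  96758079669896, 127543365328648, 96758079669320, 96824634483784, 127544405247048,
  96824634484296, 96758079669832, 127610960062024, 127543349075720, 127543365059656,
  127544388068936, 140737504861960, 145135535124296, 96758079669328, 96824634483792,
  127544405247056, 96757039750928, 96758079669904, 127543365328656, 96758079669840,
  96824634484304, 127544405247568, 127543365059664, 127543349075728, 127543365060176,
  140738544780368, 145135551370320, 96824634484312, 96758079669848, 127610960062040,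
  96758079669912, 96757039750936, 127544405247640, 96824634483800, 96758079669336,
  127610960061528, 127544388068952, 127543365060248, 127544388068440, 140805099595352,
  145136591152728, 127543348822076, 127543348825873, 127543349069465, 140737488359356,
  145135535124332, 127543348825864, 127543349068872, 127543364658760, 140737488613128,
  145135551372040, 127543349068880, 127543348825872, 127543349069392, 140737504855120,
  145136591225936, 127543364658776, 127543349069464, 127543364658264, 140738544379480,
  145203141912152, 140737488612732, 140737504829192, 140738542683216, 140804965377624,
  153931627888702, 145135534870388, 145135535119624, 145135551071312, 145136572016216,
  153931627892661, 153931628146028, 158329674399744, 61572667662139, 61640262531225,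
  61640245421640, 61639037494864, 61640128014408, 61639976986704, 61640124120233,
  162727720910848, 65970714173243, 70368760684347, 66038309042329, 70436355553433,
  65971602765496, 70436355552936, 65971717776504, 70435264636016, 65971753793720, 70368760412336,
  70289231586424, 70436355187816, 167125767421952, 167125767425379, 167125781460648,
  171523813933056, 74766807195451, 74766807191240, 79164853706555, 74834402064033,
  74834384889952, 79232448575137, 74834384890440, 74834402064040, 79232431401544, 65891187271248,
  74687145944184, 70369764287608, 101221456094800, 167126819288144, 175921860444160,
  175921860446312, 180319906955264, 74834402064992, 74834402064488, 79232448576096,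
  175921860446984, 175921860446816, 180319906958088, 184717953466368, 184717953469192,
  184717965109344, 184717953468072, 189115999977472, 83562900217659, 83562900217553,
  83630490891336, 87960946728763, 83630495086745, 83630495086241, 83630209476696, 88028541597849,
  83630477977160, 83630477912648, 83630494755416, 88028524488264, 162727720910910,
  167125767679843, 167126823745192, 171523813933118, 167126823783112, 171452622809184,
  171523814189832, 184717953466430, 184717953723144, 184719005296736, 184717953722024,
  189115999977534, 167126823777360, 171452622841432, 171524865799248, 184717953722577,
  184719005332560, 184719005328984, 184719002969192, 189116000233681, 83630209542224,
  83630209509968, 83630495087200, 88028256053328, 184719005365320, 184717953723088,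
  184717953723032, 184719003001952, 189117051876424, 193514046488576, 193514046491400,
  193514058167376, 193514058163800, 193514058131552, 193514046490280]

/-- A part of `certificates8`. -/
def certificates8Part1 : List ℕ := [
  197912092999680, 43980480818808, 92358993239867, 65971753991833, 74767840161400,
  79085322481272, 105620727642265, 70297553184328, 74767842588344, 74767695787704,
  105620710532680, 70289233782352, 79085192455288, 74767810798712, 105619502605904,
  180248713734232, 202310139510784, 206708186021888, 206708200129616, 211106232532992,
  202310139730747, 206708186024712, 175922897594456, 206708186025297, 211106232536401,
  206708186025232, 211106232535816, 206708200096840, 180248850115160, 211106246607944,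
  96686104848992, 211106246640720, 211106232536336, 215504279044096, 83563940138746,
  83563923095185, 83563906049096, 96757039750971, 70369800502937, 79165893523129, 79165876483769,
  105554172591769, 110018774153369, 74695599695432, 83491692588616, 79165855215176,
  109879971784264, 110018757043784, 74687280293456, 83483373186640, 83491828903504,
  109871652382288, 110017549117008, 189044806756440, 211035307747424, 211106232789145,
  215424634398288, 219902325555200, 224300372066304, 206775790838880, 211107284428360,
  184718990616664, 211107286759577, 219902325558609, 224300372069713, 211107286558288,
  219902325558024, 224300372069128, 215424498050632, 189044943137368, 219902339630152,
  224300386141256, 219902339662928, 219902325558544, 228698418577408, 224300386174032,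
  224300372069648, 228698418580817, 228698432652360, 233096465088512, 74767847116538,
  83563940134585, 83562899951353, 114349225795387, 118747272306491, 74767847014041,
  83563940034233, 83562899949753, 114416820664473, 118814867175577, 48378523334328,
  96685832250952, 123212896577096, 167126823846992, 167125783660744, 175922916763768,
  180319907213137, 175921860701968, 184717953724176, 175989337466968, 206708186279761,
  211106232790865, 184785430489176, 211106248669337, 219902325813073, 224300372324177,
  175922916501088, 184719009523296, 175989337502792, 206709242345121, 211107288856225,
  184785430525000, 211106232536931, 219903381878433, 224301428389537, 92425495226448,
  127463706273872, 219903381649064, 224229449377384, 228699470472776, 219968843949168,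
  224229315224696, 237494511599616, 241892558110720, 219969802680432, 237494511818961,
  219903362771064, 241892558112921, 228765893339216, 241892558330065, 241892558329505,
  246290604621824, 250688651132928, 79165893627642, 87961986649850, 96758079672058,
  118748312227578, 118748311961224, 127543365328699, 79165893525145, 87961986547353,
  96758079569561, 118748312125081, 118748305401432, 127610960197785, 83491692717640,
  92287785739848, 101083878762056, 123074111317576, 118748307701400, 127610943088200,
  171524870358096, 180320963380304, 184719009752184, 189116000235345, 180319907213072,
  189044813046904, 189117056336968, 211107288958032, 211106232790800, 215504279044158,
  224301428491344, 224300372324112, 228698418835281, 228699474936904, 233096465088574,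
  189044813080696, 180320963012192, 193442853267544, 215433354258528, 211107288589920,
  215504279300249, 228627493791840, 228699474900641, 224301428123232, 233025271867480,
  233096465344665, 211107288626856, 215433356355176, 215505330939464, 228699457693776,
  241892574615761, 241892574615201, 246290604621886, 250688651132990, 224301428160168,
  233025273965128, 228627495888488, 228699474930264, 233097516983880, 241960165225544,
  228699436722768, 241960165157448, 246290604878600, 250688651389704, 241960164894808,
  241960162863704, 246291656484440, 228698418817632, 250689702995544, 255086697644032,
  255086697646856, 259484744155136, 255086709319256, 259484744157337, 259484755863112,
  263882790666240, 101222681132729, 110018757111416, 101156109139641, 109952218672760,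
  114269700992632, 110018639670904, 131941411839803, 101222681032377, 110018750688888,
  101156109039289, 109952212250232, 114269694570104, 110018633248376, 132009006708889,
  101155085695673, 193514046492605, 110009091272312, 237495567758408, 241893614269512,
  237561988756552, 241893613873240, 241960035267656, 241960034871384, 255086697648061,
  101156125883065, 193514046746467, 114269430394488, 237495546786888, 241892574613200,
  237562120877128, 241960152311896, 241893612441296, 246211096193112, 255086697901905,
  114278288764536, 237494528095304, 241892574606408, 237495565923400, 241960152344160,
  241893612434504, 246211096225376, 255086697901923, 110018486513272, 237494523376712,
  241892558368464, 237495414666312, 241893613905504, 241892574584528, 241960034903648,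
  255086714149073, 132008868297897, 193514062994731, 246219551976552, 241950354484328,
  255086714150187, 193514046741299, 241958810201192, 241893311949928, 255087754037969,
  241958810233456, 246219552008816, 193581655701657, 255154306857113, 241893311982192,
  241950354516592, 193515081644185, 255087734863521, 255086697896755, 255086713818321,
  255087732799641, 255154304792225, 268280837177344, 105620727643833, 118814850133624,
  105554155650745, 118748311694968, 123065794014840, 118814732693112, 136339458350907,
  52777574051448, 123146358634169, 123145318446777, 140805099731097, 184785564841032,
  184718992847944, 193514062995208, 184719007731409, 211107254773336, 224367979247288,
  184717969936081, 219969934835304, 228764670668368, 211164163090008, 219903360745072,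
  241893607714392, 224301409351352, 233025412476496, 241960028712536, 255086714150664,
  184719009887304, 184717969699912, 193515102914760, 219902325812824, 228699474603600,
  123211552304712, 219902342028888, 250617726379608, 228765895601744, 246357118821976,
  259484744413009, 184717967544017, 211106248108128, 224301424031928, 184717953683153,
  219903228624488, 228699172417104, 211107137300576, 219902337334896, 241892574604896,
  224367847127224, 228756214984272, 241893612432992, 255087754070216, 219902341955168,
  228766006521424, 127472159862344, 219903379783264, 246358215862368, 233016950402640,
  246291643869280, 259484760660177, 193514046709547, 241950486605416, 246219684097640,
  255086697865003, 145055758101064, 193514046492467, 246290620562600, 246291660749992,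
  259552353367112, 241893576224368, 246291509721776, 246356984637048, 272678883688448,
  241959074475632, 246358081714864, 250617458009720, 272678883688483, 255086697647923,
  259485779309640, 272678883688501, 272678883691875, 277076930199552, 110018774154937,
  127610960199353, 109952219201209, 127544405245625, 127544388206265, 127543365058233,
  136407053221561, 145135551373115, 110018774054585, 127610960099001, 109952219100857,
  127544405145273, 127544388105913, 127543364957881, 136407053121209, 145203146242201,
  189183611352136, 189117039359048, 193514062993080, 197912093003709, 224367966269000,
  224300388560472, 233164076459592, 228618910150216, 241960169481800, 250688667639560,
  224301426388568, 241892574617240, 250756262405720, 233097504466504, 250688651386632,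
  250689690412632, 259552355526216, 263882790670269, 189117056398408, 189116016211016,
  193515102812344, 197912093257571, 224301428092496, 224300372323928, 237423593236048,
  224367849090640, 246219686258256, 250689707557968, 224300388539992, 241893614527576,
  255015772890712, 233162985678416, 250688667370576, 250755165333080, 263811872302672,
  263882790924113, 224301427863112, 224301421669984, 237423586945096, 224367848861256,
  246219679967304, 250689707559112, 224367842668128, 241893614436000, 255015772858464,
  233162979387464, 250688667371720, 250755165300832, 263811866011720, 263882790924131,
  224367960010320, 224300388466272, 233164076197968, 228618903891536, 241960169220176,
  250756262409296, 224301426294368, 241960162927712, 250756262373472, 233097504204880,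
  250689690416208, 250689690380384, 259552355264592, 263882807171281, 255086714116923,
  255087751909073, 255154170607769, 255087598614177, 268280837177406, 255086697901371,
  259552217117768, 272678883692477, 272678883946339, 277076930199614, 255086714113745,
  259485798420176, 272678883946321, 272678900193489, 277076930203537, 255087751706777,
  272678883688509, 272678883692369, 259542406244440, 277076930455705, 255086711518881,
  272678883692387, 272678883940561, 263803013834336, 277076946597537, 268280837181365,
  277076930203573, 277076930456913, 277076946671769, 277077984425633, 281474976710656,
  285873023221760, 61501732793976, 145056026570360, 140804965248632, 145055758134904,
  153931644395323, 215504295550779, 228698418831163, 228764939102296, 250756262112888,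
  215504279301947, 228698434817745, 228699440851032, 250689707421304, 228698418581307,
  228699440818776, 255015510716024, 228698418826961, 228764939070040, 250756258180728,
  259552221312697, 259485798483641, 263803007512152, 259552216723032, 277077986627225,
  215504279302011, 228698434817736, 228699457627744, 255015779184248]

/-- A part of `certificates8`. -/
def certificates8Part2 : List ℕ := [
  215504295549755, 228699457958984, 228698434218072, 250688667637432, 228698418826952,
  228764670633576, 250756245401208, 228698434548808, 228699172383320, 250689707493048,
  263803282239048, 259552221179464, 259542400085592, 259485644861016, 277144541570632,
  215504279048123, 228699457958992, 228698434217568, 250756255854200, 215504279300923,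
  228698434817744, 228699440850528, 250689707456696, 228698434548816, 228699172382312,
  255015506587256, 228698418826960, 228764939069032, 250756258249400, 259552221179472,
  263803282239056, 259485645028952, 259484758228568, 281404058347088, 228698418577467,
  228698434153056, 250755976932984, 228698418581201, 228699457563232, 255015504457336,
  259485798480057, 259552221214905, 259552217017952, 263803009642080, 277144541478561,
  228698418581192, 228699172350056, 250689706962552, 228698418820168, 228764670601824,
  250756258216120, 259552220950088, 263803275980360, 259485645123168, 259542402182752,
  281404052056136, 228698418820176, 228764670601320, 250756257984120, 228698418581200,
  228699457562728, 250689707489976, 263803275980368, 259552220950096, 259484758232672,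
  259485645061728, 277144541309008, 140795414718072, 145055753840248, 140804960953976,
  158258755971160, 259552217119417, 259485649255097, 259485798411880, 259552214691432,
  277077986295465, 263803013869128, 259542670552648, 259484758290024, 259485642763880,
  277144520337992, 259542670552656, 263803013869136, 259484744375912, 259484758195816,
  281403789912656, 281474993184563, 281476031040712, 281542453834832, 285793512761432,
  281541495137888, 281475996853864, 290271069732864, 136268523482744, 149462663016056,
  132008989666936, 145203129200248, 136259933548152, 145136590761592, 149454073081464,
  145203011759736, 149453804646008, 158329690906427, 233096481595195, 233096465342267,
  255154308623992, 263882807172923, 233097521516241, 233096481328849, 255087753932408,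
  263883847093969, 233096465092411, 259413557227128, 263882790924091, 233096465338065,
  255154304691832, 263882807168721, 255153083887224, 255087734795896, 277144541574841,
  263882807140155, 263883844996817, 277077969581753, 277076946171577, 285873023479676,
  233097521516232, 233096481328840, 255087754065592, 263883847093960, 233164076463176,
  233097504470088, 255086714148536, 263950402040904, 233096465338056, 255154304825016,
  263882807168712, 233096481059912, 255087754004152, 263883846825032, 255087734929080,
  255086713849528, 281404058218056, 263883844996808, 263950267823176, 277143450660424,
  277077952409160, 285873039728392, 233164076463184, 233097504470096, 255154308621432,
  263950402040912, 233097521516240, 233096481328848, 255087753929848, 263883847093968,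
  233096481059920, 259413557224568, 263883846825040, 233096465338064, 255154304689272,
  263882807168720, 255153083884664, 255087734793336, 277144541441616, 263950267823184,
  263883844996816, 277077969448528, 277076946038352, 285874079646800, 233096465088571,
  255154023444088, 263882790670267, 233096465092305, 259413550968440, 263882790923985,
  259405101543032, 255153077628536, 277077986621625, 263882790923643, 263882807140049,
  277076946434233, 277076930443449, 285873039728419, 233096465092296, 255087749609656,
  263882790923976, 233096465331272, 255154304727224, 263882807161928, 255154172704952,
  255087734831288, 277144541212232, 263882807140040, 263883844990024, 277077969219144,
  277076945808968, 285874079647944, 233096465331280, 255154023441528, 263882807161936,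
  233096465092304, 259413550965880, 263882790923984, 259405101540472, 255153077625976,
  281404051959376, 263883844990032, 263882807140048, 277143444401744, 277077946150480,
  285940634498128, 255154157694584, 259413687316088, 277144537381561, 255087751707320,
  255154306857656, 281403789848136, 255154157692024, 259413687313528, 277144520273488,
  277077967486137, 277143316541000, 281395466284624, 285801966347896, 290271069736893,
  263882807139131, 263883844931281, 277077965388473, 277076941978297, 285873023479595,
  263883844931272, 263950263628872, 277143182290504, 277077684039240, 285873039723208,
  263950263628880, 263883844931280, 277077948280400, 277143446531664, 285874079315024,
  277144539479225, 281403924098632, 277134858726992, 281541356725880, 290271069990764,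
  277077833268409, 277134726606408, 281404056219216, 285801830098552, 290271086238499,
  285873039695667, 285874077551816, 285940500345936, 290271069736820, 290271069986083,
  290271086239019, 294669116243968, 272607965326968, 268347357769336, 268281859518072,
  290200151371384, 268348448288376, 268281876295288, 268280852885112, 285940634332792,
  272607696891512, 268347223551608, 268280837418616, 285874079641208, 268347089333880,
  268281591082616, 290199882935928, 272607831109240, 268280848952952, 285940630400632,
  268338633617016, 268281740242552, 290199876644472, 285939409596024, 285874060504696,
  285939403304568, 290200012959352, 294670172671738, 268348448554616, 268281876561528,
  268280853151352, 285940634599032, 268281893600888, 268280853413496, 268280837422712,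
  285874079645304, 268348444360312, 268281874464376, 268280837181048, 285873039728248,
  268281872367224, 268280848957048, 285940630404728, 268348446457464, 268280837361272,
  285874079583864, 268281740246648, 268280851287672, 285940630306424, 285874060508792,
  285873039429240, 285874060410488, 285940632436344, 294736727621265, 272607965195896,
  268347357638264, 268281859387000, 290200151240312, 268348448190072, 268281876196984,
  268280852786808, 285940634234488, 272607696825976, 268347223518840, 268280837177400,
  285873023479672, 268347089268344, 268281591017080, 290199882870392, 272607831076472,
  268280837180216, 285873039727416, 268338633584248, 268280837397816, 285874079582456,
  285939409563256, 285873023475000, 285873039427832, 285874079615736, 298996244390984,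
  268348448157304, 268281876164216, 268280852754040, 285940634201720, 272607696760440,
  268347223420536, 268280837287544, 285874079510136, 268347089202808, 268281590951544,
  290199882804856, 272607830978168, 268280848821880, 285940630269560, 268338633485944,
  268281740111480, 290199876513400, 285939409464952, 285874060373624, 285939403173496,
  290200012828280, 294670172671641, 272607965228664, 268347357671032, 268281859419768,
  290200151273080, 268348431445624, 272599375359608, 268280837179064, 285873039726264,
  268281859452536, 268347357703800, 285940617490040, 268338767801976, 268280837359288,
  285874079581880, 272607965294200, 268280851285688, 285940630304440, 290191561404024,
  285873039427256, 285874060408504, 285940632434360, 294736727615048, 268348162977400,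
  272599241076344, 268280846495352, 285940627943032, 268281893006968, 268348314037880,
  268280837322936, 285874079545528, 268348297227896, 268281586822776, 290199878676088,
  272599106924152, 268280848890552, 285940630338232, 268338631487096, 268281740213432,
  290199876510840, 285939407466104, 285874060475576, 285939403170936, 290200012825720,
  298996244391504, 268281590984312, 268347089235576, 285940349021816, 268338633518712,
  268281584692856, 290199876546168, 272607831010936, 268338627227256, 285940630302328,
  290191427120760, 285939403206264, 285874060406392, 285939405303416, 294736727522977,
  268280852819576, 268281876229752, 285874079051384, 268281742044792, 268280848857272,
  285940630304952, 268348448255608, 268281740146872, 285874079582392, 285940500082296,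
  285874060409016, 285873039427768, 285874060441784, 298996238100552, 268281725234808,
  268280848625272, 285940630072952, 268338499366520, 268280837356216, 285874079578808,
  268281739947640, 268280851283128, 285940630299768, 285874060209784, 285873039424696,
  285874060403832, 285939405300856, 294736727353424, 268347223486072, 268281721040504,
  285874079575672, 272607696858744, 268280850987704, 285873039727288, 268338497269368,
  268281738116280, 285874079573112, 285873039421048, 285873023474872, 285873039418488,
  290200012859000, 294670172661848, 285940483272312, 290200012893816, 285940632432248,
  290200010796664, 294670172339881, 290191292968568, 285940632435384, 285874079615672,
  285940632402616, 294736706382408, 285939273248376, 285874058378424, 285940632429688,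
  290200010794104, 298995975957072, 285874058374776, 285873039396024, 285874058372216,
  285939403236984, 294736723421784, 285939269054072, 285874058312888, 285939269051512,
  290199876609656, 298995969665632, 294736593370801, 298987652361288, 294735502617680,
  294670153526360, 294735496326240, 298996105981032, 299067162755072]

/-- Isomorphisms of the one-point extensions with the spaces on 8 points. -/
def certificates8 : List ℕ := certificates8Part0 ++ certificates8Part1 ++ certificates8Part2

/-- Masks of the candidate quatroids, the two exceptional ones first. -/
def targets : List ℕ := [
  1606938044282374390942237333155072601656378255204385743175808,
  14355639141311039465524240860289984696005975071400509669885678659112534144,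
  26960359788324348720949767030734241706367231428990564075626486589568,
  5214322623900981569529889937713280,
  12554203470773361527671578846415332832204789163607902939264, 78274679833913472,
  26959946679704843268363379889353015356618303245206378084531008202880,
  100433627772032898770696242444295858313531347865235746220160,
  5846006549323611672973195655893660753811194013824, 158456325028528675187463841920,
  26959946667150639794667015087019630673637144422540572481103986190464, 375941248,
  1606938044282374390942237338347369443266244409688625499891840,
  23384115400275246006206840744041415905832664590464,
  89202980799314947883420580887591337743902848, 5192455317277707796997891719981184,
  1606938044264836638903208880505215261860491996658164016638080,
  5846363361246788164052659338289002875371181336704,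
  374144775968634323551381237182792323828666182166656,
  356811923176491237920007423870796747451164800, 5708990770823840791888579809306403508886464640,
  1267655435931508422963355478144,
  26959946667150639794667371898942807163607413829736213876354358208640,
  356811923176489970269407195641395250747959424,
  7237005577332262226527390039662362317824564560832612251239220989513022072960,
  12554203476619368076995190519230076998773121989018451470464,
  100433627772032898770696242444137406824206098211514934651008,
  7237005577332262213973186568889000790152985714417279419034510100584953047168,
  5846006549323611672814744166568411100090382444672,
  1606938044282374301739256539032421564681366801118754408261760,
  23384026197294446691258962159163807335961572960384,
  26959946667150639794667015087019630673637149258243851502570262521984,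
  7237005577332262213973186563042994240829374041602540088169378021961222875264,
  4835703279021466652272768,
  7237005577332262226527390033816355768500952888017868084670810452372593076352,
  12554203470773361527671578846415332832204711451878022473856,
  7237005577332262239081593504589717296172531734433200916875521341300662102144,
  25108406941546723055343157692830665664409422340806091499648,
  411376139330301510538742295639337626245683966408957915790600320,
  7237005577332262213973186563042994240829374041602535252466099563444524050560, 562949953448064,
  26960358043290065877148857947368922600249445535658585577760913123456,
  5192296858534827628530496329246848,
  7251140353850489288609852943048937588955993912777540204131071850104911587456,
  7237005577332262213973186563042994240829374041602535252466099000494570629248, 26752,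
  2923003274661805836407374576693712731740594765952, 4911261146692428729680000,
  12554203470773450730652372968907899050635669716286123802752,
  89202980794122492566218430958827358054776960,
  12554203470773361527671578846415332907762579122840099881088,
  14134776518227074636666380005943348126619871175005027222841083522371813504,
  75557868233912030855296, 6739986679341863419440115299426486514824618937839858517201679024256,
  12554203470773361527671578846415332832204715396925776461952,
  14355632401324372677864292193536212941098306662114404034742558383209971840,
  14134776518227074636666380005943348126619871175004951664977357608048394368, 4507997707436160,
  23384115400275246006048382076719111168749677314176,
  89202980799314789424753258582854254756626560, 5192296858610385492260808732704896,
  26959946667150639794667104290000424796129710640971526804862037655680,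
  56539106072908298546665520023862595487273607192586025090845722199791239296,
  89202980794122492566218430954323758427406464,
  95780971304118053647396689196969881839901507539959936,
  113078212145816597093331040047546785012958969400039688877646527195131150464,
  75557863730312403484800,
  14134776518228681574710662380245087383158903596584140141608785362972311680,
  1606938044282374301739256539032421579188476635935752631353472,
  14134776518227074636666403389969545421066562433981617938615002570137010304,
  23384026197294446691258976666273642152959796052096,
  26959946667150639794667015087019630673637163765353686319568485613696,
  14355632401324372677864292193536212941098306662133746847851888850377900160,
  14134776518227074636666380005943348126619871175024294478086688075216322688,
  19342813113838464875364480,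
  7237005577332262226527390033816355768500952888017868084670809893820719693952,
  6739986679341863419440115299426486514824618937839854013602051653760,
  12554203470773361527671578846415332832204710893326149091456,
  14134776518227175070294146192835569499250642497667609302659965432973230208,
  100433627766186892221372630771322662657637687115822632272000,
  7251140353850489288609852943048937588955993912777540204131071854502991626368,
  7237005577332262213973186563042994240829374041602535252466099004892650668160,
  14355639141311039465524240860289984696005975071400509669881175059485163648,
  14355632401324372677864292193536212941098306662114404034738054783582601344,
  14134776518227074636666380005943348126619871175004951664972854008421023872, 4398080065664,
  9159776902317325628999145450739899278477559008477321234197041257488238772352,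
  7237005577332262213973186563042994240829374041760991577494627675681692057728,
  85070591888690940894372327045063508096, 158456325028528675187121455232,
  56539112812894965334325842834946320972534213569535737720544901010206752896,
  56539106072908298546665894168192549217626545160249632085401780734304190592,
  374144419156711147060460229825425510382292940357760,
  7237005577332262213973186563042994240829374041919447902523156350868779958400,
  56539112812894965334325468690527164261387153426218562352091869091475751040,
  56539106072908298546665520023773392506479485016932456716948748815573188736,
  316912650057057350374209355904,
  33699933333938299743333768858774538342046430528175715601379546366080,
  26959946667150639794667015087019630673637144422540572481103643803776,
  9159776902317325628999145450739899278477559008318864909168512582301150871680,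
  7251140353850489288609852943048937588955993912777540204131071850104945115264,
  7237005577332262213973186563042994240829374041602535252466099000494604157056,
  56594326783669289844624946737425380465006761981083275387475818911090344064,
  56594320043682623056964998070671608710099093571797169752332698635187781760,
  56539112812894965334325468690527164261387153109305912295034518717299949696,
  56539106072908298546665520023773392506479484700019806659891398441397387392,
  6739986666787659948666753771754907668409286105635143120275936116864, 33554560,
  113299068871412228482986445818483871296800863438309828894012945286414991488,
  113299068028913895134528952235139649827437404887149065689620055251927171200,
  113078212145816597093331040047546785012958969400039613319854854476765593728, 72057594037928064,
  9159776902317325628999145450739899278477559008318864909168512582301117317248,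
  7251140353850489288609852943048937588955993912777540204131071850104911560832,
  7237005577332262213973186563042994240829374041602535252466099000494570602624,
  113299068871412228482986445818483871296800863438309828893940887692377063552,
  113299068028913895134528952235139649827437404887149065689547997657889243264,
  113078212145816597093331040047546785012958969400039613319782796882727665792, 128,
  10135356007067392298401852992480860869043946928093127336450413029551874506752,
  9159776902317325628999145450739899278477559008318864909168512582301117317120,
  7251140353850694976679518093804206960103813581590663046123499419624684912640,
  7251140353850694976679518093804206960103813581590663046114276047587830136832,
  7251140353850489288609852943048937588955993912777540204131071850104911560704,
  7237005577332262213973186563042994240829374041602535252466099000494570602496, 0]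

/-- A part of `sextupleCertificates`. -/
def sextupleCertificatesPart0 : List ℕ := [
  8796093022208, 13194139533312, 17592186044416, 21990232555520, 26388279066624, 30786325577728,
  35184372088832, 39582418599936, 43980465111040, 48378511622144, 52776558133248, 57174604644352,
  61572651155456, 65970697666560, 70368744177664, 74766790688768, 79164837199872, 83562883710976,
  87960930222080, 92358976733184, 96757023244288, 101155069755392, 105553116266496,
  109951162777600, 114349209288704, 118747255799808, 123145302310912, 127543348822016,
  131941395333120, 136339441844224, 140737488355328, 145135534866432, 149533581377536,
  149533581377553, 149533581379225, 153931627888640, 158329674399744, 162727720910848,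
  167125767421952, 171523813933056, 171523813933073, 171523813934745, 175921860444160,
  180319906955264, 184717953466368, 189115999977472, 193514046488576, 189115999977489,
  193514046488593, 189115999979161, 193514046489672, 193514046490265, 193514046596680,
  193514046490192, 197912092999680, 202310139510784, 206708186021888, 211106232532992,
  215504279044096, 219902325555200, 224300372066304, 228698418577408, 233096465088512,
  237494511599616, 4398046511104, 241892558110720, 241892558113544, 246290604621824,
  241892569789520, 246290604624081, 246290616333384, 250688651132928, 3939, 255086697644032,
  259484744155136, 263882790666240, 268280837177344, 272678883688448, 277076930199552,
  281474976710656, 285873023221760, 285873023224584, 285873037329488, 290271069732864,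
  294669116243968, 299067162755072, 303465209266176, 307863255777280, 312261302288384,
  316659348799488, 321057395310592, 321057395312793, 325455441821696, 329853488332800,
  329853488335001, 334251534843904, 338649581355008, 343047627866112, 347445674377216,
  351843720888320, 356241767399424, 351843720890521, 356241767401625, 351843732596296,
  356241779107400, 360639813910528, 365037860421632, 365037860424456, 369435906932736,
  365037872096856, 369435906934937, 369435918640712, 373833953443840, 378231999954944,
  382630046466048, 382630046466065, 382630046468249, 382630046611105, 382630060276905,
  382630947404465, 387028092977152, 391426139488256, 395824185999360, 400222232510464,
  400222232726216, 404620279021568, 409018325532672, 413416372043776, 413416372043829,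
  417814418554880, 413416372043811, 413416372047203, 417814418554915, 417814418770632,
  417814432632008, 422212465065984, 426610511577088, 426610511577141, 426610511581117,
  431008558088192, 435406604599296, 439804651110400, 439804651110435, 444202697621504,
  439804651110417, 439804651112657, 444202697621521, 439804651112601, 439804651255961,
  444202697623705, 439804651255457, 448600744132608, 448600744132661, 448600744136637,
  452998790643712, 457396837154816, 457396837154869, 457396837158845, 461794883665920,
  439804651112097, 448600744132643, 448600744136035, 448600744390499, 452998790643747,
  457396837154833, 457396837158225, 457396837412689, 461794883665937, 444202697766561,
  457396837154851, 457396837158243, 457396837412707, 461794883665955, 457396837157073,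
  457396837374161, 457396853659857, 461794883668177, 466192930177024, 466192930177077,
  466192930181053, 470590976688128, 474989023199232, 479387069710336, 474989023199276,
  479387069710353, 479387069710380, 479387069713169, 483785116221440, 474989023199267,
  479387069710371, 474989023202091, 479387069711432, 479387069713195, 479387069891656,
  483785116221448, 474989023202083, 479387069712593, 474989023199275, 479387069854792,
  479387069893329, 479387081421896, 483785116222544, 479387069713187, 479387069892817,
  483785116221475, 479387069710379, 479387081389128, 483785116223688, 479387069713105,
  479387069887560, 483785116365904, 483785116224299, 483785116404424, 483785127933008,
  488183162732544, 492581209243648, 492581209243656, 496979255754752, 496979255754787,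
  496979255757611, 496979255975219, 496979272261435, 501377302265856, 492581209244752,
  496979255754769, 496979255757009, 496979255937745, 496979269864657, 496980312182481,
  501377302265873, 496979255755848, 496979255899208, 496979267466312, 496980158788680,
  497046867129416, 501377302266952, 505775348776960, 505775348777013, 505775348780989,
  510173395288064, 505775348776977, 505775348780369, 505775349034833, 510173395288081,
  505775348780396, 505775349034860, 510173395288108, 505775348996881, 505775365282577,
  510173395290897, 505775348780916, 510173395291508, 505775349030161, 510173395508497,
  510173395545980, 510173411794705, 514571441799168, 505775348776968, 505775348780360,
  505775349034824, 510173395288072, 505775348778056, 505775348995144, 505775365280840,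
  510173395289160, 505775348996872, 505775365282568, 510173395290888, 505775362851912,
  505776405136456, 510173395469384, 505775349030152, 510173395508488, 505775364981832,
  510173409395784, 510173411794696, 510174451713096, 514571441799176, 505775348778064,
  505775348995152, 505775365280848, 510173395289168, 505775348776976, 505775348780368,
  505775349034832, 510173395288080, 505775362851920, 505776405136464, 510173395469392,
  505775348996880, 505775365282576, 510173395290896, 505775364981840, 510173409395792,
  505775349030160, 510173395508496, 510174451713104, 510173411794704, 514571441800272,
  505775348996899, 505775365282595, 510173395290915, 505775362853073, 505776405137617,
  510173395470545, 505775349030179, 510173395508515, 505775364982993, 510173409396945,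
  510173411794723, 510174451714257, 514571441799203, 505775362853064, 505776405137608,
  510173395470536, 505776249648200, 505842955859016, 510173406966856, 505775364982984,
  510173409396936, 505776385963080, 510174298256456, 510174451714248, 510241006564424,
  514571441801416, 505776249648208, 505842955859024, 510173406966864, 505775362853072,
  505776405137616, 510173395470544, 505776385963088, 510174298256464, 505775364982992,
  510173409396944, 510241006564432, 510174451714256, 514571441943632, 505775365283115,
  510173395291435, 505776405170897, 510173395503825, 510173395545899, 510173411789521,
  514571441802027, 505776405170888, 510173395503816, 505842957988936, 510173409096776,
  510173411789512, 510174451381320, 514571441982152, 505842957988944, 510173409096784,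
  505776405170896, 510173395503824, 510174451381328, 510173411789520, 514571453510736,
  510173411761971, 510174449618129, 514571442019635, 510174449618120, 510240872412232,
  514571455909064, 510240872412240, 510174449618128, 514572344833104, 514571458305851,
  514572498226888, 514639053173840, 518969488310272, 523367534821376, 527765581332480,
  527765581332488, 532163627843584, 536561674354688, 532163627843637, 536561674354741,
  532163627847613, 536561674358124, 536561674358717, 536561674612588, 536561674358644,
  540959720865792, 532163627843619, 536561674354723, 532163627847011, 536561674358115,
  532163628101475, 536561674574627, 536561674612579, 536561690860323, 536561674607907,
  540959720865827, 532163627846443, 536561674357547, 532163628064051, 536561674575155,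
  532163644350267, 536561688430810, 536561690861371, 536562730715354, 536561690560730,
  540959720868058, 532163628063531, 536561674574635, 532163644349227, 536561674358123,
  536561690860331, 536561674612587, 536561690860843, 540959720868651, 532163627846963,
  536561674358067, 532163628101435, 536561674574554, 536561674612539, 536561690860250,
  536562730748634, 540959721048794, 532163628096819, 536561674354739, 532163644317499,
  536561674357978, 536561674358715, 536561674612442, 536561690561250, 540959720868578,
  536561674607923, 536561674358643, 536561674607411, 540959721086259, 536561690828603,
  536561674607834, 536561690528986, 540959734975706, 536561674612091, 536561690828506,
  536562730716386, 540959721086178, 536561690827579, 536562728619738, 536561688432354,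
  540959734942954, 540959737372475, 540960777293530, 540959737372386, 540960777228010,
  540959737073394, 545357767376896, 527765581333584, 532163627843601, 536561674354705,
  532163627846993, 536561674358097, 532163628101457, 536561674574609, 536561674612561,
  536561690860305, 536561674607889, 540959720865809, 532163627845841, 536561674356945,
  532163628062929, 536561674574033, 532163644348625, 536561688430801, 536561690859729,
  536562730715345, 536561690560721, 540959720868049, 532163628026577, 536561674537681,
  532163641953489, 536561688464593, 532164684271313, 536562575226513, 536562730782417,
  536629281437329, 536562711541393, 540959721010833, 532163641920209, 536561688431313,
  532164684204753, 536561674574545, 536562730715857, 536561690860241, 536562730748625,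
  540959721048785, 532163628059857, 536561674570961, 532163644346065, 536561688426129,
  536561690857169, 536562730710673, 536629283567249, 540959732577937, 532163644050641,
  536561674357969]

/-- A part of `sextupleCertificates`. -/
def sextupleCertificatesPart1 : List ℕ := [
  532164682174161, 536561674565265, 536561674612433, 536561690850961, 536562711574673,
  540959721044113, 536561690561745, 536561674607825, 536561690528977, 540959734975697,
  536562728685265, 536561690556049, 536562709509777, 540960623900305, 536561690828497,
  536562728679057, 536629281503377, 540959734970513, 536562728619729, 536629147317905,
  536562575325329, 540960621804177, 540960777293521, 541027332241041, 540960777287825,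
  541027328047761, 540960758152337, 545357767376913, 532163627845273, 536561674356377,
  532163628062361, 536561674573465, 532163644348057, 536561688430233, 536561690859161,
  536562730714777, 536561690560153, 540959720867481, 532163627989153, 536561674500257,
  532163641882785, 536561688393889, 532164684167329, 536562575227041, 536562730678433,
  536629281437857, 536562711541921, 540959721011361, 532163639556777, 536561686067881,
  532164530879665, 536562577390769, 532231239220921, 536619330151496, 536629285732025,
  540888527643720, 536628054303816, 540959730148424, 532164528749225, 536562575260329,
  532231234960041, 536561688427177, 536629281471145, 536562730711721, 536629283568297,
  540959732578985, 532163641687217, 536561688198321, 532164684005049, 536562574926920,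
  536562730516153, 536629281137736, 540888663958600, 540960470443080, 532164665097393,
  536561674566833, 532231105003193, 536561687831624, 536561690853049, 536562730116168,
  536628056433736, 540959732278344, 536562711608497, 536561690557617, 536562709511345,
  540960623901873, 536629151514297, 536562711241800, 536627924280392, 541017515074632,
  536562728681145, 536629151114312, 540888531870792, 540960623567944, 536629147319993,
  540879944000584, 536619336475720, 541017380922440, 541027332243129, 545286848881736,
  541027331875912, 545286580511816, 541026107204680, 545357767377992, 527765581440600,
  532163627988633, 536561674499737, 532163641882265, 536561688393369, 532164684166809,
  536562575226521, 536562730677913, 536629281437337, 536562711541401, 540959721010841,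
  532163639555737, 536561686066841, 532164530878105, 536562577389209, 532231239218841,
  536561688430809, 536629285729945, 536562730715353, 536561690560729, 540959720868057,
  532164528748185, 536562575259289, 532231234959001, 536561688426137, 536629281470105,
  536562730710681, 536629283567257, 540959732577945, 532163641685657, 536561688196761,
  532164684002969, 536561674574553, 536562730514073, 536561690860249, 536562730748633,
  540959721048793, 532164665095833, 536561674565273, 532231105001113, 536561674357977,
  536561690850969, 536561674612441, 536629283567769, 540959732578457, 536562711606937,
  536561690556057, 536562709509785, 540960623900313, 536629151512217, 536561674607833,
  536561690528985, 540959734975705, 536562728679065, 536561690828505, 536562709510297,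
  540960623900825, 536629147317913, 536562728619737, 536629147318425, 540959734708889,
  541027332241049, 540960777293529, 541027332241561, 540960777026201, 541027198024857,
  545357767378585, 532163627845793, 536561674356897, 532163628062881, 536561674573985,
  532163644348577, 536561688430753, 536561690859681, 536562730715297, 536561690560673,
  540959720868001, 532163628026537, 536561674537641, 532163641953457, 536561688464561,
  532164684271289, 536562575226440, 536562730782393, 536629281437256, 536562711541320,
  540959721010760, 532163641920169, 536561688431273, 532164684204713, 536561674574505,
  536562730715817, 536561690860201, 536562730748585, 540959721048745, 532163628059825,
  536561674570929, 532163644346041, 536561688426056, 536561690857145, 536562730710600,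
  536629283567176, 540959732577864, 532163644050609, 536561674357937, 532164682174137,
  536561674565192, 536561674612409, 536561690850888, 540888663991880, 540960470476360,
  536561690561713, 536561674607793, 536561690528945, 540959734975665, 536562728685241,
  536561690555976, 536562709509704, 540960623900232, 536561690828473, 536562728678984,
  536627924313672, 541017515107912, 536562728619705, 536629147317832, 540879944033864,
  540960606824008, 540960777293497, 541027332240968, 545286848915016, 541027315131976,
  545278259045960, 545357767485000, 532163628021921, 536561674533025, 532163641948321,
  536561688459425, 532164684265633, 536561674574625, 536562730776737, 536561690860321,
  536561674607905, 540959720865825, 532163639524009, 536561686035113, 532164530814129,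
  536562577325233, 532231239122617, 536561688430664, 536629285633721, 536562730715208,
  536561690560584, 540959720867912, 532164528781993, 536562575293097, 532231235025577,
  536561674358121, 536629281536681, 536561674612585, 536561690860841, 540959720868649,
  532163641654449, 536561688165553, 532164683939513, 536561674574408, 536562730450617,
  536561690860104, 536562730748488, 540959721048648, 532164665130161, 536561674354737,
  532231104970425, 536561674357832, 536561674358713, 536561674612296, 536628056434256,
  540959732278864, 536562711641265, 536561674358641, 536561674607409, 540959721086257,
  536629151481529, 536561674607688, 536561690528840, 540959734975560, 536561674612089,
  536561690828360, 540888531871312, 540960623568464, 536561690827577, 536562728619592,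
  536619336476240, 541017380922960, 540959737372473, 540960777293384, 541027331876432,
  545286580512336, 541026107205200, 545357767378512, 527765590648928, 532163641915553,
  536561688426657, 532164684200097, 536562575259809, 536562730711201, 536629281470625,
  536562711574689, 540959721044129, 532163628054689, 536561674565793, 532163644340385,
  536561688431329, 536561690851489, 536562730715873, 536561690561249, 540959720868577,
  532163644045473, 536561688197281, 532164682168481, 536561674570977, 536562730514593,
  536561690857185, 536562711574177, 540959721043617, 536561690556577, 536562711607457,
  536629281503393, 540959734970529, 536562728679585, 536561690561761, 536562730716385,
  540959721086177, 536629151512737, 536562728685281, 536629281502881, 540959734970017,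
  536562575325345, 536561688432353, 536562575324833, 540959721077409, 540960777287841,
  540959737372385, 540960777287329, 540959737363105, 540960775191713, 545357767522465,
  532164528716457, 536562575227561, 532231234927273, 536561688394409, 536629281438377,
  536562730678953, 536629283535529, 540959732546217, 532163641621681, 536561688132785,
  532164683906745, 536562575259720, 536562730417849, 536629281470536, 536562711574600,
  540959721044040, 532164665031857, 536561674501297, 532231104904889, 536561688197192,
  536561690754745, 536562730514504, 536628056401992, 540959732246600, 536562711542961,
  536561690492081, 536562709445809, 540960623836337, 536629151415993, 536562711607368,
  536629281503304, 540959734970440, 536562728582841, 536629151512648, 540888531839048,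
  540960623536200, 536629147221689, 536562575325256, 536619336443976, 540959734409288,
  541027332144825, 540960777287752, 541027331844168, 540960776693832, 541027197724744,
  545357776693320, 532163639589545, 536561686100649, 532164679809705, 536561674574057,
  536562726320809, 536561690859753, 536562730748137, 540959721048297, 532164530846897,
  536562577358001, 532231239155385, 536561688394312, 536629285666489, 536562730678856,
  536629283535432, 540959732546120, 532231102905521, 536561674356977, 532164667195065,
  536561674501192, 536561674610937, 536561690754632, 540888663959632, 540960470444112,
  536629149416625, 536561674606833, 536561690527985, 540959734974705, 536562713706169,
  536561690491976, 536562709445704, 540960623836232, 536561690827001, 536562728582728,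
  536627924281424, 541017515075664, 536562728618233, 536629147221576, 540879944001616,
  540960472606800, 540960777292025, 541027332144712, 545286848882768, 541027046697040,
  545278124828752, 545357767522384, 532164662999721, 536562577390249, 532231100807849,
  536561688464617, 536629285730985, 536562730782441, 536629283534505, 540959732545193,
  532231237057713, 536561686068401, 532164532944569, 536562577390152, 536562726256313,
  536629285730888, 540888661862984, 540960468347464, 532164681907377, 536561674537713,
  532163643784889, 536561686068296, 536561690790649, 536562726256200, 536628054305360,
  540959730149968, 536562713738417, 536561690595057, 536562709444273, 540960623834801,
  536629149384377, 536562713738312, 536627920088136, 541017510882376, 536562728652025,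
  536629149384264, 540888527645776, 540960619342928, 536629147219641, 540879937711688,
  536619330154064, 541017515141208, 541027332142777, 545286842592840, 541027325554256,
  545286848948312, 541026241423448, 545357776660568, 527766330976872, 536562709510825,
  536629283601065, 536562730744489, 540960621804201, 536629147318953, 536562730749161,
  536561690860777, 540959734942953, 536562579520169, 536561688497897, 536562730743465]

/-- A part of `sextupleCertificates`. -/
def sextupleCertificatesPart2 : List ℕ := [
  540960621803177, 536561688492713, 536561674575593, 536561688491689, 540959732611241,
  541027328047785, 540960777228009, 541027328046761, 540960772831401, 541027193830569,
  545357779090089, 536629283568817, 536562709478577, 536561690524849, 540959734676657,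
  536562579455673, 536629283600968, 536562730744392, 540960621804104, 536629147254457,
  536562579520072, 536629283236424, 541017380858440, 536562728615609, 536561688492616,
  536562579122760, 540960472574536, 540960776961721, 541027328047688, 545286580447816,
  541027046664776, 545277990611528, 545358517021256, 536562728418481, 536561690528497,
  536561674607345, 540959721081585, 536561690295993, 536562709478472, 536561690524744,
  540959734676552, 536562728618745, 536629147254344, 536562711243344, 540960606759504,
  536561690827513, 536562728615496, 536629151115856, 540959734377040, 540959737367289,
  540960776961608, 541027315067472, 540960776661584, 541027180948048, 545357779090000,
  536561690328241, 536561674604273, 536561690523313, 540959734675121, 536562728386233,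
  536561690328136, 536562709146696, 540960604662856, 536561690823929, 536562728386120,
  536629281139792, 541017378761808, 536562728613561, 536629146922568, 536562574929488,
  540960606792280, 540960776959673, 541027310874184, 545286576254544, 541027315100248,
  540960743172696, 545358516955736, 536561674599601, 536561674358513, 536561674598065,
  540960623868081, 536561690820281, 536561674599496, 536561689930824, 541017513012296,
  536561674611961, 536561690820168, 536562730118224, 540960621472848, 536561690818233,
  536562728021576, 536561687834192, 541017378794584, 541027332176057, 545286844722760,
  541027327684176, 545286576287320, 540959736539744, 545357778791008, 527823375641712,
  540960758152369, 540959737073393, 540960758150833, 541027195926705, 540960774929073,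
  545358670412977, 541027197992633, 540960758152264, 541026107108424, 545278124764232,
  541027180915784, 545415561686088, 540960775195897, 541027197992520, 545278258949200,
  541027197660240, 545277990579280, 545358670412880, 541027197990585, 545278256852552,
  541026105011792, 545278258981976, 541017651457112, 545415561587800, 540960760215737,
  541026239262280, 540960757788240, 541026105044568, 540960625699936, 545358670081120,
  540959736806073, 540960741043784, 541025970859600, 545286712634968, 541027329814112,
  545415427435624, 532092709482104, 545425378754233, 549684895526472, 545425378754128,
  549684895395416, 545425378389600, 549684627025512, 545424153718384, 549755813888000]

/-- Isomorphisms of the candidates with the targets. -/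
def sextupleCertificates : List ℕ := sextupleCertificatesPart0 ++ sextupleCertificatesPart1 ++ sextupleCertificatesPart2

/-! ### Verification of the certificates -/

theorem certifyAll_spaces3 :
    strict (collect (triples 3) fun _ => true) (fun full => certifyAll full spaces3 (tripleStates 2 [0]) certificates3) = true := by
  decide +kernel

theorem certifyAll_spaces4 :
    strict (collect (triples 4) fun _ => true) (fun full => certifyAll full spaces4 (tripleStates 3 spaces3) certificates4) = true := by
  decide +kernel

theorem certifyAll_spaces5 :
    strict (collect (triples 5) fun _ => true) (fun full => certifyAll full spaces5 (tripleStates 4 spaces4) certificates5) = true := by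
  decide +kernel

theorem certifyAll_spaces6 :
    strict (collect (triples 6) fun _ => true) (fun full => certifyAll full spaces6 (tripleStates 5 spaces5) certificates6) = true := by
  decide +kernel

theorem certifyAll_spaces7 :
    strict (collect (triples 7) fun _ => true) (fun full => certifyAll full spaces7 (tripleStates 6 spaces6) certificates7) = true := by
  decide +kernel

theorem certifyAll_spaces8 :
    strict (collect (triples 8) fun _ => true) (fun full => certifyAll full spaces8 (tripleStates 7 spaces7) certificates8) = true := by
  decide +kernel

/-- The two spaces with a Fano plane are left out: matroidality excludes them, so their extensions
by sextuples need no target. -/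
theorem certifyAll_targets :
    strict (collect (triples 8 ++ sextuples) fun _ => true) (fun full => certifyAll full targets
      (sextupleStates (spaces8.filter fun m => !fanoSpaces.elem m)) sextupleCertificates) = true := by
  decide +kernel

/-! ### Soundness of the classification -/

theorem exists_lt_of_mem_triples {n : ℕ} {l : List ℕ} (hl : l ∈ triples n) :
    ∃ i j k, i < j ∧ j < k ∧ k < n ∧ l = [i, j, k] := by
  simp only [triples, List.mem_flatMap, List.mem_map, List.mem_range] at hl
  obtain ⟨k, hk, j, hj, i, hi, rfl⟩ := hl
  exact ⟨i, j, k, hi, hj, hk, rfl⟩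

theorem mem_triples {n i j k : ℕ} (hij : i < j) (hjk : j < k) (hk : k < n) :
    [i, j, k] ∈ triples n := by
  simp only [triples, List.mem_flatMap, List.mem_map, List.mem_range]
  exact ⟨k, hk, j, hjk, i, hij, rfl⟩

theorem isCluster_of_mem_tripleVars {n : ℕ} (hn : n < 8) :
    ∀ v ∈ tripleVars n, ∀ w ∈ v.2, ∃ q, IsCluster q ∧ w = faces q := by
  intro v hv w hw
  simp only [tripleVars, List.mem_flatMap, List.mem_map, List.mem_range] at hv
  obtain ⟨j, hj, i, hi, rfl⟩ := hv
  simp only [List.mem_map, List.mem_range] at hw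
  obtain ⟨d, hd, rfl⟩ := hw
  refine ⟨[d, i, j, n], ⟨?_, ?_, Or.inl rfl⟩, rfl⟩
  · simp only [List.nodup_cons, List.mem_cons, List.not_mem_nil, not_or, or_false,
      not_false_eq_true, List.nodup_nil, and_true]
    omega
  · simp only [List.mem_cons, List.not_mem_nil, or_false]
    omega

theorem isCluster_others : ∀ i < 8, IsCluster (others [i]) := by decide

theorem isCluster_of_mem_sextupleVars :
    ∀ v ∈ sextupleVars, ∀ w ∈ v.2, ∃ q, IsCluster q ∧ w = faces q := by
  intro v hv w hw
  simp only [sextupleVars, List.mem_flatMap, List.mem_map, List.mem_range] at hv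
  obtain ⟨j, hj, i, hi, rfl⟩ := hv
  simp only [List.mem_cons, List.not_mem_nil, or_false] at hw
  rcases hw with hw | hw
  exacts [⟨_, isCluster_others i (hi.trans hj), hw⟩, ⟨_, isCluster_others j hj, hw⟩]

theorem card_members_of_mem_triples {l : List ℕ} (hl : l ∈ triples 8) :
    (members (code l)).card = 3 := by
  obtain ⟨i, j, k, hij, hjk, hk, rfl⟩ := exists_lt_of_mem_triples hl
  rw [card_members_code]
  · rfl
  · simp only [List.nodup_cons, List.mem_cons, List.not_mem_nil, not_or, or_false,
      not_false_eq_true, List.nodup_nil, and_true]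
    omega
  · simp only [List.mem_cons, List.not_mem_nil, or_false]
    omega

theorem card_members_of_mem_sextuples {l : List ℕ} (hl : l ∈ sextuples) :
    (members (code l)).card = 6 := by
  have h : ∀ l ∈ sextuples, l.Nodup ∧ (∀ i ∈ l, i < 8) ∧ l.length = 6 := by decide
  obtain ⟨h1, h2, h3⟩ := h l hl
  rw [card_members_code h1 h2, h3]

theorem describes_of_agrees {m : ℕ} {V : List (List ℕ)} {F : Finset (Finset (Fin 8))}
    (h : Agrees m V F) :
    Describes (pack (collect V fun l => look (pack m) (code l)))
      (pack (collect V fun l => !look (pack m) (code l))) F where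
  mem c hc := by
    rw [pack_shiftRight, testBit_collect] at hc
    obtain ⟨l, hl, hml, rfl⟩ := hc
    rw [look_eq_testBit, pack_shiftRight] at hml
    exact (h l hl).2 hml
  notMem c hc := by
    rw [pack_shiftRight, testBit_collect] at hc
    obtain ⟨l, hl, hml, rfl⟩ := hc
    rw [look_eq_testBit, pack_shiftRight] at hml
    rw [h l hl]
    simpa using hml

/-- The family stays a family on all eight labels; only the range of triples on which it is compared
with a mask grows. This lets the permutations of successive stages be composed. -/
theorem exists_agrees_triples_succ {n : ℕ} (hn : n < 8) {masks targets certs : List ℕ}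
    (hcert : strict (collect (triples (n + 1)) fun _ => true)
      (fun full => certifyAll full targets (tripleStates n masks) certs) = true)
    {F : Finset (Finset (Fin 8))} (hF : IsBezout F)
    (h : ∃ m ∈ masks, ∃ σ : Equiv.Perm (Fin 8), Agrees m (triples n) (σ • F)) :
    ∃ m ∈ targets, ∃ σ : Equiv.Perm (Fin 8), Agrees m (triples (n + 1)) (σ • F) := by
  obtain ⟨m, hm, σ, hσ⟩ := h
  rw [strict_eq] at hcert
  obtain ⟨s, hs, hsF⟩ := exists_mem_search (hF.smul σ) (tripleVars n)
    (isCluster_of_mem_tripleVars hn) _ _ [] (describes_of_agrees hσ)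
  have hs' : s ∈ tripleStates n masks := by
    rw [tripleStates, List.mem_flatMap]
    refine ⟨m, hm, ?_⟩
    rw [strict_eq, strict_eq, strict_eq]
    exact hs
  obtain ⟨c, hc⟩ := exists_certifies hcert hs'
  obtain ⟨m', hm', τ, hτ⟩ := exists_agrees_of_certifies hc hsF
  exact ⟨m', hm', τ * σ, by rwa [mul_smul]⟩

theorem exists_agrees_spaces8 {F : Finset (Finset (Fin 8))} (hF : IsBezout F) :
    ∃ m ∈ spaces8, ∃ σ : Equiv.Perm (Fin 8), Agrees m (triples 8) (σ • F) := by
  refine exists_agrees_triples_succ (by norm_num) certifyAll_spaces8 hF ?_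
  refine exists_agrees_triples_succ (by norm_num) certifyAll_spaces7 hF ?_
  refine exists_agrees_triples_succ (by norm_num) certifyAll_spaces6 hF ?_
  refine exists_agrees_triples_succ (by norm_num) certifyAll_spaces5 hF ?_
  refine exists_agrees_triples_succ (by norm_num) certifyAll_spaces4 hF ?_
  refine exists_agrees_triples_succ (by norm_num) certifyAll_spaces3 hF ?_
  -- Two labels carry no triple, so the enumeration starts with the empty mask.
  refine ⟨0, by simp, 1, fun l hl => ?_⟩
  obtain ⟨i, j, k, hij, hjk, hk, -⟩ := exists_lt_of_mem_triples hl
  omega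

theorem members_subset_members {c d : ℕ} (h : c &&& d = c) : members c ⊆ members d := by
  intro i hi
  rw [mem_members] at hi ⊢
  rw [← h, Nat.testBit_and, Bool.and_eq_true] at hi
  exact hi.2

/-- A sextuple that contains a collinear triple is rejected in advance, which shortens the search.
-/
theorem members_notMem_of_blocks {m : ℕ} {F : Finset (Finset (Fin 8))} (hF : IsBezout F)
    (h : Agrees m (triples 8) F) {l : List ℕ} (hl : l ∈ sextuples)
    (hb : (triples 8).any (blocks (pack m) (code l)) = true) : members (code l) ∉ F := by
  obtain ⟨t, ht, hbt⟩ := List.any_eq_true.1 hb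
  rw [blocks, Bool.and_eq_true, Nat.beq_eq, look_eq_testBit, pack_shiftRight] at hbt
  exact fun hlF => hF.not_subset _ ((h t ht).2 hbt.1) _ hlF (card_members_of_mem_triples ht)
    (card_members_of_mem_sextuples hl) (members_subset_members hbt.2)

theorem exists_agrees_targets {F : Finset (Finset (Fin 8))} (hF : IsBezout F)
    (h : ∃ m ∈ spaces8.filter (fun m => !fanoSpaces.elem m), ∃ σ : Equiv.Perm (Fin 8),
      Agrees m (triples 8) (σ • F)) :
    ∃ m ∈ targets, ∃ σ : Equiv.Perm (Fin 8), Agrees m (triples 8 ++ sextuples) (σ • F) := by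
  obtain ⟨m, hm, σ, hσ⟩ := h
  have hcert := certifyAll_targets
  rw [strict_eq] at hcert
  have hd : Describes (pack (collect (triples 8) fun l => look (pack m) (code l)))
      (pack (Nat.lor (collect (triples 8) fun l => !look (pack m) (code l))
        (collect sextuples fun l => (triples 8).any (blocks (pack m) (code l))))) (σ • F) := by
    refine ⟨(describes_of_agrees hσ).mem, fun c hc => ?_⟩
    have hlor : ∀ x y : ℕ, Nat.lor x y = x ||| y := fun _ _ => rfl
    rw [pack_shiftRight, hlor, Nat.testBit_or, Bool.or_eq_true] at hc
    rcases hc with hc | hc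
    · exact (describes_of_agrees hσ).notMem c (by rwa [pack_shiftRight])
    · obtain ⟨l, hl, hb, rfl⟩ := testBit_collect.1 hc
      exact members_notMem_of_blocks (hF.smul σ) hσ hl hb
  obtain ⟨s, hs, hsF⟩ := exists_mem_search (hF.smul σ)
    (sextupleVars.filter fun v => !look (pack (Nat.lor
      (collect (triples 8) fun l => !look (pack m) (code l))
        (collect sextuples fun l => (triples 8).any (blocks (pack m) (code l))))) v.1)
    (fun v hv => isCluster_of_mem_sextupleVars v (List.mem_filter.1 hv).1) _ _ [] hd
  have hs' : s ∈ sextupleStates (spaces8.filter fun m => !fanoSpaces.elem m) := by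
    rw [sextupleStates, List.mem_flatMap]
    refine ⟨m, hm, ?_⟩
    rw [strict_eq, strict_eq, strict_eq]
    exact hs
  obtain ⟨c, hc⟩ := exists_certifies hcert hs'
  obtain ⟨m', hm', τ, hτ⟩ := exists_agrees_of_certifies hc hsF
  exact ⟨m', hm', τ * σ, by rwa [mul_smul]⟩

theorem exists_agrees {F : Finset (Finset (Fin 8))} (hF : IsBezout F) :
    (∃ m ∈ fanoSpaces, ∃ σ : Equiv.Perm (Fin 8), Agrees m (triples 8) (σ • F)) ∨
    ∃ m ∈ targets, ∃ σ : Equiv.Perm (Fin 8), Agrees m (triples 8 ++ sextuples) (σ • F) := by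
  obtain ⟨m, hm, h⟩ := exists_agrees_spaces8 hF
  by_cases hf : m ∈ fanoSpaces
  · exact Or.inl ⟨m, hf, h⟩
  · exact Or.inr (exists_agrees_targets hF ⟨m, by simp [hm, hf], h⟩)

/-! ### The family of triples and sextuples of a pair -/

/-- All triples and sextuples of `Q`. -/
def QPair.family (Q : QPair) : Finset (Finset (Fin 8)) := Q.triples ∪ Q.sextuples

theorem QPair.mem_family_of_card_three {Q : QPair} {I : Finset (Fin 8)} (hI : I.card = 3) :
    I ∈ Q.family ↔ I ∈ Q.triples := by
  rw [family, Finset.mem_union, or_iff_left]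
  intro h
  have := Q.card_sextuple I h
  omega

theorem QPair.mem_family_of_card_six {Q : QPair} {J : Finset (Fin 8)} (hJ : J.card = 6) :
    J ∈ Q.family ↔ J ∈ Q.sextuples := by
  rw [family, Finset.mem_union, or_iff_right]
  intro h
  have := Q.card_triple J h
  omega

theorem QPair.smul_triples (σ : Equiv.Perm (Fin 8)) (Q : QPair) :
    (σ • Q).triples = σ • Q.triples := rfl

theorem QPair.smul_sextuples (σ : Equiv.Perm (Fin 8)) (Q : QPair) :
    (σ • Q).sextuples = σ • Q.sextuples := rfl

theorem QPair.smul_family (σ : Equiv.Perm (Fin 8)) (Q : QPair) :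
    (σ • Q).family = σ • Q.family := by
  rw [family, smul_triples, smul_sextuples, family, Finset.smul_finset_union]

/-- Two faces of a set `q` have union `q` and intersection of size `q.card - 2`. For 4 and 7
elements this exceeds 1 and 4, so the criteria on lines and on conics apply and become one closure
condition. -/
theorem WeakBezout.isBezout {Q : QPair} (h : WeakBezout Q) : IsBezout Q.family where
  closed q hq i hi j hj hij hFi hFj k hk := by
    have hcard : ∀ x ∈ q, (q.erase x).card = q.card - 1 := fun x hx => Finset.card_erase_of_mem hx
    have hunion : q.erase i ∪ q.erase j = q := by
      ext x
      simp only [Finset.mem_union, Finset.mem_erase]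
      constructor
      · rintro (h | h) <;> exact h.2
      · intro hx
        by_cases hxi : x = i
        · exact Or.inr ⟨hxi ▸ hij, hx⟩
        · exact Or.inl ⟨hxi, hx⟩
    have hinter : (q.erase i ∩ q.erase j).card = q.card - 2 := by
      have : q.erase i ∩ q.erase j = (q.erase i).erase j := by
        ext x
        simp only [Finset.mem_inter, Finset.mem_erase]
        tauto
      rw [this, Finset.card_erase_of_mem (Finset.mem_erase.2 ⟨hij.symm, hj⟩), hcard i hi]
      omega
    have hi' := hcard i hi
    have hj' := hcard j hj
    have hk' := hcard k hk
    rcases hq with hq | hq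
    · rw [hq] at hi' hj' hk' hinter
      rw [QPair.mem_family_of_card_three hi'] at hFi
      rw [QPair.mem_family_of_card_three hj'] at hFj
      rw [QPair.mem_family_of_card_three hk']
      exact h.line_line _ hFi _ hFj (by omega) _ (by rw [hunion]; exact Finset.erase_subset _ _) hk'
    · rw [hq] at hi' hj' hk' hinter
      rw [QPair.mem_family_of_card_six hi'] at hFi
      rw [QPair.mem_family_of_card_six hj'] at hFj
      rw [QPair.mem_family_of_card_six hk']
      exact h.conic_conic _ hFi _ hFj (by omega) _ (by rw [hunion]; exact Finset.erase_subset _ _) hk'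
  not_subset I hI J hJ hI3 hJ6 hIJ := by
    rw [QPair.mem_family_of_card_three hI3] at hI
    rw [QPair.mem_family_of_card_six hJ6] at hJ
    have := h.line_conic I hI J hJ
    rw [Finset.inter_eq_left.2 hIJ, hI3] at this
    omega

theorem exists_triple_of_card {I : Finset (Fin 8)} (hI : I.card = 3) :
    ∃ i j k : Fin 8, i < j ∧ j < k ∧ I = {i, j, k} ∧ members (code [i, j, k]) = I := by
  have key : ∀ i j k : Fin 8, ∀ I : Finset (Fin 8), I = {i, j, k} →
      members (code [(i : ℕ), j, k]) = I := by
    rintro i j k I rfl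
    ext x
    simp [mem_members_code, Fin.val_inj]
  obtain ⟨f, hf⟩ : ∃ f : Fin 3 ↪o Fin 8, Finset.univ.map f.toEmbedding = I :=
    ⟨I.orderEmbOfFin hI, by simp⟩
  have hI' : I = {f 0, f 1, f 2} := by
    rw [← hf]
    ext x
    simp [Fin.exists_fin_succ, eq_comm]
  exact ⟨f 0, f 1, f 2, f.strictMono (by decide), f.strictMono (by decide), hI', key _ _ _ _ hI'⟩

theorem exists_mem_sextuples : ∀ J : Finset (Fin 8), J.card = 6 →
    ∃ l ∈ sextuples, members (code l) = J := by
  decide +kernel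

theorem exists_mem_triples {I : Finset (Fin 8)} (hI : I.card = 3) :
    ∃ l ∈ triples 8, members (code l) = I := by
  obtain ⟨i, j, k, hij, hjk, -, h⟩ := exists_triple_of_card hI
  exact ⟨_, mem_triples hij hjk k.2, h⟩

/-- A pair is determined by its mask. -/
theorem eq_of_agrees {m : ℕ} {Q Q' : QPair} (h : Agrees m (triples 8 ++ sextuples) Q.family)
    (h' : Agrees m (triples 8 ++ sextuples) Q'.family) : Q = Q' := by
  have hmem : ∀ l ∈ triples 8 ++ sextuples,
      (members (code l) ∈ Q.family ↔ members (code l) ∈ Q'.family) := fun l hl =>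
    (h l hl).trans (h' l hl).symm
  refine QPair.ext ?_ ?_ <;> ext I
  · by_cases hI : I.card = 3
    · obtain ⟨l, hl, rfl⟩ := exists_mem_triples hI
      rw [← QPair.mem_family_of_card_three hI, ← QPair.mem_family_of_card_three hI]
      exact hmem l (List.mem_append_left _ hl)
    · exact ⟨fun h => absurd (Q.card_triple I h) hI, fun h => absurd (Q'.card_triple I h) hI⟩
  · by_cases hI : I.card = 6
    · obtain ⟨l, hl, rfl⟩ := exists_mem_sextuples I hI
      rw [← QPair.mem_family_of_card_six hI, ← QPair.mem_family_of_card_six hI]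
      exact hmem l (List.mem_append_right _ hl)
    · exact ⟨fun h => absurd (Q.card_sextuple I h) hI, fun h => absurd (Q'.card_sextuple I h) hI⟩

/-! ### Brackets and quadratic forms in three variables -/

section Brackets

variable {R : Type*} [CommRing R]

/-- The determinant of three vectors. -/
def bracket (u v w : Fin 3 → R) : R :=
  u 0 * (v 1 * w 2 - v 2 * w 1) - u 1 * (v 0 * w 2 - v 2 * w 0) + u 2 * (v 0 * w 1 - v 1 * w 0)

/-- The value at `x` of the quadratic form with matrix `a`. -/
def quadVal (a : Fin 3 → Fin 3 → R) (x : Fin 3 → R) : R := ∑ i, ∑ j, a i j * x i * x j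

/-- The polar form of the quadratic form with matrix `a`. -/
def polar (a : Fin 3 → Fin 3 → R) (x y : Fin 3 → R) : R :=
  ∑ i, ∑ j, a i j * (x i * y j + y i * x j)

/-- Cramer's rule without denominators. It holds over any commutative ring, so `x` may also be the
vector of the variables of a polynomial ring. -/
theorem bracket_smul_eq (u v w x : Fin 3 → R) :
    bracket u v w • x = bracket x v w • u + bracket u x w • v + bracket u v x • w := by
  funext i
  fin_cases i <;> simp [bracket] <;> ring

theorem quadVal_smul (a : Fin 3 → Fin 3 → R) (t : R) (x : Fin 3 → R) :
    quadVal a (t • x) = t ^ 2 * quadVal a x := by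
  simp only [quadVal, Fin.sum_univ_three, Pi.smul_apply, smul_eq_mul]
  ring

theorem quadVal_add_add (a : Fin 3 → Fin 3 → R) (r s t : R) (u v w : Fin 3 → R) :
    quadVal a (r • u + s • v + t • w) = r ^ 2 * quadVal a u + s ^ 2 * quadVal a v +
      t ^ 2 * quadVal a w + s * t * polar a v w + r * t * polar a u w + r * s * polar a u v := by
  simp only [quadVal, polar, Fin.sum_univ_three, Pi.add_apply, Pi.smul_apply, smul_eq_mul]
  ring

/-- Evaluate the form on Cramer's rule. If `u`, `v`, `w` are zeros of the form, only the polar terms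
survive, and these are a linear form in `cremona u v w x`: conics through the fundamental points
correspond to lines. -/
theorem bracket_sq_mul_quadVal (a : Fin 3 → Fin 3 → R) (u v w x : Fin 3 → R) :
    bracket u v w ^ 2 * quadVal a x =
      bracket x v w ^ 2 * quadVal a u + bracket u x w ^ 2 * quadVal a v +
      bracket u v x ^ 2 * quadVal a w + bracket u x w * bracket u v x * polar a v w +
      bracket x v w * bracket u v x * polar a u w + bracket x v w * bracket u x w * polar a u v := by
  rw [← quadVal_smul, bracket_smul_eq, quadVal_add_add]

/-- The image of `x` under the quadratic transformation with fundamental points `u`, `v`, `w`. -/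
def cremona (u v w x : Fin 3 → R) : Fin 3 → R :=
  ![bracket u x w * bracket u v x, bracket x v w * bracket u v x, bracket x v w * bracket u x w]

/-- This expression vanishes if the six points lie on a conic. -/
def conicBracket (u v w x y z : Fin 3 → R) : R :=
  bracket (cremona u v w x) (cremona u v w y) (cremona u v w z)

variable {S : Type*} [CommRing S] (f : R →+* S)

theorem map_bracket (u v w : Fin 3 → R) : f (bracket u v w) = bracket (f ∘ u) (f ∘ v) (f ∘ w) := by
  simp [bracket]

theorem map_quadVal (a : Fin 3 → Fin 3 → R) (x : Fin 3 → R) :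
    f (quadVal a x) = quadVal (fun i j => f (a i j)) (f ∘ x) := by
  simp [quadVal]

theorem map_polar (a : Fin 3 → Fin 3 → R) (x y : Fin 3 → R) :
    f (polar a x y) = polar (fun i j => f (a i j)) (f ∘ x) (f ∘ y) := by
  simp [polar]

end Brackets

section Field

variable {K : Type*} [Field K]

theorem bracket_eq_zero_iff (u v w : Fin 3 → K) :
    bracket u v w = 0 ↔ ∃ l : Fin 3 → K, l ≠ 0 ∧ l ⬝ᵥ u = 0 ∧ l ⬝ᵥ v = 0 ∧ l ⬝ᵥ w = 0 := by
  have h : bracket u v w = (Matrix.of ![u, v, w]).det := by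
    rw [Matrix.det_fin_three]
    simp [bracket]
    ring
  rw [h, ← Matrix.exists_mulVec_eq_zero_iff]
  refine exists_congr fun l => and_congr_right fun _ => ?_
  constructor
  · intro hl
    have h0 := congrFun hl 0
    have h1 := congrFun hl 1
    have h2 := congrFun hl 2
    simp only [Matrix.mulVec, Matrix.of_apply, Matrix.cons_val, Pi.zero_apply] at h0 h1 h2
    exact ⟨by rwa [dotProduct_comm], by rwa [dotProduct_comm], by rwa [dotProduct_comm]⟩
  · rintro ⟨h0, h1, h2⟩
    funext i
    fin_cases i
    · simpa [Matrix.mulVec, dotProduct_comm] using h0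
    · simpa [Matrix.mulVec, dotProduct_comm] using h1
    · simpa [Matrix.mulVec, dotProduct_comm] using h2

/-- The brackets with the unit vectors are the coordinates of the cross product. If they all vanish,
then `u` is the multiple of `v` by the quotient at a place where `v` is not zero. -/
theorem exists_bracket_ne_zero {u v : Fin 3 → K} (hv : v ≠ 0) (h : ∀ t : K, t • v ≠ u) :
    ∃ e, bracket u v e ≠ 0 := by
  by_contra hc
  push Not at hc
  have h0 := hc ![1, 0, 0]
  have h1 := hc ![0, 1, 0]
  have h2 := hc ![0, 0, 1]
  simp [bracket] at h0 h1 h2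
  obtain ⟨i, hi⟩ := Function.ne_iff.1 hv
  refine h (u i / v i) ?_
  have hi' : v i ≠ 0 := hi
  funext j
  simp only [Pi.smul_apply, smul_eq_mul]
  rw [div_mul_eq_mul_div, div_eq_iff hi']
  fin_cases i <;> fin_cases j <;> simp only [Fin.zero_eta, Fin.mk_one, Fin.reduceFinMk] <;>
    first
    | ring1
    | linear_combination h0
    | linear_combination -h0
    | linear_combination h1
    | linear_combination -h1
    | linear_combination h2
    | linear_combination -h2

/-! ### Conics -/

open MvPolynomial

/-- The quadratic form with matrix `a` as a polynomial. -/
noncomputable def quadPoly (a : Fin 3 → Fin 3 → K) : MvPolynomial (Fin 3) K :=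
  quadVal (fun i j => C (a i j)) X

theorem isHomogeneous_quadPoly (a : Fin 3 → Fin 3 → K) : (quadPoly a).IsHomogeneous 2 := by
  refine IsHomogeneous.sum _ _ _ fun i _ => IsHomogeneous.sum _ _ _ fun j _ => ?_
  exact ((isHomogeneous_C_mul_X (a i j) i).mul (isHomogeneous_X K j) :)

theorem eval_quadPoly (a : Fin 3 → Fin 3 → K) (x : Fin 3 → K) :
    eval x (quadPoly a) = quadVal a x := by
  rw [quadPoly, map_quadVal]
  congr 1
  · simp
  · funext i; simp

theorem exists_eq_sum_of_isHomogeneous_one {F : MvPolynomial (Fin 3) K} (hF : F.IsHomogeneous 1) :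
    ∃ c : Fin 3 → K, F = ∑ i, C (c i) * X i := by
  have h : F ∈ homogeneousSubmodule (Fin 3) K 1 := hF
  rw [homogeneousSubmodule_one_eq_span_X, Submodule.mem_span_range_iff_exists_fun] at h
  obtain ⟨c, hc⟩ := h
  exact ⟨c, by simp [← hc, smul_eq_C_mul]⟩

/-- Forms of degree two are sums of products of two linear forms, and such a product has the matrix
`c i * d j`. Matrices are not required to be symmetric, so characteristic two needs no special
treatment. -/
theorem exists_eq_quadPoly {F : MvPolynomial (Fin 3) K} (hF : F.IsHomogeneous 2) :
    ∃ a, F = quadPoly a := by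
  have h : F ∈ homogeneousSubmodule (Fin 3) K 2 := hF
  rw [← homogeneousSubmodule_one_pow, pow_two] at h
  induction h using Submodule.mul_induction_on' with
  | mem_mul_mem g hg h hh =>
    obtain ⟨c, rfl⟩ := exists_eq_sum_of_isHomogeneous_one hg
    obtain ⟨d, rfl⟩ := exists_eq_sum_of_isHomogeneous_one hh
    refine ⟨fun i j => c i * d j, ?_⟩
    simp only [quadPoly, quadVal, Fin.sum_univ_three, C_mul]
    ring
  | add g hg h hh ihg ihh =>
    have hm : ∀ p, p ∈ homogeneousSubmodule (Fin 3) K 1 * homogeneousSubmodule (Fin 3) K 1 →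
        p.IsHomogeneous 2 := fun p hp => by
      rw [← pow_two, homogeneousSubmodule_one_pow] at hp
      exact hp
    obtain ⟨a, ha⟩ := ihg (hm g hg)
    obtain ⟨b, hb⟩ := ihh (hm h hh)
    refine ⟨fun i j => a i j + b i j, ?_⟩
    rw [ha, hb]
    simp only [quadPoly, quadVal, Fin.sum_univ_three, C_add]
    ring

theorem not_isUnit_of_eval_zero {F : MvPolynomial (Fin 3) K} (h : eval 0 F = 0) : ¬ IsUnit F :=
  fun hu => not_isUnit_zero (h ▸ hu.map (eval (0 : Fin 3 → K)))

/-- Three collinear points of an irreducible conic are not distinct. -/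
theorem bracket_ne_zero_of_irreducible {a : Fin 3 → Fin 3 → K} (ha : Irreducible (quadPoly a))
    {u v w : Fin 3 → K} (huv : ∃ e, bracket u v e ≠ 0) (huw : ∃ e, bracket u w e ≠ 0)
    (hvw : ∃ e, bracket v w e ≠ 0) (hu : quadVal a u = 0) (hv : quadVal a v = 0)
    (hw : quadVal a w = 0) : bracket u v w ≠ 0 := by
  intro h
  obtain ⟨e, he⟩ := huv
  have hcr := bracket_smul_eq u v e w
  rw [h, zero_smul, add_zero] at hcr
  -- By `hcr`, a multiple of `w` by a nonzero scalar is a combination of `u` and `v`. If the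
  -- coefficient of `u` vanished, `w` would be proportional to `v`; likewise for the coefficient of
  -- `v` below.
  have h1 : bracket w v e ≠ 0 := by
    intro h1
    obtain ⟨f, hf⟩ := hvw
    apply hf
    have : bracket u v e * bracket v w f = bracket v (bracket u v e • w) f := by
      simp only [bracket, Pi.smul_apply, smul_eq_mul]; ring
    rw [hcr, h1] at this
    have h0 : bracket v ((0 : K) • u + bracket u w e • v) f = 0 := by
      simp only [bracket, Pi.add_apply, Pi.smul_apply, smul_eq_mul]; ring
    rw [h0] at this
    exact (mul_eq_zero.1 this).resolve_left he
  have h2 : bracket u w e ≠ 0 := by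
    intro h2
    obtain ⟨f, hf⟩ := huw
    apply hf
    have : bracket u v e * bracket u w f = bracket u (bracket u v e • w) f := by
      simp only [bracket, Pi.smul_apply, smul_eq_mul]; ring
    rw [hcr, h2] at this
    have h0 : bracket u (bracket w v e • u + (0 : K) • v) f = 0 := by
      simp only [bracket, Pi.add_apply, Pi.smul_apply, smul_eq_mul]; ring
    rw [h0] at this
    exact (mul_eq_zero.1 this).resolve_left he
  -- A third zero on the line through `u` and `v` leaves only the mixed term, so the polar form
  -- vanishes at `u`, `v` and the whole line belongs to the conic.
  have hp := bracket_sq_mul_quadVal a u v e w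
  rw [hu, hv, hw, h] at hp
  have hpol : polar a u v = 0 := by
    have : bracket w v e * bracket u w e * polar a u v = 0 := by linear_combination -hp
    simpa [h1, h2] using this
  -- The same identity at the generic point: every remaining term contains `bracket u v X`, the
  -- equation of the line, which is thus a factor of the conic.
  have hX := bracket_sq_mul_quadVal (fun i j => C (a i j)) (C ∘ u) (C ∘ v) (C ∘ e)
    (X : Fin 3 → MvPolynomial (Fin 3) K)
  rw [← map_quadVal, ← map_quadVal, ← map_polar _ _ u v, hu, hv, hpol, map_zero, ← map_bracket]
    at hX
  have hC : (C ((bracket u v e)⁻¹ ^ 2) : MvPolynomial (Fin 3) K) * C (bracket u v e) ^ 2 = 1 := by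
    rw [← map_pow, ← map_mul, ← mul_pow, inv_mul_cancel₀ he, one_pow, map_one]
  have hfac : quadPoly a = bracket (C ∘ u) (C ∘ v) X * (C ((bracket u v e)⁻¹ ^ 2) *
      (bracket (C ∘ u) (C ∘ v) X * quadVal (fun i j => C (a i j)) (C ∘ e) +
        bracket (C ∘ u) X (C ∘ e) * polar (fun i j => C (a i j)) (C ∘ v) (C ∘ e) +
        bracket X (C ∘ v) (C ∘ e) * polar (fun i j => C (a i j)) (C ∘ u) (C ∘ e))) := by
    rw [quadPoly]
    linear_combination (-quadVal (fun i j => C (a i j)) X) * hC +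
      C ((bracket u v e)⁻¹ ^ 2) * hX
  -- Both factors vanish at the origin, so neither is a unit.
  rcases ha.isUnit_or_isUnit hfac with hunit | hunit
  · exact not_isUnit_of_eval_zero (by simp [bracket]) hunit
  · exact not_isUnit_of_eval_zero (by simp [bracket]) hunit

theorem exists_dotProduct_of_totalDegree_eq_one {g : MvPolynomial (Fin 3) K}
    (hg : g.totalDegree = 1) : ∃ (g₀ : K) (c : Fin 3 → K), g = C g₀ + ∑ i, C (c i) * X i := by
  obtain ⟨c, hc⟩ := exists_eq_sum_of_isHomogeneous_one (homogeneousComponent_isHomogeneous 1 g)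
  refine ⟨coeff 0 g, c, ?_⟩
  rw [← hc, ← homogeneousComponent_zero]
  conv_lhs => rw [← sum_homogeneousComponent g, hg]
  simp [Finset.sum_range_succ]

/-- A nonzero quadratic form with six zeros of which no three are collinear is irreducible. -/
theorem irreducible_of_six_zeros {F : MvPolynomial (Fin 3) K} (hF : F.IsHomogeneous 2)
    (hF0 : F ≠ 0) {v : Fin 6 → Fin 3 → K} (hv : ∀ i, eval (v i) F = 0)
    (hb : ∀ i j k, i ≠ j → i ≠ k → j ≠ k → bracket (v i) (v j) (v k) ≠ 0) : Irreducible F := by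
  have hdeg := hF.totalDegree hF0
  refine ⟨fun hu => ?_, fun g h hgh => ?_⟩
  · rw [isUnit_iff_totalDegree_of_isReduced] at hu
    omega
  by_contra! hcon
  obtain ⟨hg, hh⟩ := hcon
  have hg0 : g ≠ 0 := by rintro rfl; simp at hgh; exact hF0 hgh
  have hh0 : h ≠ 0 := by rintro rfl; simp at hgh; exact hF0 hgh
  have hpos : ∀ p : MvPolynomial (Fin 3) K, p ≠ 0 → ¬ IsUnit p → p.totalDegree ≠ 0 := by
    intro p hp hpu h0
    refine hpu (isUnit_iff_totalDegree_of_isReduced.2 ⟨?_, h0⟩)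
    rw [totalDegree_eq_zero_iff_eq_C] at h0
    rw [isUnit_iff_ne_zero]
    intro hc
    rw [hc, C_0] at h0
    exact hp h0
  have hsum : g.totalDegree + h.totalDegree = 2 := by
    rw [← totalDegree_mul_of_isDomain hg0 hh0, ← hgh, hdeg]
  have := hpos g hg0 hg
  have := hpos h hh0 hh
  obtain ⟨g₀, c, hgc⟩ := exists_dotProduct_of_totalDegree_eq_one (g := g) (by omega)
  obtain ⟨h₀, d, hhd⟩ := exists_dotProduct_of_totalDegree_eq_one (g := h) (by omega)
  have hlin : ∀ c : Fin 3 → K, (∑ i, C (c i) * X i : MvPolynomial (Fin 3) K).IsHomogeneous 1 :=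
    fun c => IsHomogeneous.sum _ _ _ fun i _ => isHomogeneous_C_mul_X _ _
  -- The factors of a homogeneous polynomial are not assumed homogeneous; comparing the components
  -- of degree two shows that `F` is the product of their linear parts.
  have hprod : F = (∑ i, C (c i) * X i) * ∑ i, C (d i) * X i := by
    have h2 := homogeneousComponent_of_mem (n := 2) (m := 2) (p := F) hF
    rw [if_pos rfl, hgh, hgc, hhd, add_mul, mul_add, mul_add, map_add, map_add, map_add,
      ← C_mul, homogeneousComponent_C_mul, mul_comm _ (C h₀), homogeneousComponent_C_mul,
      homogeneousComponent_of_mem (hlin c), homogeneousComponent_of_mem (hlin d),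
      homogeneousComponent_of_mem (isHomogeneous_C _ _),
      homogeneousComponent_of_mem ((hlin c).mul (hlin d))] at h2
    simp only [OfNat.ofNat_ne_zero, OfNat.ofNat_ne_one, if_false, mul_zero, zero_add, if_true,
      Nat.reduceAdd] at h2
    rw [C_mul] at h2
    rw [hgh, hgc, hhd]
    linear_combination -h2
  have hval : ∀ i, c ⬝ᵥ v i = 0 ∨ d ⬝ᵥ v i = 0 := by
    intro i
    have := hv i
    rw [hprod, map_mul, mul_eq_zero] at this
    simpa [dotProduct] using this
  have hne : ∀ c : Fin 3 → K, (∑ i, C (c i) * X i : MvPolynomial (Fin 3) K) ≠ 0 → c ≠ 0 := by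
    rintro c hc rfl
    simp at hc
  have hc : c ≠ 0 := hne c (left_ne_zero_of_mul (hprod ▸ hF0))
  have hd : d ≠ 0 := hne d (right_ne_zero_of_mul (hprod ▸ hF0))
  have hcard : ∀ (s : Finset (Fin 6)) (l : Fin 3 → K), l ≠ 0 → (∀ i ∈ s, l ⬝ᵥ v i = 0) →
      s.card ≤ 2 := by
    intro s l hl hs
    by_contra! h2
    obtain ⟨i, hi, j, hj, k, hk, hij, hik, hjk⟩ := Finset.two_lt_card.1 h2
    exact hb i j k hij hik hjk
      ((bracket_eq_zero_iff _ _ _).2 ⟨l, hl, hs i hi, hs j hj, hs k hk⟩)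
  classical
  -- Each of the two lines carries at most two of the six zeros, so together they cannot account for
  -- all six.
  have h1 := hcard (Finset.univ.filter fun i => c ⬝ᵥ v i = 0) c hc (by simp)
  have h2 := hcard (Finset.univ.filter fun i => ¬ c ⬝ᵥ v i = 0) d hd (by
    intro i hi
    exact (hval i).resolve_left (Finset.mem_filter.1 hi).2)
  have h3 := Finset.card_filter_add_card_filter_not (s := (Finset.univ : Finset (Fin 6)))
    (fun i => c ⬝ᵥ v i = 0)
  simp only [Finset.card_univ, Fintype.card_fin] at h3
  omega

/-- The three polar values are the coefficients of a line through the images of all zeros of the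
form. Were they all zero, the identity at the generic point would make the form itself zero. -/
theorem conicBracket_eq_zero {a : Fin 3 → Fin 3 → K} (ha : quadPoly a ≠ 0)
    {u v w x y z : Fin 3 → K} (hb : bracket u v w ≠ 0) (hu : quadVal a u = 0)
    (hv : quadVal a v = 0) (hw : quadVal a w = 0) (hx : quadVal a x = 0) (hy : quadVal a y = 0)
    (hz : quadVal a z = 0) : conicBracket u v w x y z = 0 := by
  have key : ∀ q, quadVal a q = 0 →
      ![polar a v w, polar a u w, polar a u v] ⬝ᵥ cremona u v w q = 0 := by
    intro q hq
    have := bracket_sq_mul_quadVal a u v w q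
    rw [hq, hu, hv, hw] at this
    simp [cremona, dotProduct, Fin.sum_univ_three]
    linear_combination -this
  refine (bracket_eq_zero_iff _ _ _).2 ⟨_, fun h0 => ha ?_, key x hx, key y hy, key z hz⟩
  have h1 : polar a v w = 0 := congrFun h0 0
  have h2 : polar a u w = 0 := congrFun h0 1
  have h3 : polar a u v = 0 := congrFun h0 2
  have hX := bracket_sq_mul_quadVal (fun i j => C (a i j)) (C ∘ u) (C ∘ v) (C ∘ w)
    (X : Fin 3 → MvPolynomial (Fin 3) K)
  rw [← map_quadVal, ← map_quadVal, ← map_quadVal, ← map_polar _ _ u v, ← map_polar _ _ u w,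
    ← map_polar _ _ v w, hu, hv, hw, h1, h2, h3, map_zero, ← map_bracket] at hX
  simp only [mul_zero, add_zero, mul_eq_zero, pow_eq_zero_iff, ne_eq, OfNat.ofNat_ne_zero,
    not_false_eq_true, C_eq_zero, hb, false_or] at hX
  exact hX

/-- The coordinates of `cremona u v w x` are products of two linear forms in `x`, so a line pulls
back to a conic. -/
theorem exists_quadVal_eq (u v w : Fin 3 → K) (l : Fin 3 → K) :
    ∃ a, ∀ x, quadVal a x = l ⬝ᵥ cremona u v w x := by
  have h : ∀ r s : Fin 3 → K, ∃ a, ∀ x, quadVal a x = (r ⬝ᵥ x) * (s ⬝ᵥ x) := fun r s =>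
    ⟨fun i j => r i * s j, fun x => by
      simp only [quadVal, dotProduct, Fin.sum_univ_three]; ring⟩
  have hlin : ∀ v w : Fin 3 → K, ∃ r : Fin 3 → K, ∀ x, r ⬝ᵥ x = bracket x v w := fun v w =>
    ⟨![v 1 * w 2 - v 2 * w 1, -(v 0 * w 2 - v 2 * w 0), v 0 * w 1 - v 1 * w 0], fun x => by
      simp [dotProduct, Fin.sum_univ_three, bracket]; ring⟩
  obtain ⟨r, hr⟩ := hlin v w
  obtain ⟨s, hs⟩ := hlin w u
  obtain ⟨t, ht⟩ := hlin u v
  have hs' : ∀ x, s ⬝ᵥ x = bracket u x w := fun x => by rw [hs]; simp only [bracket]; ring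
  have ht' : ∀ x, t ⬝ᵥ x = bracket u v x := fun x => by rw [ht]; simp only [bracket]; ring
  obtain ⟨a, ha⟩ := h s t
  obtain ⟨b, hb⟩ := h r t
  obtain ⟨c, hc⟩ := h r s
  refine ⟨fun i j => l 0 * a i j + l 1 * b i j + l 2 * c i j, fun x => ?_⟩
  have : quadVal (fun i j => l 0 * a i j + l 1 * b i j + l 2 * c i j) x =
      l 0 * quadVal a x + l 1 * quadVal b x + l 2 * quadVal c x := by
    simp only [quadVal, Fin.sum_univ_three]; ring
  rw [this, ha, hb, hc, hr, hs', ht']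
  simp [dotProduct, Fin.sum_univ_three, cremona]

/-- Pull back the line through the three images. The resulting conic also passes through `u`, `v`,
`w`, where the transformation vanishes. -/
theorem exists_conic_of_conicBracket_eq_zero {u v w x y z : Fin 3 → K} (hb : bracket u v w ≠ 0)
    (h : conicBracket u v w x y z = 0) : ∃ a, quadPoly a ≠ 0 ∧ quadVal a u = 0 ∧
      quadVal a v = 0 ∧ quadVal a w = 0 ∧ quadVal a x = 0 ∧ quadVal a y = 0 ∧
      quadVal a z = 0 := by
  obtain ⟨l, hl, hx, hy, hz⟩ := (bracket_eq_zero_iff _ _ _).1 h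
  obtain ⟨a, ha⟩ := exists_quadVal_eq u v w l
  refine ⟨a, fun h0 => hl ?_, ?_, ?_, ?_, by rw [ha, hx], by rw [ha, hy], by rw [ha, hz]⟩
  · have hz : ∀ q, l ⬝ᵥ cremona u v w q = 0 := fun q => by
      rw [← ha, ← eval_quadPoly, h0, map_zero]
    -- A point on the line through two fundamental points, but different from both, goes to a
    -- multiple of a unit vector. These three values recover the coefficients of `l`, so a zero form
    -- would give a zero line.
    have e1 := hz (v + w)
    have e2 := hz (u + w)
    have e3 := hz (u + v)
    have c1 : cremona u v w (v + w) = ![bracket u v w ^ 2, 0, 0] := by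
      funext i
      fin_cases i <;> simp only [cremona, bracket, Pi.add_apply, Fin.zero_eta, Fin.mk_one,
        Fin.reduceFinMk, Matrix.cons_val] <;> ring
    have c2 : cremona u v w (u + w) = ![0, bracket u v w ^ 2, 0] := by
      funext i
      fin_cases i <;> simp only [cremona, bracket, Pi.add_apply, Fin.zero_eta, Fin.mk_one,
        Fin.reduceFinMk, Matrix.cons_val] <;> ring
    have c3 : cremona u v w (u + v) = ![0, 0, bracket u v w ^ 2] := by
      funext i
      fin_cases i <;> simp only [cremona, bracket, Pi.add_apply, Fin.zero_eta, Fin.mk_one,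
        Fin.reduceFinMk, Matrix.cons_val] <;> ring
    rw [c1] at e1
    rw [c2] at e2
    rw [c3] at e3
    simp [dotProduct, Fin.sum_univ_three, hb] at e1 e2 e3
    funext i
    fin_cases i
    exacts [e1, e2, e3]
  · rw [ha]; simp [dotProduct, Fin.sum_univ_three, cremona, bracket]; ring
  · rw [ha]; simp [dotProduct, Fin.sum_univ_three, cremona, bracket]; ring
  · rw [ha]; simp [dotProduct, Fin.sum_univ_three, cremona, bracket]; ring

end Field

/-! ### Lines and conics through given points -/

section Points

open MvPolynomial

variable {K : Type*} [Field K] {p : Fin 8 → ℙ K (Fin 3 → K)} {v : Fin 8 → Fin 3 → K}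

/-- The vector `v i` represents the point `p i`. -/
def IsLift (p : Fin 8 → ℙ K (Fin 3 → K)) (v : Fin 8 → Fin 3 → K) : Prop :=
  ∀ i, ∃ h : v i ≠ 0, p i = Projectivization.mk K (v i) h

theorem isLift_rep (p : Fin 8 → ℙ K (Fin 3 → K)) : IsLift p fun i => (p i).rep := fun i =>
  ⟨(p i).rep_nonzero, (p i).mk_rep.symm⟩

theorem IsLift.onLine_iff (h : IsLift p v) (i j k : Fin 8) :
    OnLine p {i, j, k} ↔ bracket (v i) (v j) (v k) = 0 := by
  obtain ⟨hi, hpi⟩ := h i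
  obtain ⟨hj, hpj⟩ := h j
  obtain ⟨hk, hpk⟩ := h k
  rw [bracket_eq_zero_iff, OnLine]
  constructor
  · rintro ⟨l, hl⟩
    induction l using Projectivization.ind with
    | h l hl0 =>
      have h1 := hl i (by simp)
      have h2 := hl j (by simp)
      have h3 := hl k (by simp)
      rw [hpi, Projectivization.orthogonal_mk] at h1
      rw [hpj, Projectivization.orthogonal_mk] at h2
      rw [hpk, Projectivization.orthogonal_mk] at h3
      exact ⟨l, hl0, h1, h2, h3⟩
  · rintro ⟨l, hl0, h1, h2, h3⟩
    refine ⟨Projectivization.mk K l hl0, fun s hs => ?_⟩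
    simp only [Finset.mem_insert, Finset.mem_singleton] at hs
    rcases hs with rfl | rfl | rfl
    · rwa [hpi, Projectivization.orthogonal_mk]
    · rwa [hpj, Projectivization.orthogonal_mk]
    · rwa [hpk, Projectivization.orthogonal_mk]

theorem IsLift.exists_bracket_ne_zero (h : IsLift p v) (hp : Function.Injective p) {i j : Fin 8}
    (hij : i ≠ j) : ∃ e, bracket (v i) (v j) e ≠ 0 := by
  obtain ⟨hi, hpi⟩ := h i
  obtain ⟨hj, hpj⟩ := h j
  refine Quatroid.exists_bracket_ne_zero hj fun t ht => hij (hp ?_)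
  rw [hpi, hpj, Projectivization.mk_eq_mk_iff']
  exact ⟨t, ht⟩

/-- The chosen representative differs from `v i` by a unit, and the form is multiplied by its
square. -/
theorem IsLift.eval_rep_eq_zero_iff (h : IsLift p v) (a : Fin 3 → Fin 3 → K) (i : Fin 8) :
    eval (p i).rep (quadPoly a) = 0 ↔ quadVal a (v i) = 0 := by
  obtain ⟨hi, hpi⟩ := h i
  obtain ⟨t, ht⟩ := Projectivization.exists_smul_eq_mk_rep K (v i) hi
  rw [hpi, ← ht, eval_quadPoly, Units.smul_def, quadVal_smul]
  simp

theorem IsLift.onConic_iff_exists (h : IsLift p v) (J : Finset (Fin 8)) :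
    OnConic p J ↔ ∃ a, Irreducible (quadPoly a) ∧ ∀ i ∈ J, quadVal a (v i) = 0 := by
  constructor
  · rintro ⟨F, hF, hirr, hJ⟩
    obtain ⟨a, rfl⟩ := exists_eq_quadPoly hF
    exact ⟨a, hirr, fun i hi => (h.eval_rep_eq_zero_iff a i).1 (hJ i hi)⟩
  · rintro ⟨a, hirr, hJ⟩
    exact ⟨_, isHomogeneous_quadPoly a, hirr, fun i hi => (h.eval_rep_eq_zero_iff a i).2 (hJ i hi)⟩

theorem not_onLine_of_onConic (hp : Function.Injective p) {J : Finset (Fin 8)} (hJ : OnConic p J)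
    {I : Finset (Fin 8)} (hIJ : I ⊆ J) (hI : I.card = 3) : ¬ OnLine p I := by
  have h := isLift_rep p
  obtain ⟨a, hirr, ha⟩ := (h.onConic_iff_exists J).1 hJ
  obtain ⟨i, j, k, hij, hik, hjk, rfl⟩ := Finset.card_eq_three.1 hI
  rw [h.onLine_iff]
  exact bracket_ne_zero_of_irreducible hirr (h.exists_bracket_ne_zero hp hij)
    (h.exists_bracket_ne_zero hp hik) (h.exists_bracket_ne_zero hp hjk)
    (ha i (hIJ (by simp))) (ha j (hIJ (by simp))) (ha k (hIJ (by simp)))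

theorem IsLift.conicBracket_eq_zero_of_onConic (h : IsLift p v) (hp : Function.Injective p)
    {J : Finset (Fin 8)} (hJ : OnConic p J) {e : Fin 6 → Fin 8} (he : Function.Injective e)
    (heJ : ∀ n, e n ∈ J) :
    conicBracket (v (e 0)) (v (e 1)) (v (e 2)) (v (e 3)) (v (e 4)) (v (e 5)) = 0 := by
  obtain ⟨a, hirr, ha⟩ := (h.onConic_iff_exists J).1 hJ
  refine conicBracket_eq_zero hirr.ne_zero ?_ (ha _ (heJ 0)) (ha _ (heJ 1)) (ha _ (heJ 2))
    (ha _ (heJ 3)) (ha _ (heJ 4)) (ha _ (heJ 5))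
  rw [Ne, ← h.onLine_iff]
  refine not_onLine_of_onConic hp hJ ?_ ?_
  · intro x hx
    simp only [Finset.mem_insert, Finset.mem_singleton] at hx
    rcases hx with rfl | rfl | rfl <;> exact heJ _
  · exact Finset.card_eq_three.2 ⟨_, _, _, he.ne (by decide), he.ne (by decide),
      he.ne (by decide), rfl⟩

/-- The vanishing yields some conic through the six points; since no three of them are collinear, it
cannot split into lines, so irreducibility costs nothing. -/
theorem IsLift.onConic_of_conicBracket_eq_zero (h : IsLift p v) {J : Finset (Fin 8)}
    (hline : ∀ I ⊆ J, I.card = 3 → ¬ OnLine p I) {e : Fin 6 → Fin 8} (he : Function.Injective e)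
    (heJ : ∀ i, i ∈ J ↔ ∃ n, e n = i)
    (h0 : conicBracket (v (e 0)) (v (e 1)) (v (e 2)) (v (e 3)) (v (e 4)) (v (e 5)) = 0) :
    OnConic p J := by
  have hb : ∀ i j k, i ≠ j → i ≠ k → j ≠ k → bracket (v (e i)) (v (e j)) (v (e k)) ≠ 0 := by
    intro i j k hij hik hjk
    rw [Ne, ← h.onLine_iff]
    refine hline _ ?_ (Finset.card_eq_three.2
      ⟨_, _, _, he.ne hij, he.ne hik, he.ne hjk, rfl⟩)
    intro x hx
    simp only [Finset.mem_insert, Finset.mem_singleton] at hx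
    rw [heJ]
    rcases hx with rfl | rfl | rfl <;> exact ⟨_, rfl⟩
  obtain ⟨a, ha, h0, h1, h2, h3, h4, h5⟩ := exists_conic_of_conicBracket_eq_zero
    (hb 0 1 2 (by decide) (by decide) (by decide)) h0
  have hz : ∀ n, quadVal a (v (e n)) = 0 := by
    intro n
    fin_cases n
    exacts [h0, h1, h2, h3, h4, h5]
  refine (h.onConic_iff_exists J).2 ⟨a, irreducible_of_six_zeros (isHomogeneous_quadPoly a) ha
    (v := fun n => v (e n)) (fun n => by rw [eval_quadPoly, hz]) hb, fun i hi => ?_⟩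
  obtain ⟨n, rfl⟩ := (heJ i).1 hi
  exact hz n

end Points

/-! ### Configurations with coordinates in a ring with decidable equality -/

section Config

variable {R : Type*}

section Defs

variable [Mul R] [Sub R] [Add R] [Zero R] [DecidableEq R]

/-- The determinant of three vectors. -/
def det3 (x y z : R × R × R) : R :=
  x.1 * (y.2.1 * z.2.2 - y.2.2 * z.2.1) - x.2.1 * (y.1 * z.2.2 - y.2.2 * z.1) +
    x.2.2 * (y.1 * z.2.1 - y.2.1 * z.1)

/-- The quadratic transformation with fundamental points `x`, `y`, `z`. -/
def cremona3 (x y z t : R × R × R) : R × R × R :=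
  (det3 x t z * det3 x y t, det3 t y z * det3 x y t, det3 t y z * det3 x t z)

/-- The vectors are proportional. -/
def proportional (x y : R × R × R) : Bool :=
  decide (x.1 * y.2.1 = x.2.1 * y.1) && decide (x.1 * y.2.2 = x.2.2 * y.1) &&
    decide (x.2.1 * y.2.2 = x.2.2 * y.2.1)

/-- The number `i` vector of the list. -/
def point (P : List (R × R × R)) (i : ℕ) : R × R × R := P.getD i (0, 0, 0)

/-- The three points of `P` numbered by `l` are collinear. -/
def lineCheck (P : List (R × R × R)) : List ℕ → Bool
  | [i, j, k] => decide (det3 (point P i) (point P j) (point P k) = 0)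
  | _ => false

/-- The six points of `P` numbered by `l` lie on a conic, provided that no three are collinear. -/
def conicCheck (P : List (R × R × R)) : List ℕ → Bool
  | [i, j, k, a, b, c] => decide
      (det3 (cremona3 (point P i) (point P j) (point P k) (point P a))
        (cremona3 (point P i) (point P j) (point P k) (point P b))
        (cremona3 (point P i) (point P j) (point P k) (point P c)) = 0)
  | _ => false

/-- The points in the list `P` represent the pair with mask `m`. -/
def checkConfig (P : List (R × R × R)) (m : ℕ) : Bool :=
  ((List.range 8).all fun j => (List.range j).all fun i => !proportional (point P i) (point P j)) &&
  strict (pack m) fun n =>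
    ((triples 8).all fun l => lineCheck P l == look n (code l)) &&
    sextuples.all fun l =>
      (!(triples 8).any (blocks n (code l)) && conicCheck P l) == look n (code l)

end Defs

variable [CommRing R] {K : Type*} [Field K] (f : R →+* K)

/-- The image of a vector over `R` in `K`. -/
def vec (x : R × R × R) : Fin 3 → K := ![f x.1, f x.2.1, f x.2.2]

theorem bracket_vec (x y z : R × R × R) :
    bracket (vec f x) (vec f y) (vec f z) = f (det3 x y z) := by
  simp [bracket, vec, det3]

theorem vec_cremona3 (x y z t : R × R × R) :
    vec f (cremona3 x y z t) = cremona (vec f x) (vec f y) (vec f z) (vec f t) := by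
  simp only [cremona, bracket_vec]
  simp [vec, cremona3]

theorem exists_vector_of_mem_sextuples : ∀ l ∈ sextuples, ∃ i j k a b c, l = [i, j, k, a, b, c] ∧
    l.Nodup ∧ ∀ x ∈ l, x < 8 := by
  have h : ∀ l ∈ sextuples, l.length = 6 ∧ l.Nodup ∧ ∀ x ∈ l, x < 8 := by decide
  intro l hl
  obtain ⟨h6, h⟩ := h l hl
  match l, h6 with
  | [i, j, k, a, b, c], _ => exact ⟨i, j, k, a, b, c, rfl, h⟩

variable {f}

/-- A nontrivial relation `r • x = s • y` would make all 2 × 2 minors vanish. The coefficients `1,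
0` give the first claim and `t, 1` the second. -/
theorem vec_ne_zero_of_not_proportional (hf : Function.Injective f) [DecidableEq R]
    {x y : R × R × R} (h : proportional x y = false) : vec f x ≠ 0 ∧ ∀ t : K, t • vec f x ≠ vec f y := by
  have key : ∀ r s : K, ¬ r • vec f x = s • vec f y ∨ (r = 0 ∧ s = 0) := by
    intro r s
    by_contra! hc
    obtain ⟨hc, hrs⟩ := hc
    have h0 := congrFun hc 0
    have h1 := congrFun hc 1
    have h2 := congrFun hc 2
    simp only [vec, Pi.smul_apply, Matrix.cons_val, smul_eq_mul] at h0 h1 h2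
    have hr : r ≠ 0 ∨ s ≠ 0 := by
      by_cases hr : r = 0
      · exact Or.inr (hrs hr)
      · exact Or.inl hr
    have hz : f (x.1 * y.2.1 - x.2.1 * y.1) = 0 ∧ f (x.1 * y.2.2 - x.2.2 * y.1) = 0 ∧
        f (x.2.1 * y.2.2 - x.2.2 * y.2.1) = 0 := by
      simp only [map_sub, map_mul]
      rcases hr with hr | hr
      · refine ⟨?_, ?_, ?_⟩ <;> apply mul_left_cancel₀ hr
        · linear_combination f y.2.1 * h0 - f y.1 * h1
        · linear_combination f y.2.2 * h0 - f y.1 * h2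
        · linear_combination f y.2.2 * h1 - f y.2.1 * h2
      · refine ⟨?_, ?_, ?_⟩ <;> apply mul_left_cancel₀ hr
        · linear_combination f x.2.1 * h0 - f x.1 * h1
        · linear_combination f x.2.2 * h0 - f x.1 * h2
        · linear_combination f x.2.2 * h1 - f x.2.1 * h2
    simp only [map_eq_zero_iff f hf, sub_eq_zero] at hz
    simp [proportional, hz] at h
  constructor
  · intro h0
    rcases key 1 0 with h | h
    · simp [h0] at h
    · exact one_ne_zero h.1
  · intro t ht
    rcases key t 1 with h | h
    · simp [ht] at h
    · exact one_ne_zero h.2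

/-- The vectors of a configuration that passes the check define a representation. -/
theorem representable_of_checkConfig [DecidableEq R] (hf : Function.Injective f)
    {P : List (R × R × R)} {m : ℕ} (h : checkConfig P m = true) {Q : QPair}
    (hQ : Agrees m (triples 8 ++ sextuples) Q.family) : Representable K Q := by
  rw [checkConfig, strict_eq, Bool.and_eq_true, Bool.and_eq_true, List.all_eq_true,
    List.all_eq_true, List.all_eq_true] at h
  obtain ⟨hprop, hline, hconic⟩ := h
  let v : Fin 8 → Fin 3 → K := fun i => vec f (point P i)
  have hind : ∀ i j : Fin 8, i < j → vec f (point P i) ≠ 0 ∧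
      ∀ t : K, t • vec f (point P i) ≠ vec f (point P j) := by
    intro i j hij
    have := List.all_eq_true.1 (hprop j (List.mem_range.2 j.2)) i (List.mem_range.2 hij)
    exact vec_ne_zero_of_not_proportional hf (by simpa using this)
  have hv : ∀ i, v i ≠ 0 := by
    intro i
    by_cases hi : i < 7
    · exact (hind i 7 hi).1
    -- Label 7 is never the smaller one of a pair in `hind`; its vector is nonzero because it is not
    -- `0` times the vector of label 0.
    · intro h0
      exact (hind 0 i (by omega)).2 0 (by rw [zero_smul]; exact h0.symm)
  let p : Fin 8 → ℙ K (Fin 3 → K) := fun i => Projectivization.mk K (v i) (hv i)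
  have hp : IsLift p v := fun i => ⟨hv i, rfl⟩
  have hne : ∀ i j : Fin 8, i < j → p i ≠ p j := by
    intro i j hij h
    obtain ⟨t, ht⟩ := (Projectivization.mk_eq_mk_iff' K _ _ (hv j) (hv i)).1 h.symm
    exact (hind i j hij).2 t ht
  have hinj : Function.Injective p := by
    intro i j hij
    rcases lt_trichotomy i j with h | h | h
    exacts [absurd hij (hne i j h), h, absurd hij.symm (hne j i h)]
  have hlook : ∀ l ∈ triples 8 ++ sextuples,
      (look (pack m) (code l) = true ↔ members (code l) ∈ Q.family) := fun l hl => by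
    rw [hQ l hl, look_eq_testBit, pack_shiftRight]
  have htriple : ∀ I : Finset (Fin 8), I.card = 3 → (OnLine p I ↔ I ∈ Q.triples) := by
    intro I hI
    obtain ⟨i, j, k, hij, hjk, hI', hmem⟩ := exists_triple_of_card hI
    have hl : [(i : ℕ), j, k] ∈ triples 8 := mem_triples hij hjk k.2
    have h1 := hline _ hl
    rw [beq_iff_eq, Bool.eq_iff_iff, hlook _ (List.mem_append_left _ hl), hmem,
      QPair.mem_family_of_card_three hI, lineCheck, decide_eq_true_eq,
      ← map_eq_zero_iff f hf, ← bracket_vec] at h1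
    rw [← h1, hI', hp.onLine_iff]
  refine ⟨p, hinj, htriple, fun J hJ => ?_⟩
  obtain ⟨l, hl, rfl⟩ := exists_mem_sextuples J hJ
  have h1 := hconic _ hl
  rw [beq_iff_eq, Bool.eq_iff_iff, hlook _ (List.mem_append_right _ hl),
    QPair.mem_family_of_card_six hJ] at h1
  rw [← h1, Bool.and_eq_true, Bool.not_eq_true', List.any_eq_false]
  obtain ⟨i, j, k, a, b, c, rfl, hnd, h8⟩ := exists_vector_of_mem_sextuples l hl
  have hlt : i < 8 ∧ j < 8 ∧ k < 8 ∧ a < 8 ∧ b < 8 ∧ c < 8 := by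
    simpa only [List.mem_cons, List.not_mem_nil, or_false, forall_eq_or_imp, forall_eq] using h8
  obtain ⟨hi, hj, hk, ha, hb, hc⟩ := hlt
  let e : Fin 6 → Fin 8 := ![⟨i, hi⟩, ⟨j, hj⟩, ⟨k, hk⟩, ⟨a, ha⟩, ⟨b, hb⟩, ⟨c, hc⟩]
  have hle : [i, j, k, a, b, c] = List.ofFn fun n => (e n : ℕ) := by simp [e, List.ofFn_succ]
  have heJ : ∀ x, x ∈ members (code [i, j, k, a, b, c]) ↔ ∃ n, e n = x := by
    intro x
    rw [mem_members_code, hle, List.mem_ofFn]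
    simp only [Fin.val_inj]
  have he : Function.Injective e := by
    rw [hle, List.nodup_ofFn] at hnd
    exact fun x y hxy => hnd (by simp only [hxy])
  have hcb : conicCheck P [i, j, k, a, b, c] = true ↔
      conicBracket (v (e 0)) (v (e 1)) (v (e 2)) (v (e 3)) (v (e 4)) (v (e 5)) = 0 := by
    rw [conicCheck, decide_eq_true_eq, ← map_eq_zero_iff f hf, ← bracket_vec, vec_cremona3,
      vec_cremona3, vec_cremona3]
    rfl
  -- A blocking triple of the mask is a collinear triple inside the sextuple, because `htriple` has
  -- already identified the collinear triples with those of `Q`.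
  have hblocks : (∀ t ∈ triples 8, ¬ blocks (pack m) (code [i, j, k, a, b, c]) t = true) ↔
      ∀ I ⊆ members (code [i, j, k, a, b, c]), I.card = 3 → ¬ OnLine p I := by
    constructor
    · intro hb I hIJ hI hon
      obtain ⟨i', j', k', hij, hjk, -, rfl⟩ := exists_triple_of_card hI
      have ht : [(i' : ℕ), j', k'] ∈ triples 8 := mem_triples hij hjk k'.2
      refine hb _ ht ?_
      rw [htriple _ hI, ← QPair.mem_family_of_card_three hI,
        ← hlook _ (List.mem_append_left _ ht)] at hon
      rw [blocks, hon, Bool.true_and, Nat.beq_eq]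
      refine Nat.eq_of_testBit_eq fun x => ?_
      have hland : ∀ x y : ℕ, Nat.land x y = x &&& y := fun _ _ => rfl
      rw [hland, Nat.testBit_and, Bool.eq_iff_iff, Bool.and_eq_true, and_iff_left_iff_imp,
        testBit_code, testBit_code]
      intro hx
      have hx8 : x < 8 := by
        simp only [List.mem_cons, List.not_mem_nil, or_false] at hx
        omega
      have := hIJ ((mem_members_code _ ⟨x, hx8⟩).2 hx)
      exact (mem_members_code _ ⟨x, hx8⟩).1 this
    · intro hI t ht hbt
      rw [blocks, Bool.and_eq_true, Nat.beq_eq] at hbt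
      have h3 := card_members_of_mem_triples ht
      refine hI _ (members_subset_members hbt.2) h3 ?_
      rw [htriple _ h3, ← QPair.mem_family_of_card_three h3,
        ← hlook _ (List.mem_append_left _ ht)]
      exact hbt.1
  rw [hcb, hblocks]
  constructor
  · intro hon
    exact ⟨fun I hI h3 => not_onLine_of_onConic hinj hon hI h3,
      hp.conicBracket_eq_zero_of_onConic hinj hon he fun n => (heJ _).2 ⟨n, rfl⟩⟩
  · rintro ⟨h1, h2⟩
    exact hp.onConic_of_conicBracket_eq_zero h1 he heJ h2

end Config

/-! ### Integral representations -/

/-- The eight integral vectors encoded by the hexadecimal digits of `n`, each increased by `4`. -/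
def decodeConfig (n : ℕ) : List (ℤ × ℤ × ℤ) :=
  (List.range 8).map fun i =>
    (Int.subNatNat ((n >>> (12 * i)) % 16) 4, Int.subNatNat ((n >>> (12 * i + 4)) % 16) 4,
      Int.subNatNat ((n >>> (12 * i + 8)) % 16) 4)

/-- Representations of the targets other than the first two. -/
def configurations : List ℕ := [
  23313706048620852376181756997, 26079728323899123927909487685, 21437000345824658545249109077,
  21436999165444426703863895364, 26408102080282688159905826132, 26079274257356797698095863125,
  11862307263167392576386192469, 21146928117540576463312737109, 26406818223788629620999668820,
  30740963680472828215435879748, 26078141533730925332297700149, 26387550968538553431689086277,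
  26737001088050325195807085908, 21148061485500968782386251109, 16195168531234776548179793237,
  26099897476189528197195715669, 26387626839929358111703586117, 30760235970458807925297468740,
  21147915367742283783869842261, 21145719467471881010587981141, 20837443366189504553865725269,
  16814068011757629029427266884, 21439346126097526732347495765, 25809760278468613896449254437,
  11554026456641535752471204661, 21437000013769420168345507140, 21149204871331139971355858278,
  21435795810392868371203113813, 21435644676290463912349094437, 16505867170795471808171828038,
  21149124293706013588235502933, 10953265865007383752331387750, 21144288590504362568404260181,
  21439498496203575573817345365, 21439488424434432547501655381, 26078221796604278808992109877,
  21145578351046130671564440420, 21144591414425248655415199061, 21436999405171262407287522901,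
  31341724272255615503977305157, 30432692006319327926594913364, 7239445747029364250118472021,
  21436999203139554416723771989, 21436999128537426597349057894, 16504507148852331402829780292,
  21145795616793062313765979445, 26405760430841966438964811076, 21434506660907972603833304133,
  21144591118124454819349746516, 16814066870360516130196768551, 21149351281985931495163187796,
  10624366928661784678653912405, 25808476110838624180182008661, 21150409109371914734207849813,
  25828880863814235567716320325, 11572165343003665315380155476, 31051657616113805444820391269,
  11573449532925979498358588500, 21149355689677130986492805989, 21475756198802457811110610261,
  11571041125938369642595968084, 16814068011762150302844994644, 25498990784896391886565360997,
  25808474929085356246738158676, 21145800007127706599782958404, 21435862256862091413600691269,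
  26716534646861438157555127365, 30759182587652758117772579909, 16504582686959064819310085686,
  21148141396998919583866046036, 21150409018346006789258298740, 11572235627341130122982151237,
  10933923051901993922220876646, 21144288313595787256896243029, 21439347306689125382790333781,
  21148146763929625632694420821, 10934914766085443010374624054, 26078221189149697730503066981,
  21149124609395115815112889910, 25496652936934847854378571093, 25498991102170202961085691221,
  21147920366751907557041067285, 7218605961092829819079771477, 11570810023908117883746669909,
  15614884750098214126852855125, 6637254039682041205588514132, 15614883217860132604007961397,
  30742097065713810484880495956, 31051733467819391620363928917, 26716454662711697361385833029,
  16525128800945820621935433045, 30432612371729327905177948981, 15574989290548303380769686869,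
  11862377508292227840932595029, 16815271034546799984120255525, 10936194804184508922557912405,
  11863511190995724769561896277, 10933851865916579481907447125, 25812182558632220855363781973,
  25208919130060434311631762773, 25515995732826546409899902293, 15576198198929753736190641493,
  35382110182198815675038123349, 21434511049787689309243336021, 16816409696862917022669235541,
  30739764199390998423794959701, 21150262938592386442905867348, 31397571016251899069741749572,
  30428919478901472078336382294, 16523925519897392662467396150, 26079345076501469455605658965,
  16814138238584917513735590519, 21434514852343487884650890598, 17121285694141881771579688533,
  21436999997926021790122202436, 26082826121511596909663777366, 11862378653143264392065144132,
  17434321057625387102277752169, 26404400042472710415539586117, 16525366139196304346805781573,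
  26405917101493566920118862917, 26409306928349772084594303605, 26409306928349825810101003558,
  26411658943199681582897124421]

/-- Elementwise check of the configurations against the masks. -/
def checkConfigs : List ℕ → List ℕ → Bool
  | n :: ns, m :: ms => checkConfig (decodeConfig n) m && checkConfigs ns ms
  | _, [] => true
  | [], _ :: _ => false

theorem exists_checkConfig {ns ms : List ℕ} (h : checkConfigs ns ms = true) {m : ℕ}
    (hm : m ∈ ms) : ∃ P : List (ℤ × ℤ × ℤ), checkConfig P m = true := by
  induction ms generalizing ns with
  | nil => simp at hm
  | cons m' ms ih =>
    cases ns with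
    | nil => simp [checkConfigs] at h
    | cons n ns =>
      rw [checkConfigs, Bool.and_eq_true] at h
      rcases List.mem_cons.1 hm with rfl | hm
      · exact ⟨_, h.1⟩
      · exact ih h.2 hm

/-- The check is exact: it also excludes lines and conics that are not prescribed. -/
theorem checkConfigs_targets : checkConfigs configurations (targets.drop 2) = true := by
  decide +kernel

/-- The integers embed in every field of characteristic zero, so one integral configuration
represents the pair over all of them. -/
theorem representable_of_mem_targets (K : Type*) [Field K] [CharZero K] {m : ℕ}
    (hm : m ∈ targets.drop 2) {Q : QPair} (hQ : Agrees m (triples 8 ++ sextuples) Q.family) :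
    Representable K Q := by
  obtain ⟨P, hP⟩ := exists_checkConfig checkConfigs_targets hm
  exact representable_of_checkConfig (f := Int.castRingHom K) Int.cast_injective hP hQ

/-! ### Relabelling -/

section Relabelling

variable {K : Type*} [Field K]

theorem forall_mem_inv_smul (σ : Equiv.Perm (Fin 8)) (S : Finset (Fin 8)) (P : Fin 8 → Prop) :
    (∀ i ∈ σ⁻¹ • S, P i) ↔ ∀ i ∈ S, P (σ⁻¹ i) := by
  constructor
  · exact fun h i hi => h _ (Finset.smul_mem_smul_finset hi)
  · intro h i hi
    obtain ⟨j, hj, rfl⟩ := Finset.mem_smul_finset.1 hi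
    exact h j hj

theorem Represents.smul {p : Fin 8 → ℙ K (Fin 3 → K)} {Q : QPair} (h : Represents p Q)
    (σ : Equiv.Perm (Fin 8)) : Represents (fun i => p (σ⁻¹ i)) (σ • Q) := by
  obtain ⟨hp, hI, hJ⟩ := h
  refine ⟨hp.comp σ⁻¹.injective, fun I hc => ?_, fun J hc => ?_⟩
  · rw [QPair.smul_triples, ← Finset.inv_smul_mem_iff, ← hI _ (by rwa [Finset.card_smul_finset])]
    simp only [OnLine, forall_mem_inv_smul σ I fun i => Projectivization.orthogonal _ (p i)]
  · rw [QPair.smul_sextuples, ← Finset.inv_smul_mem_iff,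
      ← hJ _ (by rwa [Finset.card_smul_finset])]
    simp only [OnConic, forall_mem_inv_smul σ J fun i => MvPolynomial.eval (p i).rep _ = 0]

theorem Representable.smul {Q : QPair} (h : Representable K Q) (σ : Equiv.Perm (Fin 8)) :
    Representable K (σ • Q) :=
  h.imp' _ fun _ hp => hp.smul σ

theorem representable_smul_iff {Q : QPair} (σ : Equiv.Perm (Fin 8)) :
    Representable K (σ • Q) ↔ Representable K Q :=
  ⟨fun h => by simpa using h.smul σ⁻¹, fun h => h.smul σ⟩

theorem IsMatroidal.smul {Q : QPair} (h : IsMatroidal Q) (σ : Equiv.Perm (Fin 8)) :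
    IsMatroidal (σ • Q) := by
  obtain ⟨Q', hQ', hrep⟩ := h
  exact ⟨σ • Q', by rw [QPair.smul_triples, hQ', QPair.smul_triples], hrep.smul σ⟩

theorem WeakBezout.smul {Q : QPair} (h : WeakBezout Q) (σ : Equiv.Perm (Fin 8)) :
    WeakBezout (σ • Q) where
  line_conic I hI J hJ := by
    obtain ⟨I, hI', rfl⟩ := Finset.mem_smul_finset.1 hI
    obtain ⟨J, hJ', rfl⟩ := Finset.mem_smul_finset.1 hJ
    rw [← Finset.smul_finset_inter, Finset.card_smul_finset]
    exact h.line_conic I hI' J hJ'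
  line_line I₁ h₁ I₂ h₂ hc I hI h3 := by
    obtain ⟨I₁, h₁', rfl⟩ := Finset.mem_smul_finset.1 h₁
    obtain ⟨I₂, h₂', rfl⟩ := Finset.mem_smul_finset.1 h₂
    rw [← Finset.smul_finset_inter, Finset.card_smul_finset] at hc
    rw [← Finset.smul_finset_union, Finset.subset_smul_finset_iff] at hI
    rw [QPair.smul_triples, ← Finset.inv_smul_mem_iff]
    exact h.line_line _ h₁' _ h₂' hc _ hI (by rwa [Finset.card_smul_finset])
  conic_conic J₁ h₁ J₂ h₂ hc J hJ h6 := by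
    obtain ⟨J₁, h₁', rfl⟩ := Finset.mem_smul_finset.1 h₁
    obtain ⟨J₂, h₂', rfl⟩ := Finset.mem_smul_finset.1 h₂
    rw [← Finset.smul_finset_inter, Finset.card_smul_finset] at hc
    rw [← Finset.smul_finset_union, Finset.subset_smul_finset_iff] at hJ
    rw [QPair.smul_sextuples, ← Finset.inv_smul_mem_iff]
    exact h.conic_conic _ h₁' _ h₂' hc _ hJ (by rwa [Finset.card_smul_finset])

theorem IsCandidate.smul {Q : QPair} (h : IsCandidate Q) (σ : Equiv.Perm (Fin 8)) :
    IsCandidate (σ • Q) :=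
  ⟨h.1.smul σ, h.2.smul σ⟩

end Relabelling

/-! ### The exceptional pairs are candidates -/

/-- Distinct lines with at most one common point and distinct conics with at most four common
points satisfy the criteria. -/
theorem WeakBezout.of_distinct {Q : QPair}
    (hIJ : ∀ I ∈ Q.triples, ∀ J ∈ Q.sextuples, (I ∩ J).card ≤ 2)
    (hI : ∀ I₁ ∈ Q.triples, ∀ I₂ ∈ Q.triples, I₁ ≠ I₂ → (I₁ ∩ I₂).card ≤ 1)
    (hJ : ∀ J₁ ∈ Q.sextuples, ∀ J₂ ∈ Q.sextuples, J₁ ≠ J₂ → (J₁ ∩ J₂).card ≤ 4) :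
    WeakBezout Q where
  line_conic := hIJ
  line_line I₁ h₁ I₂ h₂ hc I hI' h3 := by
    obtain rfl : I₁ = I₂ := by
      by_contra hne
      have := hI I₁ h₁ I₂ h₂ hne
      omega
    rw [Finset.union_self] at hI'
    rwa [Finset.eq_of_subset_of_card_le hI' (by rw [Q.card_triple _ h₁, h3])]
  conic_conic J₁ h₁ J₂ h₂ hc J hJ' h6 := by
    obtain rfl : J₁ = J₂ := by
      by_contra hne
      have := hJ J₁ h₁ J₂ h₂ hne
      omega
    rw [Finset.union_self] at hJ'
    rwa [Finset.eq_of_subset_of_card_le hJ' (by rw [Q.card_sextuple _ h₁, h6])]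

theorem weakBezout_Q41 : WeakBezout Q41 :=
  WeakBezout.of_distinct (by decide +kernel) (by decide +kernel) (by decide +kernel)

theorem weakBezout_Q63 : WeakBezout Q63 :=
  WeakBezout.of_distinct (by decide +kernel) (by decide +kernel) (by decide +kernel)

/-! ### Masks and complex configurations for the exceptional pairs -/

instance (m : ℕ) (V : List (List ℕ)) (F : Finset (Finset (Fin 8))) : Decidable (Agrees m V F) :=
  inferInstanceAs (Decidable (∀ l ∈ V, members (code l) ∈ F ↔ m.testBit (code l) = true))

/-- The mask of a list of labelled subsets. -/
def maskOf (V : List (List ℕ)) : ℕ := V.foldl (fun m l => m ||| 1 <<< code l) 0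

/-- The mask of the MacLane matroid. -/
def macLaneMask : ℕ :=
  maskOf [[0, 1, 2], [0, 3, 4], [0, 5, 6], [1, 3, 5], [1, 4, 7], [2, 4, 6], [2, 5, 7], [3, 6, 7]]

/-- The mask of the Fano candidate. -/
def fanoCandidateMask : ℕ :=
  maskOf [[0, 1, 2], [0, 3, 4], [1, 3, 5], [2, 4, 5], [0, 1, 4, 5, 6, 7], [0, 2, 3, 5, 6, 7],
    [1, 2, 3, 4, 6, 7]]

theorem agrees_Q41 : Agrees macLaneMask (triples 8 ++ sextuples) Q41.family := by
  decide +kernel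

theorem agrees_Q63 : Agrees fanoCandidateMask (triples 8 ++ sextuples) Q63.family := by
  decide +kernel

theorem targets_eq : targets = macLaneMask :: fanoCandidateMask :: targets.drop 2 := by
  decide +kernel

/-- The ring `ℤ[ω]`, where `ω ^ 2 = ω - 1`. -/
abbrev Eisenstein : Type := QuadraticAlgebra ℤ (-1) 1

/-- A complex square root of -3 gives a root of t² - t + 1, hence a homomorphism. It is injective
since an element of the kernel has norm x² + xy + y² = 0, and this form is positive definite. -/
theorem exists_injective_ringHom_eisenstein : ∃ f : Eisenstein →+* ℂ, Function.Injective f := by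
  obtain ⟨t, ht⟩ : ∃ t : ℂ, t * t = (-1 : ℤ) • 1 + (1 : ℤ) • t := by
    obtain ⟨s, hs⟩ := IsAlgClosed.exists_pow_nat_eq (-3 : ℂ) (n := 2) (by norm_num)
    refine ⟨(1 + s) / 2, ?_⟩
    simp only [neg_smul, one_smul]
    linear_combination hs / 4
  let g : Eisenstein →ₐ[ℤ] ℂ := QuadraticAlgebra.lift ⟨t, ht⟩
  refine ⟨g.toRingHom, (injective_iff_map_eq_zero _).2 fun z hz => ?_⟩
  have h1 : ((z.norm : ℤ) : ℂ) = 0 := by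
    have := congrArg g (QuadraticAlgebra.algebraMap_norm_eq_mul_star z)
    rw [map_mul, show g z = 0 from hz, zero_mul, AlgHom.commutes] at this
    simpa using this
  have h2 : z.norm = 0 := by exact_mod_cast h1
  rw [QuadraticAlgebra.norm_def] at h2
  have h3 : z.re = 0 ∧ z.im = 0 := by
    constructor <;> nlinarith [sq_nonneg (z.re + z.im), sq_nonneg z.re, sq_nonneg z.im]
  exact QuadraticAlgebra.ext h3.1 h3.2

/-- The labels 0, 1, 3, 6 form the standard frame used in `not_representable_Q41`; there the lines
force the ratio of the outer coordinates of point 4 to satisfy t² - t + 1 = 0, and ω is such a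
ratio. -/
theorem checkConfig_macLane :
    checkConfig (R := Eisenstein) [(1, 0, 0), (0, 1, 0), (1, ⟨1, -1⟩, 0), (0, 0, 1),
      (1, 0, ⟨0, 1⟩), (0, 1, 1), (1, 1, 1), (1, 1, ⟨0, 1⟩)] macLaneMask = true := by
  decide +kernel

theorem representable_Q41 : Representable ℂ Q41 := by
  obtain ⟨f, hf⟩ := exists_injective_ringHom_eisenstein
  exact representable_of_checkConfig hf checkConfig_macLane agrees_Q41

theorem isCandidate_Q41 : IsCandidate Q41 := ⟨⟨Q41, rfl, representable_Q41⟩, weakBezout_Q41⟩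

/-- The Fano candidate without its conics. -/
def quadrilateral : QPair := { Q63 with sextuples := ∅, card_sextuple := by simp }

/-- This makes the Fano candidate matroidal: its four lines alone can be realized, even with
integral coordinates. -/
theorem representable_quadrilateral : Representable ℂ quadrilateral := by
  have hm : Agrees (maskOf [[0, 1, 2], [0, 3, 4], [1, 3, 5], [2, 4, 5]]) (triples 8 ++ sextuples)
      quadrilateral.family := by
    decide +kernel
  have hc : checkConfig (R := ℤ) [(1, 1, 0), (1, 0, 0), (0, 1, 0), (0, 0, 1), (1, 1, 1), (1, 0, 1),
      (-3, 4, -4), (-1, -4, 2)] (maskOf [[0, 1, 2], [0, 3, 4], [1, 3, 5], [2, 4, 5]]) = true := by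
    decide +kernel
  exact representable_of_checkConfig (f := Int.castRingHom ℂ) Int.cast_injective hc hm

theorem isCandidate_Q63 : IsCandidate Q63 :=
  ⟨⟨quadrilateral, rfl, representable_quadrilateral⟩, weakBezout_Q63⟩

/-! ### Projective frames -/

section Frame

variable {K : Type*} [Field K] {p : Fin 8 → ℙ K (Fin 3 → K)} {v w : Fin 8 → Fin 3 → K}

theorem bracket_smul_left (s : K) (x y z : Fin 3 → K) :
    bracket (s • x) y z = s * bracket x y z := by
  simp only [bracket, Pi.smul_apply, smul_eq_mul]
  ring

theorem bracket_smul_middle (s : K) (x y z : Fin 3 → K) :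
    bracket x (s • y) z = s * bracket x y z := by
  simp only [bracket, Pi.smul_apply, smul_eq_mul]
  ring

theorem bracket_smul_right (s : K) (x y z : Fin 3 → K) :
    bracket x y (s • z) = s * bracket x y z := by
  simp only [bracket, Pi.smul_apply, smul_eq_mul]
  ring

/-- The vectors `w i` are the images under a linear automorphism of vectors representing `p i`. -/
def IsCoord (p : Fin 8 → ℙ K (Fin 3 → K)) (w : Fin 8 → Fin 3 → K) : Prop :=
  ∃ v, IsLift p v ∧ ∃ r : K, r ≠ 0 ∧ ∃ φ : (Fin 3 → K) → Fin 3 → K,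
    (∀ x y z, bracket (φ x) (φ y) (φ z) = r * bracket x y z) ∧ ∀ i, w i = φ (v i)

theorem IsLift.smul (h : IsLift p v) {s : Fin 8 → K} (hs : ∀ i, s i ≠ 0) :
    IsLift p fun i => s i • v i := by
  intro i
  obtain ⟨hi, hpi⟩ := h i
  refine ⟨smul_ne_zero (hs i) hi, ?_⟩
  rw [hpi, Projectivization.mk_eq_mk_iff']
  exact ⟨(s i)⁻¹, inv_smul_smul₀ (hs i) _⟩

theorem IsCoord.onLine_iff (h : IsCoord p w) (i j k : Fin 8) :
    OnLine p {i, j, k} ↔ bracket (w i) (w j) (w k) = 0 := by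
  obtain ⟨v, hv, r, hr, φ, hφ, hw⟩ := h
  rw [hv.onLine_iff, hw, hw, hw, hφ, mul_eq_zero, or_iff_right hr]

/-- The conic condition is built from brackets only, so a map that multiplies brackets by `r`
multiplies it by a power of `r`. -/
theorem IsCoord.conicBracket_eq_zero (h : IsCoord p w) (hp : Function.Injective p)
    {J : Finset (Fin 8)} (hJ : OnConic p J) {e : Fin 6 → Fin 8} (he : Function.Injective e)
    (heJ : ∀ n, e n ∈ J) :
    conicBracket (w (e 0)) (w (e 1)) (w (e 2)) (w (e 3)) (w (e 4)) (w (e 5)) = 0 := by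
  obtain ⟨v, hv, r, hr, φ, hφ, hw⟩ := h
  have h0 := hv.conicBracket_eq_zero_of_onConic hp hJ he heJ
  have hc : ∀ x y z t, cremona (φ x) (φ y) (φ z) (φ t) = r ^ 2 • cremona x y z t := by
    intro x y z t
    funext i
    fin_cases i <;> simp [cremona, hφ] <;> ring
  rw [conicBracket] at h0
  simp only [hw, conicBracket, hc, bracket_smul_left, bracket_smul_middle, bracket_smul_right, h0,
    mul_zero]

/-- `φ` is not assumed to be linear; that it kills no vector of the lift follows from a nonzero
bracket containing that vector. -/
theorem IsCoord.ne_zero (h : IsCoord p w) (i : Fin 8) : w i ≠ 0 := by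
  obtain ⟨v, hv, r, hr, φ, hφ, hw⟩ := h
  obtain ⟨hi, -⟩ := hv i
  obtain ⟨n, hn⟩ : ∃ n, v i n ≠ 0 := by
    by_contra! h
    exact hi (funext h)
  obtain ⟨y, z, hyz⟩ : ∃ y z, bracket (v i) y z ≠ 0 := by
    fin_cases n
    · exact ⟨![0, 1, 0], ![0, 0, 1], by simpa [bracket] using hn⟩
    · exact ⟨![1, 0, 0], ![0, 0, 1], by simpa [bracket] using hn⟩
    · exact ⟨![1, 0, 0], ![0, 1, 0], by simpa [bracket] using hn⟩
  intro h0
  have := hφ (v i) y z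
  rw [← hw, h0] at this
  exact mul_ne_zero hr hyz (by rw [← this]; simp [bracket])

theorem IsCoord.comp (h : IsCoord p w) {r : K} (hr : r ≠ 0) {φ : (Fin 3 → K) → Fin 3 → K}
    (hφ : ∀ x y z, bracket (φ x) (φ y) (φ z) = r * bracket x y z) :
    IsCoord p fun i => φ (w i) := by
  obtain ⟨v, hv, s, hs, ψ, hψ, hw⟩ := h
  refine ⟨v, hv, r * s, mul_ne_zero hr hs, φ ∘ ψ, fun x y z => ?_, fun i => congrArg φ (hw i)⟩
  rw [Function.comp_apply, Function.comp_apply, Function.comp_apply, hφ, hψ, mul_assoc]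

/-- Four points, no three of which are collinear, can be given standard coordinates. -/
theorem exists_isCoord (p : Fin 8 → ℙ K (Fin 3 → K)) {a b c d : Fin 8}
    (habc : ¬ OnLine p {a, b, c}) (hdbc : ¬ OnLine p {d, b, c}) (hadc : ¬ OnLine p {a, d, c})
    (habd : ¬ OnLine p {a, b, d}) :
    ∃ w, IsCoord p w ∧ w a = ![1, 0, 0] ∧ w b = ![0, 1, 0] ∧ w c = ![0, 0, 1] ∧
      w d = ![1, 1, 1] := by
  have hv := isLift_rep p
  set v : Fin 8 → Fin 3 → K := fun i => (p i).rep
  rw [hv.onLine_iff] at habc hdbc hadc habd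
  -- Cramer coordinates with respect to `a`, `b`, `c`, each divided by that of `d`, so that `d` goes
  -- to `(1, 1, 1)`.
  let φ : (Fin 3 → K) → Fin 3 → K := fun x =>
    ![bracket x (v b) (v c) / bracket (v d) (v b) (v c),
      bracket (v a) x (v c) / bracket (v a) (v d) (v c),
      bracket (v a) (v b) x / bracket (v a) (v b) (v d)]
  have haa : ∀ x y : Fin 3 → K, bracket x x y = 0 := fun x y => by simp only [bracket]; ring
  have hbb : ∀ x y : Fin 3 → K, bracket x y y = 0 := fun x y => by simp only [bracket]; ring
  have hcc : ∀ x y : Fin 3 → K, bracket x y x = 0 := fun x y => by simp only [bracket]; ring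
  have hab : a ≠ b := by rintro rfl; exact habc (haa _ _)
  have hac : a ≠ c := by rintro rfl; exact habc (hcc _ _)
  have hbc : b ≠ c := by rintro rfl; exact habc (hbb _ _)
  have hda : d ≠ a := by rintro rfl; exact hadc (haa _ _)
  have hdb : d ≠ b := by rintro rfl; exact hdbc (haa _ _)
  have hdc : d ≠ c := by rintro rfl; exact hdbc (hcc _ _)
  -- Rescaling the representatives of `a`, `b`, `c` turns their images into the unit vectors
  -- exactly.
  let s : Fin 8 → K := fun i =>
    if i = a then bracket (v d) (v b) (v c) / bracket (v a) (v b) (v c)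
    else if i = b then bracket (v a) (v d) (v c) / bracket (v a) (v b) (v c)
    else if i = c then bracket (v a) (v b) (v d) / bracket (v a) (v b) (v c)
    else 1
  have hs : ∀ i, s i ≠ 0 := by
    intro i
    simp only [s]
    split_ifs
    exacts [div_ne_zero hdbc habc, div_ne_zero hadc habc, div_ne_zero habd habc, one_ne_zero]
  refine ⟨fun i => φ (s i • v i), ⟨_, hv.smul hs,
    bracket (v a) (v b) (v c) ^ 2 / (bracket (v d) (v b) (v c) * bracket (v a) (v d) (v c) *
      bracket (v a) (v b) (v d)), ?_, φ, fun x y z => ?_, fun i => rfl⟩, ?_, ?_, ?_, ?_⟩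
  · exact div_ne_zero (pow_ne_zero _ habc) (mul_ne_zero (mul_ne_zero hdbc hadc) habd)
  -- The map to undivided Cramer coordinates has determinant `bracket (v a) (v b) (v c) ^ 2`; the
  -- denominators are treated as independent scalars to keep the identity small.
  · have key : ∀ α β γ : K, α ≠ 0 → β ≠ 0 → γ ≠ 0 → bracket
        ![bracket x (v b) (v c) / α, bracket (v a) x (v c) / β, bracket (v a) (v b) x / γ]
        ![bracket y (v b) (v c) / α, bracket (v a) y (v c) / β, bracket (v a) (v b) y / γ]
        ![bracket z (v b) (v c) / α, bracket (v a) z (v c) / β, bracket (v a) (v b) z / γ] =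
        bracket (v a) (v b) (v c) ^ 2 / (α * β * γ) * bracket x y z := by
      intro α β γ hα hβ hγ
      generalize v a = A
      generalize v b = B
      generalize v c = C
      simp only [bracket, Matrix.cons_val]
      field_simp
      ring
    exact key _ _ _ hdbc hadc habd
  all_goals
    funext n
    simp only [φ, s, hab.symm, hac.symm, hbc.symm, hda, hdb, hdc, if_true, if_false, one_smul]
    fin_cases n <;>
      simp [bracket_smul_left, bracket_smul_middle, bracket_smul_right, haa, hbb, hcc, habc, hdbc,
        hadc, habd]

/-! ### Pairs that are not representable -/

/-- In characteristic different from two, the diagonal points of a quadrangle are not collinear. -/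
theorem not_onLine_diagonal (h2 : (2 : K) ≠ 0) {a b c d x y z : Fin 8}
    (habc : ¬ OnLine p {a, b, c}) (hdbc : ¬ OnLine p {d, b, c}) (hadc : ¬ OnLine p {a, d, c})
    (habd : ¬ OnLine p {a, b, d}) (habx : OnLine p {a, b, x}) (hcdx : OnLine p {c, d, x})
    (hacy : OnLine p {a, c, y}) (hbdy : OnLine p {b, d, y}) (hadz : OnLine p {a, d, z})
    (hbcz : OnLine p {b, c, z}) : ¬ OnLine p {x, y, z} := by
  obtain ⟨w, hw, ha, hb, hc, hd⟩ := exists_isCoord p habc hdbc hadc habd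
  rw [hw.onLine_iff] at habx hcdx hacy hbdy hadz hbcz ⊢
  have h0 : ∀ i, w i ≠ 0 := hw.ne_zero
  have hx := h0 x
  have hy := h0 y
  have hz := h0 z
  simp only [bracket, ha, hb, hc, hd, Matrix.cons_val] at habx hcdx hacy hbdy hadz hbcz
  have hx2 : w x 2 = 0 := by linear_combination habx
  have hx1 : w x 1 = w x 0 := by linear_combination hcdx
  have hy1 : w y 1 = 0 := by linear_combination -hacy
  have hy2 : w y 2 = w y 0 := by linear_combination -hbdy
  have hz0 : w z 0 = 0 := by linear_combination hbcz
  have hz2 : w z 2 = w z 1 := by linear_combination hadz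
  have hx0 : w x 0 ≠ 0 := fun h => hx (funext fun n => by fin_cases n <;> simp [*])
  have hy0 : w y 0 ≠ 0 := fun h => hy (funext fun n => by fin_cases n <;> simp [*])
  have hz1 : w z 1 ≠ 0 := fun h => hz (funext fun n => by fin_cases n <;> simp [*])
  -- The diagonal points are (1 : 1 : 0), (1 : 0 : 1), (0 : 1 : 1), whose determinant is -2.
  have key : bracket (w x) (w y) (w z) = -(2 * w x 0 * w y 0 * w z 1) := by
    simp only [bracket, hx1, hx2, hy1, hy2, hz0, hz2]
    ring
  rw [key]
  exact neg_ne_zero.2 (mul_ne_zero (mul_ne_zero (mul_ne_zero h2 hx0) hy0) hz1)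

/-- The MacLane matroid is not representable over an ordered field. -/
theorem not_representable_Q41 [LinearOrder K] [IsStrictOrderedRing K] : ¬ Representable K Q41 := by
  rintro ⟨p, hp, hI, -⟩
  have hl : ∀ i j k : Fin 8, ({i, j, k} : Finset (Fin 8)).card = 3 ∧ {i, j, k} ∈ Q41.triples →
      OnLine p {i, j, k} := fun i j k hc => (hI _ hc.1).2 hc.2
  have hn : ∀ i j k : Fin 8, ({i, j, k} : Finset (Fin 8)).card = 3 ∧ {i, j, k} ∉ Q41.triples →
      ¬ OnLine p {i, j, k} := fun i j k hc => mt (hI _ hc.1).1 hc.2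
  obtain ⟨w, hw, h0, h1, h3, h6⟩ := exists_isCoord p (hn 0 1 3 (by decide)) (hn 6 1 3 (by decide))
    (hn 0 6 3 (by decide)) (hn 0 1 6 (by decide))
  have l012 := hl 0 1 2 (by decide)
  have l034 := hl 0 3 4 (by decide)
  have l056 := hl 0 5 6 (by decide)
  have l135 := hl 1 3 5 (by decide)
  have l147 := hl 1 4 7 (by decide)
  have l246 := hl 2 4 6 (by decide)
  have l257 := hl 2 5 7 (by decide)
  have l367 := hl 3 6 7 (by decide)
  have n014 := hn 0 1 4 (by decide)
  have n023 := hn 0 2 3 (by decide)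
  have n137 := hn 1 3 7 (by decide)
  have n015 := hn 0 1 5 (by decide)
  rw [hw.onLine_iff] at l012 l034 l056 l135 l147 l246 l257 l367 n014 n023 n137 n015
  simp only [bracket, h0, h1, h3, h6, Matrix.cons_val] at l012 l034 l056 l135 l147 l246 l257 l367
  simp only [bracket, h0, h1, h3, Matrix.cons_val] at n014 n023 n137 n015
  have e2 : w 2 2 = 0 := by linear_combination l012
  have e4 : w 4 1 = 0 := by linear_combination -l034
  have e50 : w 5 0 = 0 := by linear_combination l135
  have e51 : w 5 2 = w 5 1 := by linear_combination -l056
  have e7 : w 7 1 = w 7 0 := by linear_combination l367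
  simp only [e2, e4, e50, e51, e7] at l147 l246 l257 n014 n023 n137 n015
  -- Eliminating the points 2, 5 and 7 from the three coupled equations leaves a binary quadratic
  -- form in the coordinates of point 4; its cofactors are nonzero by noncollinearity.
  have k1 : w 2 1 * w 7 0 * w 5 1 * (w 4 2 ^ 2 - w 4 0 * w 4 2 + w 4 0 ^ 2) = 0 := by
    linear_combination w 4 0 * w 4 2 * l257 + w 2 0 * w 4 2 * w 5 1 * l147 +
      (w 4 2 - w 4 0) * w 7 0 * w 5 1 * l246
  have b0 : w 2 1 ≠ 0 := fun h => n023 (by rw [h]; ring)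
  have d0 : w 4 2 ≠ 0 := fun h => n014 (by rw [h]; ring)
  have g0 : w 5 1 ≠ 0 := fun h => n015 (by rw [h]; ring)
  have h0 : w 7 0 ≠ 0 := fun h => n137 (by rw [h]; ring)
  have k2 := (mul_eq_zero.1 k1).resolve_left (mul_ne_zero (mul_ne_zero b0 h0) g0)
  have : 0 < w 4 2 ^ 2 := by positivity
  -- Four times the form is (y - 2x)² + 3y², with x = `w 4 0` and y = `w 4 2`, and y is nonzero.
  nlinarith [sq_nonneg (w 4 2 - 2 * w 4 0)]

/-- Two points that lie together on three suitable conics through two pairs of diagonal points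
coincide. -/
theorem proportional_of_conics {a b c d e f : K} (ha : a ≠ 0) (hb : b ≠ 0) (hc : c ≠ 0)
    (hd : d ≠ 0) (he : e ≠ 0) (hf : f ≠ 0)
    (h₁ : (a ^ 2 + b ^ 2 - c ^ 2) * d * e = (d ^ 2 + e ^ 2 - f ^ 2) * a * b)
    (h₂ : (a ^ 2 + c ^ 2 - b ^ 2) * d * f = (d ^ 2 + f ^ 2 - e ^ 2) * a * c)
    (h₃ : (c ^ 2 + b ^ 2 - a ^ 2) * e * f = (f ^ 2 + e ^ 2 - d ^ 2) * b * c)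
    (h : 4 * a ^ 2 * b ^ 2 - (a ^ 2 + b ^ 2 - c ^ 2) ^ 2 ≠ 0) : a * f = c * d ∧ b * f = c * e := by
  -- With a, b, c and d, e, f as sides of triangles, each hypothesis equates the cosines of
  -- corresponding angles. The common ratios P, Q, R obtained from this claim are the doubled
  -- cosines.
  have hdiv : ∀ {r s x y z t : K}, x ≠ 0 → y ≠ 0 → z ≠ 0 → t ≠ 0 → r * z * t = s * x * y →
      ∃ u, r = u * x * y ∧ s = u * z * t := by
    intro r s x y z t hx hy hz ht h
    refine ⟨r / (x * y), ?_, ?_⟩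
    · field_simp
    · field_simp
      linear_combination -h
  obtain ⟨P, hP, hP'⟩ := hdiv ha hb hd he h₁
  obtain ⟨Q, hQ, hQ'⟩ := hdiv ha hc hd hf h₂
  obtain ⟨R, hR, hR'⟩ := hdiv hb hc he hf h₃
  -- The projection formulas: a side is the sum of the projections of the other two.
  have k1 : 2 * a = P * b + Q * c := mul_left_cancel₀ ha (by linear_combination hP + hQ)
  have k2 : 2 * b = P * a + R * c := mul_left_cancel₀ hb (by linear_combination hP + hR)
  have k3 : 2 * d = P * e + Q * f := mul_left_cancel₀ hd (by linear_combination hP' + hQ')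
  have k4 : 2 * e = P * d + R * f := mul_left_cancel₀ he (by linear_combination hP' + hR')
  -- Up to a factor, `h` is the squared area, so the sine of the angle with doubled cosine P is not
  -- zero. The projection formulas can then be solved for the ratios of the sides, in the same way
  -- for both triangles.
  have hne : 4 - P ^ 2 ≠ 0 := by
    intro h0
    rw [hP] at h
    exact h (by linear_combination a ^ 2 * b ^ 2 * h0)
  constructor <;> apply mul_left_cancel₀ hne
  · linear_combination f * (2 * k1 + P * k2) - c * (2 * k3 + P * k4)
  · linear_combination f * (2 * k2 + P * k1) - c * (2 * k4 + P * k3)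

/-- The Fano candidate is not representable in characteristic different from two. -/
theorem not_representable_Q63 (h2 : (2 : K) ≠ 0) : ¬ Representable K Q63 := by
  rintro ⟨p, hp, hI, hJ⟩
  have hl : ∀ i j k : Fin 8, ({i, j, k} : Finset (Fin 8)).card = 3 ∧ {i, j, k} ∈ Q63.triples →
      OnLine p {i, j, k} := fun i j k hc => (hI _ hc.1).2 hc.2
  have hn : ∀ i j k : Fin 8, ({i, j, k} : Finset (Fin 8)).card = 3 ∧ {i, j, k} ∉ Q63.triples →
      ¬ OnLine p {i, j, k} := fun i j k hc => mt (hI _ hc.1).1 hc.2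
  have hc : ∀ e : Fin 6 → Fin 8, Function.Injective e → Finset.univ.image e ∈ Q63.sextuples →
      OnConic p (Finset.univ.image e) := fun e he hm =>
    (hJ _ (by rw [Finset.card_image_of_injective _ he]; rfl)).2 hm
  obtain ⟨u, hu, h1, h2', h3, h4⟩ := exists_isCoord p (hn 1 2 3 (by decide)) (hn 4 2 3 (by decide))
    (hn 1 4 3 (by decide)) (hn 1 2 4 (by decide))
  -- This change of coordinates has determinant 2. It makes the diagonal triangle of the
  -- quadrilateral the coordinate triangle and its four lines ±x ± y ± z = 0, so that the symmetry
  -- between the three conics is visible.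
  have hφ : ∀ x y z : Fin 3 → K, bracket ![-x 0 + x 1 + x 2, x 1 - x 2, -x 0]
      ![-y 0 + y 1 + y 2, y 1 - y 2, -y 0] ![-z 0 + z 1 + z 2, z 1 - z 2, -z 0] =
      2 * bracket x y z := by
    intro x y z
    simp only [bracket, Matrix.cons_val]
    ring
  have hw := hu.comp (φ := fun x => ![-x 0 + x 1 + x 2, x 1 - x 2, -x 0]) h2 hφ
  generalize hwu : (fun i => ![-u i 0 + u i 1 + u i 2, u i 1 - u i 2, -u i 0]) = w at hw
  have w1 : w 1 = ![-1, 0, -1] := by simp [← hwu, h1]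
  have w2 : w 2 = ![1, 1, 0] := by simp [← hwu, h2']
  have w3 : w 3 = ![1, -1, 0] := by simp [← hwu, h3]
  have w4 : w 4 = ![1, 0, -1] := by simp [← hwu, h4]
  have l012 := hl 0 1 2 (by decide)
  have l034 := hl 0 3 4 (by decide)
  have l135 := hl 1 3 5 (by decide)
  have l245 := hl 2 4 5 (by decide)
  rw [hw.onLine_iff] at l012 l034 l135 l245
  simp only [bracket, w1, w2, w3, w4, Matrix.cons_val] at l012 l034 l135 l245
  have w00 : w 0 0 = 0 := mul_left_cancel₀ h2 (by linear_combination l012 + l034)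
  have w02 : w 0 2 = -w 0 1 := mul_left_cancel₀ h2 (by linear_combination l034 - l012)
  have w50 : w 5 0 = 0 := mul_left_cancel₀ h2 (by linear_combination -l135 - l245)
  have w52 : w 5 2 = w 5 1 := mul_left_cancel₀ h2 (by linear_combination l135 - l245)
  have w0 : w 0 = ![0, w 0 1, -w 0 1] := by
    funext n
    fin_cases n
    exacts [w00, rfl, w02]
  have w5 : w 5 = ![0, w 5 1, w 5 1] := by
    funext n
    fin_cases n
    exacts [w50, rfl, w52]
  generalize w 0 1 = y at w0
  generalize w 5 1 = z at w5
  have hy : y ≠ 0 := by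
    rintro rfl
    exact hw.ne_zero 0 (by simp [w0])
  have hz : z ≠ 0 := by
    rintro rfl
    exact hw.ne_zero 5 (by simp [w5])
  have h16 : (16 : K) ≠ 0 := by
    have : (16 : K) = 2 ^ 4 := by norm_num
    rw [this]
    exact pow_ne_zero _ h2
  -- The opposite vertices 1, 4 lie on y = 0, the vertices 0, 5 on x = 0, and 2, 3 on z = 0. A conic
  -- through the first two pairs has the form x² + y² - z² = Pxy; the others are analogous. Equality
  -- of the constants at points 6 and 7 is the law of cosines condition.
  have c1 := hw.conicBracket_eq_zero hp (hc ![1, 4, 0, 5, 6, 7] (by decide) (by decide))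
    (e := ![1, 4, 0, 5, 6, 7]) (by decide) (by decide)
  have c2 := hw.conicBracket_eq_zero hp (hc ![0, 5, 2, 3, 6, 7] (by decide) (by decide))
    (e := ![0, 5, 2, 3, 6, 7]) (by decide) (by decide)
  have c3 := hw.conicBracket_eq_zero hp (hc ![1, 4, 2, 3, 6, 7] (by decide) (by decide))
    (e := ![1, 4, 2, 3, 6, 7]) (by decide) (by decide)
  have hline : ∀ i j k : Fin 8,
      ({i, j, k} : Finset (Fin 8)).card = 3 ∧ {i, j, k} ∉ Q63.triples →
      bracket (w i) (w j) (w k) ≠ 0 := fun i j k h => by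
    rw [Ne, ← hw.onLine_iff]
    exact hn i j k h
  have n056 := hline 0 5 6 (by decide)
  have n146 := hline 1 4 6 (by decide)
  have n236 := hline 2 3 6 (by decide)
  have n057 := hline 0 5 7 (by decide)
  have n147 := hline 1 4 7 (by decide)
  have n237 := hline 2 3 7 (by decide)
  have n126 := hline 1 2 6 (by decide)
  have n346 := hline 3 4 6 (by decide)
  have n136 := hline 1 3 6 (by decide)
  have n246 := hline 2 4 6 (by decide)
  have n167 := hline 1 6 7 (by decide)
  simp only [conicBracket, cremona, bracket, w0, w1, w2, w3, w4, w5, Matrix.cons_val] at c1 c2 c3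
  simp only [bracket, w0, w1, w2, w3, w4, w5, Matrix.cons_val] at n056 n146 n236 n057 n147 n237
  simp only [bracket, w1, w2, w3, w4, Matrix.cons_val] at n126 n346 n136 n246 n167
  generalize w 6 0 = a at *
  generalize w 6 1 = b at *
  generalize w 6 2 = c at *
  generalize w 7 0 = d at *
  generalize w 7 1 = e at *
  generalize w 7 2 = f at *
  have hc0 : c ≠ 0 := by rintro rfl; exact n236 (by ring)
  obtain ⟨r1, r2⟩ := proportional_of_conics (a := a) (b := b) (c := c) (d := d) (e := e) (f := f)
    (by rintro rfl; exact n056 (by ring)) (by rintro rfl; exact n146 (by ring)) hc0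
    (by rintro rfl; exact n057 (by ring)) (by rintro rfl; exact n147 (by ring))
    (by rintro rfl; exact n237 (by ring))
    (mul_left_cancel₀ (mul_ne_zero h16 (mul_ne_zero (pow_ne_zero 4 hy) (pow_ne_zero 2 hz)))
      (by linear_combination c1))
    (mul_left_cancel₀ (mul_ne_zero h16 (mul_ne_zero (pow_ne_zero 4 hy) (pow_ne_zero 4 hz)))
      (by linear_combination c2))
    (mul_left_cancel₀ h16 (by linear_combination -c3)) (by
      -- Heron's formula: the expression is, up to sign, the product of the four linear forms ±a ± b
      -- ± c, which do not vanish because point 6 lies on none of the four lines.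
      refine ne_of_eq_of_ne ?_ (neg_ne_zero.2 (mul_ne_zero (mul_ne_zero n126 n346)
        (mul_ne_zero n136 n246)))
      ring)
  -- Points 6 and 7 are proportional, so any bracket containing both vanishes; that with point 1 was
  -- known not to.
  exact n167 (mul_left_cancel₀ hc0 (by linear_combination (a - c) * r2 - b * r1))

end Frame

/-- In characteristic zero, the linear spaces that contain a Fano plane have no representation. -/
theorem not_isMatroidal_of_mem_fanoSpaces {m : ℕ} (hm : m ∈ fanoSpaces) {Q : QPair}
    (hQ : Agrees m (triples 8) Q.family) : ¬ IsMatroidal Q := by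
  rintro ⟨Q', hQ', p, hp, hI, -⟩
  have h : ∀ l ∈ triples 8, ∀ i j k : Fin 8, members (code l) = {i, j, k} →
      (OnLine p {i, j, k} ↔ m.testBit (code l) = true) := by
    intro l hl i j k hmem
    have h3 := card_members_of_mem_triples hl
    rw [← hQ l hl, QPair.mem_family_of_card_three h3, ← hQ', hmem, hI _ (hmem ▸ h3)]
  have hl : ∀ i j k : Fin 8, (∃ l ∈ triples 8, members (code l) = {i, j, k} ∧
      m.testBit (code l) = true) → OnLine p {i, j, k} := fun i j k ⟨l, hl, hmem, hm⟩ =>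
    (h l hl i j k hmem).2 hm
  have hn : ∀ i j k : Fin 8, (∃ l ∈ triples 8, members (code l) = {i, j, k} ∧
      m.testBit (code l) = false) → ¬ OnLine p {i, j, k} := fun i j k ⟨l, hl, hmem, hm⟩ hon => by
    rw [(h l hl i j k hmem).1 hon] at hm
    exact Bool.noConfusion hm
  rw [fanoSpaces, List.mem_cons, List.mem_singleton] at hm
  rcases hm with rfl | rfl
  -- Here the Fano plane consists of all labels except 3: the quadrangle 4, 5, 6, 7 with diagonal
  -- points 0, 1, 2.
  · exact not_onLine_diagonal (p := p) two_ne_zero (a := 4) (b := 5) (c := 6) (d := 7)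
      (hn _ _ _ (by decide +kernel)) (hn _ _ _ (by decide +kernel)) (hn _ _ _ (by decide +kernel))
      (hn _ _ _ (by decide +kernel)) (hl 4 5 0 (by decide +kernel)) (hl 6 7 0 (by decide +kernel))
      (hl 4 6 1 (by decide +kernel)) (hl 5 7 1 (by decide +kernel)) (hl 4 7 2 (by decide +kernel))
      (hl 5 6 2 (by decide +kernel)) (hl 0 1 2 (by decide +kernel))
  -- Here the label outside the Fano plane is 7, and the quadrangle is 3, 4, 5, 6.
  · exact not_onLine_diagonal (p := p) two_ne_zero (a := 3) (b := 4) (c := 5) (d := 6)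
      (hn _ _ _ (by decide +kernel)) (hn _ _ _ (by decide +kernel)) (hn _ _ _ (by decide +kernel))
      (hn _ _ _ (by decide +kernel)) (hl 3 4 0 (by decide +kernel)) (hl 5 6 0 (by decide +kernel))
      (hl 3 5 1 (by decide +kernel)) (hl 4 6 1 (by decide +kernel)) (hl 3 6 2 (by decide +kernel))
      (hl 4 5 2 (by decide +kernel)) (hl 0 1 2 (by decide +kernel))

end Quatroid

/-! ### The theorem -/

theorem mainTheorem5 :
    (∀ Q : Quatroid.QPair, Quatroid.IsCandidate Q →
      (Quatroid.Representable ℚ Q ↔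
        Q ∉ MulAction.orbit (Equiv.Perm (Fin 8)) Quatroid.Q41 ∧
        Q ∉ MulAction.orbit (Equiv.Perm (Fin 8)) Quatroid.Q63)) ∧
    (∀ Q ∈ MulAction.orbit (Equiv.Perm (Fin 8)) Quatroid.Q41,
      Quatroid.IsCandidate Q ∧ Quatroid.Representable ℂ Q ∧ ¬ Quatroid.Representable ℝ Q) ∧
    (∀ Q ∈ MulAction.orbit (Equiv.Perm (Fin 8)) Quatroid.Q63,
      Quatroid.IsCandidate Q ∧ ¬ Quatroid.Representable ℂ Q) := by
  open Quatroid in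
  refine ⟨fun Q hQ => ⟨fun hrep => ⟨?_, ?_⟩, fun ⟨h41, h63⟩ => ?_⟩, ?_, ?_⟩
  · rintro ⟨σ, rfl⟩
    exact not_representable_Q41 ((representable_smul_iff σ).1 hrep)
  · rintro ⟨σ, rfl⟩
    exact not_representable_Q63 two_ne_zero ((representable_smul_iff σ).1 hrep)
  -- The classification uses only the weak criteria; matroidality is used just to dismiss the Fano
  -- spaces in the first case.
  · rcases exists_agrees hQ.2.isBezout with ⟨m, hm, σ, hσ⟩ | ⟨m, hm, σ, hσ⟩ <;>
      rw [← QPair.smul_family] at hσ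
    · exact absurd (hQ.1.smul σ) (not_isMatroidal_of_mem_fanoSpaces hm hσ)
    · have horbit : ∀ Q' : QPair, σ • Q = Q' → Q ∈ MulAction.orbit (Equiv.Perm (Fin 8)) Q' := by
        rintro _ rfl
        exact ⟨σ⁻¹, inv_smul_smul σ Q⟩
      rw [targets_eq, List.mem_cons, List.mem_cons] at hm
      rcases hm with rfl | rfl | hm
      · exact absurd (horbit _ (eq_of_agrees hσ agrees_Q41)) h41
      · exact absurd (horbit _ (eq_of_agrees hσ agrees_Q63)) h63
      · exact (representable_smul_iff σ).1 (representable_of_mem_targets ℚ hm hσ)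
  · rintro _ ⟨σ, rfl⟩
    exact ⟨isCandidate_Q41.smul σ, representable_Q41.smul σ, fun h =>
      not_representable_Q41 ((representable_smul_iff σ).1 h)⟩
  · rintro _ ⟨σ, rfl⟩
    exact ⟨isCandidate_Q63.smul σ, fun h =>
      not_representable_Q63 two_ne_zero ((representable_smul_iff σ).1 h)⟩
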